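/- **Setting.** $N$ threads run a set implementation (operations insert, delete, contains on integer keys) in an asynchronous shared memory with atomic read, write and compare-and-swap; data are kept in *nodes* reached from fixed entry points. A *plain implementation* does not reclaim memory. In it every node is unallocated, then active (allocated), then possibly *retired*, by an explicit call, when it is no longer reachable, and at most once. A *reclamation scheme* for $N$ threads turns every plain implementation into an *integrated* one, in which retired nodes may be *reclaimed*: their memory becomes unallocated, returning to the system or staying available to the program, and may be reused for new nodes. A pointer is *invalid* if, at some time since the allocation its value stems from, the node it refers to was unallocated. **Robustness.** For an execution $E$ let $\mathrm{max\_active}_E(i)$ be the largest number of active nodes (allocated, not retired) in the configurations $C_0,\dots,C_i$. A scheme is *robust* (*weakly robust*) for a plain implementation if for every integrated execution $E$ there is a function $g$ with $g(x)=o(x)$ (a polynomial $g$) such that for all $i$ the number of retired, not yet reclaimed, nodes in $C_i$ is at most $g(\mathrm{max\_active}_E(i))\cdot N$. It is robust (weakly robust) if this holds for all plain implementations. **Easy integration.** A scheme is *easily integrated* if (1) it is one object, the same for all plain implementations; (2) its operations are inserted only upon the invocation or before the termination of set operations, or in place of allocations, retirements, and primitive memory accesses; (3) its operations replacing primitive memory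 accesses are linearizable implementations of these primitives, every memory address being an object; (4) histories of the integrated implementation are well-formed: a thread leaves an operation of the scheme only through its response (no roll-backs); (5) it accesses only node fields that it has added itself, apart from the field for which an operation replacing a primitive is called. It is easily integrated into one given plain implementation if (1)–(5) hold for that one. **Applicability.** A scheme is *applicable* to a plain implementation if (1) in every integrated execution, every access through an invalid pointer is to memory in program space, does not change the node, and what it reads is never used; (2) the integrated implementation is linearizable as a set if the plain one is; (3) it provides every progress guarantee (lock-freedom, wait-freedom, etc.) that the plain one provides. In (1), an operation of the scheme that replaces a read and is called with an invalid pointer counts as a read through that pointer. A scheme is *widely applicable* if it is applicable to all access-aware plain implementations, i.e. those whose code can be divided into read-only and write phases such that: pointers read in a read-only phase are obtained, within that phase, from the entry points or through pointers so obtained, or by allocating a still local node; and in a write phase reads of pointers from nodes, and all writes to nodes, go only through pointers obtained in that way by the end of the preceding read-only phase; writes to nodes happen only in write phases. (A node is local as long as it has never been reachable.) **Theorem (ERA).** Let $N\ge 2$. No reclamation scheme for $N$ threads is robust, easily integrated and widely applicable. In fact, no reclamation scheme that is easily integrated and applicable to Harris's lock-free linked list is weakly robust; and no reclamation scheme that is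 easily integrated into Harris's list and applicable to it is weakly robust even for Harris's list alone. -/

import Mathlib

open Filter Asymptotics

namespace ERA

/-! ## Values -/

/-- Keys, with `-∞` and `∞` for sentinels. -/
abbrev Key := WithBot (WithTop ℤ)

/-- A reference to a node: the address it occupies, and (as a ghost component recording where the
reference comes from) the identity of the node that was allocated there.  Identities are never
reused, addresses may be. -/
structure Ref where
  addr : ℕ
  id : ℕ
deriving DecidableEq

/-- A word: a key, a truth value, or a (possibly null) pointer with mark bits. -/
inductive Val where
  | key (k : Key)
  | bool (b : Bool)
  | ptr (r : Option Ref) (mark : ℕ)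
deriving DecidableEq

namespace Val

def null : Val := .ptr none 0

/-- The node referenced by a pointer, whatever its mark. -/
def ref? : Val → Option Ref
  | .ptr r _ => r
  | _ => none

def mark : Val → ℕ
  | .ptr _ m => m
  | _ => 0

def toKey : Val → Key
  | .key k => k
  | _ => ⊥

def isTrue : Val → Bool
  | .bool b => b
  | _ => false

def setMark (m : ℕ) : Val → Val
  | .ptr r _ => .ptr r m
  | v => v

/-- Equality of words as the hardware sees it: the ghost identities are not compared. -/
def same : Val → Val → Bool
  | .key k, .key l => decide (k = l)
  | .bool b, .bool c => decide (b = c)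
  | .ptr r m, .ptr q n => decide (r.map Ref.addr = q.map Ref.addr) && decide (m = n)
  | _, _ => false

def IsPtr : Val → Prop
  | .ptr _ _ => True
  | _ => False

end Val

/-! ## The language of data-structure implementations -/

/-- Names of local variables of a thread. -/
abbrev Var := ℕ

inductive SetOp where
  | insert
  | delete
  | contains
deriving DecidableEq

/-- Tests on local variables. Addresses can only be compared for equality. -/
inductive Cond where
  | isTrue (v : Var)
  | hasMark (v : Var) (m : ℕ)
  | same (u v : Var)
  | keys (srcs : List Var) (g : List Key → Bool)
  | neg (c : Cond)

namespace Cond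

def eval (ρ : Var → Val) : Cond → Bool
  | .isTrue v => (ρ v).isTrue
  | .hasMark v m => decide ((ρ v).mark = m)
  | .same u v => (ρ u).same (ρ v)
  | .keys srcs g => g (srcs.map fun v => (ρ v).toKey)
  | .neg c => !(c.eval ρ)

def uses : Cond → Set Var
  | .isTrue v => {v}
  | .hasMark v _ => {v}
  | .same u v => {u, v}
  | .keys srcs _ => {v | v ∈ srcs}
  | .neg c => c.uses

end Cond

/-- Instructions.  A node has fields `0, 1, 2, …`.  `aux` calls an operation of a reclamation
scheme other than the replacements of `read`, `write`, `cas`, `alloc`, `retire`. -/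
inductive Instr where
  | key (dst : Var) (k : Key)
  | bool (dst : Var) (b : Bool)
  | null (dst : Var)
  | keyOp (dst : Var) (srcs : List Var) (g : List Key → Key)
  | move (dst src : Var)
  | setMark (dst src : Var) (m : ℕ)
  | jumpIf (c : Cond) (target : ℕ)
  | goto (target : ℕ)
  | call (target : ℕ)
  | return
  | ret (src : Var)
  | global (dst : Var) (g : ℕ)
  | read (dst p : Var) (f : ℕ)
  | write (p : Var) (f : ℕ) (src : Var)
  | cas (dst p : Var) (f : ℕ) (expected new : Var)
  | alloc (dst : Var) (init : ℕ → Option Var)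
  | retire (p : Var)
  | aux (dst : Var) (k : ℕ) (args : List Var)

namespace Instr

/-- The local variables that an instruction reads. -/
def uses : Instr → Set Var
  | .key _ _ | .bool _ _ | .null _ | .goto _ | .call _ | .return | .global _ _ => ∅
  | .keyOp _ srcs _ => {v | v ∈ srcs}
  | .move _ src => {src}
  | .setMark _ src _ => {src}
  | .jumpIf c _ => c.uses
  | .ret src => {src}
  | .read _ p _ => {p}
  | .write p _ src => {p, src}
  | .cas _ p _ e d => {p, e, d}
  | .alloc _ init => {v | ∃ f, init f = some v}
  | .retire p => {p}
  | .aux _ _ args => {v | v ∈ args}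

/-- The local variable that an instruction overwrites. -/
def dst : Instr → Option Var
  | .key d _ | .bool d _ | .null d | .keyOp d _ _ | .move d _ | .setMark d _ _ | .global d _
  | .read d _ _ | .cas d _ _ _ _ | .alloc d _ | .aux d _ _ => some d
  | .jumpIf _ _ | .goto _ | .call _ | .return | .ret _ | .write _ _ _ | .retire _ => none

end Instr

/-- The code of a set implementation.  Initially there are nodes at the addresses
`0, …, init.length - 1`, with the given contents; `entry` lists the entry points, which are nodes
among these; `start o` is the first instruction of the operation `o`, which finds its argument in
variable `0`. -/
structure Program where
  init : List (ℕ → Val)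
  entry : List ℕ
  start : SetOp → ℕ
  code : ℕ → Instr

/-- The value of the `g`-th entry point. -/
def Program.global (P : Program) (g : ℕ) : Val :=
  match P.entry[g]? with
  | some a => .ptr (some ⟨a, a⟩) 0
  | none => .null

/-- Calls that a data-structure implementation issues, with their arguments.  They may be
performed directly, or by an operation of a reclamation scheme. -/
inductive Call where
  | read (p : Val) (f : ℕ)
  | write (p : Val) (f : ℕ) (v : Val)
  | cas (p : Val) (f : ℕ) (expected new : Val)
  | alloc (init : ℕ → Val)
  | retire (p : Val)
  | aux (k : ℕ) (args : List Val)

/-- The node field that a call dereferences. -/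
def Call.target : Call → Option (Ref × ℕ)
  | .read p f | .write p f _ | .cas p f _ _ => p.ref?.map fun r => (r, f)
  | .alloc _ | .retire _ | .aux _ _ => none

/-! ## Reclamation schemes as objects -/

/-- One atomic action of the code of a reclamation scheme, with the word it yields:
a local computation, an access to the shared memory of the scheme, an access to the fields that the
scheme has added to a node, a primitive access to an original field of a node, the allocation of a
node at the address `a`, the reclamation of the retired node at the address `a` (whose memory goes
back to system space or remains in program space), the return from the operation, or a roll-back
to an instruction of the data-structure implementation. -/
inductive Act (Shared X Word : Type) where
  | local (w : Word)
  | shared (g : Shared → Shared × Word)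
  | ext (r : Ref) (g : X → X × Word)
  | read (r : Ref) (f : ℕ) (k : Val → Word)
  | write (r : Ref) (f : ℕ) (v : Val) (w : Word)
  | cas (r : Ref) (f : ℕ) (expected new : Val) (k : Bool → Word)
  | allocate (a : ℕ) (k : Option Ref → Word)
  | reclaim (a : ℕ) (toSystem : Bool) (w : Word)
  | ret (v : Val)
  | rollback (pc : ℕ)

/-- An instruction of a scheme: the action and the next label depend on the current call with its
arguments, and on the registers in `srcs` only; the word yielded goes to the register `dst`. -/
structure ApiInstr (Shared X Word Reg Label : Type) where
  srcs : Set Reg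
  act : Call → (srcs → Word) → Act Shared X Word
  dst : Option Reg
  next : Call → (srcs → Word) → Label

/-- A reclamation scheme as an object for `N` threads.  `enter c` is the code that performs the
call `c`; when it is `none`, the scheme does not replace this call.  The registers are local to the
threads and keep their contents between calls; `X` is the type of the data added to a node. -/
structure Scheme.Obj (N : ℕ) where
  Shared : Type
  X : Type
  Word : Type
  Reg : Type
  Label : Type
  shared₀ : Shared
  x₀ : X
  regs₀ : Fin N → Reg → Word
  enter : Call → Option Label
  code : Label → ApiInstr Shared X Word Reg Label

/-- An implementation of a set for `N` threads together with the reclamation scheme it runs on.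
The operations of the scheme listed in `pro o` (resp. `epi o`) are called upon the invocation
(resp. before the termination) of the set operation `o`. -/
structure Integrated (N : ℕ) where
  obj : Scheme.Obj N
  pro : SetOp → List ℕ
  epi : SetOp → List ℕ
  prog : Program

/-- A reclamation scheme turns every implementation into an integrated one, in whatever way. -/
def Scheme (N : ℕ) := Program → Integrated N

/-- The object that replaces nothing. -/
def bare (N : ℕ) : Scheme.Obj N where
  Shared := Unit
  X := Unit
  Word := Unit
  Reg := Empty
  Label := Empty
  shared₀ := ()
  x₀ := ()
  regs₀ := fun _ r => r.elim
  enter := fun _ => none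
  code := fun l => l.elim

/-- A plain implementation: no reclamation at all. -/
def plain (N : ℕ) (P : Program) : Integrated N := ⟨bare N, fun _ => [], fun _ => [], P⟩

/-! ## Configurations -/

/-- The status of an address: in system space; in program space, but unallocated; occupied by an
active node; occupied by a retired node. -/
inductive Status where
  | system
  | free
  | active
  | retired
deriving DecidableEq

structure Cell (X : Type) where
  fields : ℕ → Val
  ext : X
  id : ℕ
  status : Status

/-- The control state of a thread outside the code of the scheme. -/
inductive Ctrl where
  | idle
  | pro (o : SetOp) (rest : List ℕ)
  | body (o : SetOp) (pc : ℕ)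
  | epi (o : SetOp) (rest : List ℕ) (v : Val)

/-- A pending operation of the scheme; `result` is the node it has allocated. -/
structure Frame (Label : Type) where
  call : Call
  label : Label
  result : Option Ref

variable {N : ℕ}

structure Thread (A : Scheme.Obj N) where
  ctrl : Ctrl
  stack : List ℕ
  vars : Var → Val
  frame : Option (Frame A.Label)
  regs : A.Reg → A.Word

/-- `nextId` is the identity of the next node; the addresses from `brk` on have never been used. -/
structure Config (A : Scheme.Obj N) where
  mem : ℕ → Cell A.X
  brk : ℕ
  nextId : ℕ
  shared : A.Shared
  thr : Fin N → Thread A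

/-- What a step does, as far as later definitions refer to it. `dst` is the variable or register
overwritten. -/
inductive Event (A : Scheme.Obj N) where
  | opInv (o : SetOp) (k : ℤ)
  | opRes (v : Val)
  | quiet (dst : Option Var)
  | direct (c : Call) (v : Val) (dst : Option Var)
  | apiInv (c : Call)
  | apiRes (c : Call) (v : Val) (dst : Option Var)
  | inner (a : Act A.Shared A.X A.Word) (dst : Option A.Reg)
  | allocated (a : ℕ) (init : ℕ → Val) (dst : Option A.Reg)

section Semantics

variable {A : Scheme.Obj N}

namespace Config

def setThr (c : Config A) (t : Fin N) (th : Thread A) : Config A :=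
  { c with thr := Function.update c.thr t th }

def readField (c : Config A) (r : Ref) (f : ℕ) : Val := (c.mem r.addr).fields f

def writeField (c : Config A) (r : Ref) (f : ℕ) (v : Val) : Config A :=
  { c with
    mem := Function.update c.mem r.addr
      { c.mem r.addr with fields := Function.update (c.mem r.addr).fields f v } }

def writeExt (c : Config A) (r : Ref) (x : A.X) : Config A :=
  { c with mem := Function.update c.mem r.addr { c.mem r.addr with ext := x } }

/-- Compare-and-swap, with its success flag. -/
def casField (c : Config A) (r : Ref) (f : ℕ) (expected new : Val) : Config A × Bool :=
  if (c.readField r f).same expected then (c.writeField r f new, true) else (c, false)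

/-- The node of the reference is allocated, and has been ever since the reference originated. -/
def Valid (c : Config A) (r : Ref) : Prop :=
  (c.mem r.addr).id = r.id ∧ ((c.mem r.addr).status = .active ∨ (c.mem r.addr).status = .retired)

/-- A new node at the address `a`; data added by a scheme are left as they are. -/
def allocAt (c : Config A) (a : ℕ) (init : ℕ → Val) : Config A :=
  { c with
    mem := Function.update c.mem a
      { fields := init, ext := (c.mem a).ext, id := c.nextId, status := .active }
    brk := max c.brk (a + 1)
    nextId := c.nextId + 1 }

def Unallocated (c : Config A) (a : ℕ) : Prop :=
  (c.mem a).status = .system ∨ (c.mem a).status = .free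

instance (c : Config A) (a : ℕ) : Decidable (c.Unallocated a) :=
  inferInstanceAs (Decidable (_ ∨ _))

/-- The node of the reference, if it is active, becomes retired. -/
def retireRef (c : Config A) (r : Ref) : Config A :=
  if (c.mem r.addr).id = r.id ∧ (c.mem r.addr).status = .active then
    { c with mem := Function.update c.mem r.addr { c.mem r.addr with status := .retired } }
  else c

/-- The node at the address `a`, if it is retired, is reclaimed. -/
def reclaimAt (c : Config A) (a : ℕ) (toSystem : Bool) : Config A :=
  if (c.mem a).status = .retired then
    { c with
      mem := Function.update c.mem a
        { c.mem a with status := if toSystem then .system else .free } }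
  else c

/-- A node becomes retired as soon as the implementation issues the call of `retire`. -/
def retireCall (c : Config A) : Call → Config A
  | .retire (.ptr (some r) _) => c.retireRef r
  | _ => c

end Config

/-- Performing a call directly on the memory. -/
def performDirect (c : Config A) : Call → Config A × Val
  | .read p f =>
    match p.ref? with
    | some r => (c, c.readField r f)
    | none => (c, .null)
  | .write p f v =>
    match p.ref? with
    | some r => (c.writeField r f v, .null)
    | none => (c, .null)
  | .cas p f e d =>
    match p.ref? with
    | some r => ((c.casField r f e d).1, .bool (c.casField r f e d).2)
    | none => (c, .bool false)
  | .alloc init => (c.allocAt c.brk init, .ptr (some ⟨c.brk, c.nextId⟩) 0)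
  | .retire p => (c.retireCall (.retire p), .null)
  | .aux _ _ => (c, .null)

def setVar (ρ : Var → Val) (dst : Option Var) (v : Val) : Var → Val :=
  match dst with
  | some d => Function.update ρ d v
  | none => ρ

open Classical in
noncomputable def setReg (ρ : A.Reg → A.Word) (dst : Option A.Reg) (w : A.Word) : A.Reg → A.Word :=
  match dst with
  | some d => Function.update ρ d w
  | none => ρ

/-- The value that an operation of a scheme delivers when it asks to return `v`; an operation
replacing `alloc` delivers the node it has allocated, and cannot return before. -/
def deliver (fr : Frame A.Label) (v : Val) : Option Val :=
  match fr.call with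
  | .read _ _ | .cas _ _ _ _ | .aux _ _ => some v
  | .write _ _ _ | .retire _ => some .null
  | .alloc _ => fr.result.map fun r => .ptr (some r) 0

end Semantics

namespace Integrated

variable (I : Integrated N)

/-- The instruction that the thread `t` is about to execute, or whose call is being performed. -/
def curInstr (c : Config I.obj) (t : Fin N) : Option Instr :=
  match (c.thr t).ctrl with
  | .body _ pc => some (I.prog.code pc)
  | _ => none

/-- Moving on after the call issued by the current instruction has yielded `v`. -/
def resume (th : Thread I.obj) (v : Val) : Thread I.obj × Option Var :=
  match th.ctrl with
  | .idle => ({ th with frame := none }, none)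
  | .pro o ks => ({ th with frame := none, ctrl := .pro o ks.tail }, none)
  | .body o pc =>
    ({ th with frame := none, ctrl := .body o (pc + 1),
               vars := setVar th.vars (I.prog.code pc).dst v }, (I.prog.code pc).dst)
  | .epi o ks u => ({ th with frame := none, ctrl := .epi o ks.tail u }, none)

/-- Issuing a call: the operation of the scheme is invoked, or the call is performed directly. -/
def issue (t : Fin N) (c : Config I.obj) (a : Call) : Config I.obj × Event I.obj :=
  match I.obj.enter a with
  | some l =>
    ((c.retireCall a).setThr t { c.thr t with frame := some ⟨a, l, none⟩ }, .apiInv a)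
  | none =>
    ((performDirect c a).1.setThr t (I.resume (c.thr t) (performDirect c a).2).1,
      .direct a (performDirect c a).2 (I.resume (c.thr t) (performDirect c a).2).2)

/-- A step of the thread `t` inside an operation of the scheme. -/
noncomputable def apiStep (t : Fin N) (c : Config I.obj) (fr : Frame I.obj.Label) :
    Config I.obj × Event I.obj :=
  let th := c.thr t
  let ins := I.obj.code fr.label
  let a := ins.act fr.call fun r => th.regs r
  let fr' : Frame I.obj.Label := { fr with label := ins.next fr.call fun r => th.regs r }
  -- the action has led to the configuration `d` and yielded `w`
  let go (d : Config I.obj) (w : I.obj.Word) : Config I.obj × Event I.obj :=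
    (d.setThr t { th with frame := some fr', regs := setReg th.regs ins.dst w }, .inner a ins.dst)
  match a with
  | .local w => go c w
  | .shared g => go { c with shared := (g c.shared).1 } (g c.shared).2
  | .ext r g =>
    go (c.writeExt r (g (c.mem r.addr).ext).1) (g (c.mem r.addr).ext).2
  | .read r f k => go c (k (c.readField r f))
  | .write r f v w => go (c.writeField r f v) w
  | .cas r f e d k => go (c.casField r f e d).1 (k (c.casField r f e d).2)
  | .reclaim b toSystem w => go (c.reclaimAt b toSystem) w
  | .allocate b k =>
    match fr.call, fr.result with
    | .alloc init, none =>
      if c.Unallocated b then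
        ((c.allocAt b init).setThr t
          { th with frame := some { fr' with result := some ⟨b, c.nextId⟩ },
                    regs := setReg th.regs ins.dst (k (some ⟨b, c.nextId⟩)) },
          .allocated b init ins.dst)
      else go c (k none)
    | _, _ => go c (k none)
  | .ret v =>
    match deliver fr v with
    | some u => (c.setThr t (I.resume th u).1, .apiRes fr.call u (I.resume th u).2)
    | none => (c, .quiet none)
  | .rollback pc =>
    match th.ctrl with
    | .pro o _ | .body o _ | .epi o _ _ =>
      (c.setThr t { th with frame := none, ctrl := .body o pc }, .quiet none)
    | .idle => (c.setThr t { th with frame := none }, .quiet none)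

/-- A step of the thread `t` at the instruction with number `pc`. -/
def bodyStep (t : Fin N) (c : Config I.obj) (o : SetOp) (pc : ℕ) : Config I.obj × Event I.obj :=
  let th := c.thr t
  let ρ := th.vars
  let assign (d : Var) (v : Val) : Config I.obj × Event I.obj :=
    (c.setThr t { th with ctrl := .body o (pc + 1), vars := Function.update ρ d v },
      .quiet (some d))
  let jump (q : ℕ) (st : List ℕ) : Config I.obj × Event I.obj :=
    (c.setThr t { th with ctrl := .body o q, stack := st }, .quiet none)
  match I.prog.code pc with
  | .key d k => assign d (.key k)
  | .bool d b => assign d (.bool b)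
  | .null d => assign d .null
  | .keyOp d srcs g => assign d (.key (g (srcs.map fun v => (ρ v).toKey)))
  | .move d src => assign d (ρ src)
  | .setMark d src m => assign d ((ρ src).setMark m)
  | .global d g => assign d (I.prog.global g)
  | .jumpIf b q => jump (if b.eval ρ then q else pc + 1) th.stack
  | .goto q => jump q th.stack
  | .call q => jump q ((pc + 1) :: th.stack)
  | .return => jump (th.stack.headD 0) th.stack.tail
  | .ret src =>
    (c.setThr t { th with ctrl := .epi o (I.epi o) (ρ src) }, .quiet none)
  | .read _ p f => I.issue t c (.read (ρ p) f)
  | .write p f src => I.issue t c (.write (ρ p) f (ρ src))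
  | .cas _ p f e n => I.issue t c (.cas (ρ p) f (ρ e) (ρ n))
  | .alloc _ init => I.issue t c (.alloc fun f => ((init f).map ρ).getD .null)
  | .retire p => I.issue t c (.retire (ρ p))
  | .aux _ k args => I.issue t c (.aux k (args.map ρ))

/-- A step of the thread `t`.  An idle thread invokes the operation `req`; local variables do not
survive from one operation to the next. -/
noncomputable def step (t : Fin N) (req : SetOp × ℤ) (c : Config I.obj) :
    Config I.obj × Event I.obj :=
  let th := c.thr t
  match th.frame with
  | some fr => I.apiStep t c fr
  | none =>
    match th.ctrl with
    | .idle =>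
      (c.setThr t { th with
          ctrl := .pro req.1 (I.pro req.1), stack := [],
          vars := Function.update (fun _ => .null) 0 (.key ((req.2 : WithTop ℤ) : Key)) },
        .opInv req.1 req.2)
    | .pro _ (k :: _) => I.issue t c (.aux k [])
    | .pro o [] => (c.setThr t { th with ctrl := .body o (I.prog.start o) }, .quiet none)
    | .body o pc => I.bodyStep t c o pc
    | .epi _ (k :: _) _ => I.issue t c (.aux k [])
    | .epi _ [] v => (c.setThr t { th with ctrl := .idle }, .opRes v)

/-- The initial configuration. -/
def initial : Config I.obj where
  mem := fun a =>
    match I.prog.init[a]? with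
    | some fs => { fields := fs, ext := I.obj.x₀, id := a, status := .active }
    | none => { fields := fun _ => .null, ext := I.obj.x₀, id := 0, status := .system }
  brk := I.prog.init.length
  nextId := I.prog.init.length
  shared := I.obj.shared₀
  thr := fun t =>
    { ctrl := .idle, stack := [], vars := fun _ => .null, frame := none, regs := I.obj.regs₀ t }

end Integrated

/-! ## Executions -/

/-- A schedule says which thread takes the `i`-th step, and which operation it invokes in case it
is idle.  Every thread can always take a step, and steps are deterministic; so the executions are
exactly the runs of schedules, and every finite execution is a prefix of such a run. -/
abbrev Schedule (N : ℕ) := ℕ → Fin N × SetOp × ℤ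

namespace Integrated

variable (I : Integrated N) (s : Schedule N)

/-- The `i`-th configuration of an execution. -/
noncomputable def conf : ℕ → Config I.obj
  | 0 => I.initial
  | i + 1 => (I.step (s i).1 (s i).2 (conf i)).1

/-- What happens in the step from the `i`-th to the `(i + 1)`-st configuration. -/
noncomputable def event (i : ℕ) : Event I.obj := (I.step (s i).1 (s i).2 (I.conf s i)).2

/-- The state of a thread in the `i`-th configuration. -/
noncomputable def thread (t : Fin N) (i : ℕ) : Thread I.obj := (I.conf s i).thr t

/-- The instruction of the implementation that is executed, or whose call is issued, in step `i`. -/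
noncomputable def instr (i : ℕ) : Option Instr :=
  match (I.thread s (s i).1 i).frame with
  | some _ => none
  | none => I.curInstr (I.conf s i) (s i).1

/-- In step `i` the thread `t` overwrites its local variable `v`. -/
def Writes (t : Fin N) (v : Var) (i : ℕ) : Prop :=
  (s i).1 = t ∧
    match I.event s i with
    | .opInv _ _ => True
    | .quiet d | .direct _ _ d | .apiRes _ _ d => d = some v
    | _ => False

/-- In step `i` the thread `t` reads its local variable `v`. -/
def Uses (t : Fin N) (v : Var) (i : ℕ) : Prop :=
  (s i).1 = t ∧ ∃ ins, I.instr s i = some ins ∧ v ∈ ins.uses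

/-- In step `i` the thread `t` overwrites its register `d` in the code of the scheme. -/
def WritesReg (t : Fin N) (d : I.obj.Reg) (i : ℕ) : Prop :=
  (s i).1 = t ∧
    match I.event s i with
    | .inner _ e | .allocated _ _ e => e = some d
    | _ => False

/-- In step `i` the thread `t` reads its register `d` in the code of the scheme. -/
def UsesReg (t : Fin N) (d : I.obj.Reg) (i : ℕ) : Prop :=
  (s i).1 = t ∧ ∃ fr, (I.thread s t i).frame = some fr ∧ d ∈ (I.obj.code fr.label).srcs

/-- What the variable `v` received in step `i` is never used. -/
def NeverUsed (t : Fin N) (v : Var) (i : ℕ) : Prop :=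
  ∀ j, i < j → I.Uses s t v j → ∃ k, i < k ∧ k < j ∧ I.Writes s t v k

/-- What the register `d` received in step `i` is never used. -/
def NeverUsedReg (t : Fin N) (d : I.obj.Reg) (i : ℕ) : Prop :=
  ∀ j, i < j → I.UsesReg s t d j → ∃ k, i < k ∧ k < j ∧ I.WritesReg s t d k

/-! ## Histories and linearizability -/

/-- The set operation invoked in step `i` is `o` with argument `k`. -/
def OpInv (i : ℕ) (x : SetOp × ℤ) : Prop := I.event s i = .opInv x.1 x.2

/-- The response to the set operation invoked in step `i` is `v`, in step `j`. -/
def OpRes (i j : ℕ) (v : Val) : Prop :=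
  (∃ x, I.OpInv s i x) ∧ i < j ∧ (s j).1 = (s i).1 ∧ I.event s j = .opRes v ∧
    ∀ k, i < k → k < j → (s k).1 = (s i).1 → ∀ u, I.event s k ≠ .opRes u

/-- The call `c` is issued in step `i`. -/
def Issued (i : ℕ) (c : Call) : Prop :=
  I.event s i = .apiInv c ∨ ∃ v d, I.event s i = .direct c v d

/-- The operation of the scheme invoked in step `i` responds with `v` in step `j`. -/
def ApiRes (i j : ℕ) (v : Val) : Prop :=
  ∃ c d, I.event s i = .apiInv c ∧ i < j ∧ (s j).1 = (s i).1 ∧ I.event s j = .apiRes c v d ∧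
    ∀ k, i < k → k < j → (s k).1 = (s i).1 →
      (∀ c', I.event s k ≠ .apiInv c') ∧ ∀ c' u d', I.event s k ≠ .apiRes c' u d'

end Integrated

/-- Results of a sequential run of an object. -/
def Legal {σ O R : Type} (spec : σ → O → σ × R) : σ → List (O × R) → Prop
  | _, [] => True
  | x, (o, r) :: l => (spec x o).2 = r ∧ Legal spec (spec x o).1 l

/-- Linearizability of a history of one object, where `Inv i o` says that `o` is invoked in step `i`
and `Res i j r` that the operation invoked in step `i` responds with `r` in step `j`: every prefix
can be completed by responses to some of its pending operations, dropping the others, so that the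
operations can be put into a legal sequential order that extends the real-time order. -/
def Linearizable {σ O R : Type} (spec : σ → O → σ × R) (init : σ)
    (Inv : ℕ → O → Prop) (Res : ℕ → ℕ → R → Prop) : Prop :=
  ∀ m : ℕ, ∃ L : List (ℕ × O × R),
    (L.map Prod.fst).Nodup ∧
    (∀ x ∈ L, x.1 < m ∧ Inv x.1 x.2.1) ∧
    (∀ i j r, Res i j r → j < m → ∃ o, (i, o, r) ∈ L) ∧
    L.Pairwise (fun x y => ∀ j r, Res y.1 j r → ¬ j < x.1) ∧
    Legal spec init (L.map Prod.snd)

/-- The set data type. -/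
def setSpec (S : Finset ℤ) : SetOp × ℤ → Finset ℤ × Val
  | (.insert, k) => (insert k S, .bool (decide (k ∉ S)))
  | (.delete, k) => (S.erase k, .bool (decide (k ∈ S)))
  | (.contains, k) => (S, .bool (decide (k ∈ S)))

/-- Operations on a memory word. -/
inductive WordOp where
  | read
  | write (v : Val)
  | cas (expected new : Val)

/-- A memory word. -/
def wordSpec (x : Val) : WordOp → Val × Val
  | .read => (x, x)
  | .write v => (v, .null)
  | .cas e d => if x.same e then (d, .bool true) else (x, .bool false)

/-- The operation on a memory word that a call asks for. -/
def Call.wordOp : Call → Option WordOp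
  | .read _ _ => some .read
  | .write _ _ v => some (.write v)
  | .cas _ _ e d => some (.cas e d)
  | .alloc _ | .retire _ | .aux _ _ => none

namespace Integrated

variable (I : Integrated N)

/-- The implementation is linearizable as an implementation of a set. -/
def LinearizableSet : Prop :=
  ∀ s, Linearizable setSpec ∅ (I.OpInv s) (I.OpRes s)

/-- In step `i` a node with the contents `init` is allocated at the address `a`. -/
def NewNode (s : Schedule N) (i a : ℕ) (init : ℕ → Val) : Prop :=
  (∃ d, I.event s i = .allocated a init d) ∨
    ∃ r m d, I.event s i = .direct (.alloc init) (.ptr (some r) m) d ∧ r.addr = a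

/-- The operation `w` is invoked on field `f` of the address `a` in step `i`.  The
initialization of a new node is a write. -/
def WordInv (s : Schedule N) (a f i : ℕ) (w : WordOp) : Prop :=
  (∃ c r, I.Issued s i c ∧ c.target = some (r, f) ∧ r.addr = a ∧ c.wordOp = some w) ∨
    ∃ init, I.NewNode s i a init ∧ w = .write (init f)

/-- The operation invoked on field `f` of the address `a` in step `i` responds with `v` in
step `j`. -/
def WordRes (s : Schedule N) (a f i j : ℕ) (v : Val) : Prop :=
  (∃ c r, c.target = some (r, f) ∧ r.addr = a ∧
    ((j = i ∧ ∃ d, I.event s i = .direct c v d) ∨ (I.event s i = .apiInv c ∧ I.ApiRes s i j v))) ∨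
    (j = i ∧ v = .null ∧ ∃ init, I.NewNode s i a init)

/-- The operations of the scheme that replace primitive memory accesses are linearizable
implementations of these primitives, every memory address being an object. -/
def LinearizableWords : Prop :=
  ∀ s a f, Linearizable wordSpec ((I.conf s 0).readField ⟨a, a⟩ f) (I.WordInv s a f)
    (I.WordRes s a f)

/-- Histories are well-formed: a set operation or an operation of the scheme, once invoked by a
thread, is left by that thread through its own response only. -/
def WellFormed : Prop :=
  ∀ s i j, i < j → (s j).1 = (s i).1 →
    ((∃ c, I.event s i = .apiInv c) →
      ((∃ c, I.event s j = .apiInv c) ∨ (∃ x, I.OpInv s j x) ∨ ∃ v, I.event s j = .opRes v) →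
      ∃ k, i < k ∧ k < j ∧ (s k).1 = (s i).1 ∧ ∃ c v d, I.event s k = .apiRes c v d) ∧
    ((∃ x, I.OpInv s i x) → (∃ x, I.OpInv s j x) →
      ∃ k, i < k ∧ k < j ∧ (s k).1 = (s i).1 ∧ ∃ v, I.event s k = .opRes v)

/-- The scheme does not access the original fields of nodes, except that an operation replacing a
primitive memory access applies primitives to the very field it is called for. -/
def RespectsLayout : Prop :=
  ∀ s i a d, I.event s i = .inner a d →
    match a with
    | .read r f _ | .write r f _ _ | .cas r f _ _ _ =>
      ∃ fr, (I.thread s (s i).1 i).frame = some fr ∧ fr.call.target = some (r, f)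
    | _ => True

/-! ## Progress -/

end Integrated

/-- The thread `t` takes infinitely many steps. -/
def Schedule.InfOften (s : Schedule N) (t : Fin N) : Prop := ∀ m, ∃ i, m ≤ i ∧ (s i).1 = t

/-- The schedules with respect to which progress is guaranteed: all; those in which every thread
that takes infinitely many steps runs alone for arbitrarily long intervals; those in which every
thread takes infinitely many steps. -/
inductive SchedClass where
  | all
  | isolating
  | fair

def SchedClass.Mem (s : Schedule N) : SchedClass → Prop
  | .all => True
  | .isolating => ∀ t, s.InfOften t → ∀ k, ∃ i, ∀ j, j < k → (s (i + j)).1 = t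
  | .fair => ∀ t, s.InfOften t

namespace Integrated

variable (I : Integrated N)

/-- The thread `t` has a pending operation in the `k`-th configuration, and does not starve. -/
def PendingEffective (s : Schedule N) (t : Fin N) (k : ℕ) : Prop :=
  (I.thread s t k).ctrl ≠ .idle ∧ s.InfOften t

/-- After any point where some operation is pending and effective, some operation responds. -/
def MinimalProgress (s : Schedule N) : Prop :=
  ∀ k, (∃ t, I.PendingEffective s t k) → ∃ i v, k ≤ i ∧ I.event s i = .opRes v

/-- Every operation that is pending and effective at some point responds after this point. -/
def MaximalProgress (s : Schedule N) : Prop :=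
  ∀ k t, I.PendingEffective s t k → ∃ i v, k ≤ i ∧ (s i).1 = t ∧ I.event s i = .opRes v

/-- Lock-freedom, for the class of all schedules (for the other two classes, clash-freedom and
deadlock-freedom). -/
def GuaranteesMinimal (C : SchedClass) : Prop :=
  (∀ s, C.Mem s → I.MinimalProgress s) ∧ ∃ s, C.Mem s ∧ I.MaximalProgress s

/-- Wait-freedom, for the class of all schedules (for the other two classes, obstruction-freedom
and starvation-freedom). -/
def GuaranteesMaximal (C : SchedClass) : Prop :=
  ∀ s, C.Mem s → I.MaximalProgress s

/-! ## Safety -/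

/-- The address of `r` is in program space before step `i`, and what the node
contains is not changed in that step. -/
def Harmless (s : Schedule N) (i : ℕ) (r : Ref) : Prop :=
  ((I.conf s i).mem r.addr).status ≠ .system ∧
    ((I.conf s (i + 1)).mem r.addr).fields = ((I.conf s i).mem r.addr).fields ∧
    ((I.conf s (i + 1)).mem r.addr).ext = ((I.conf s i).mem r.addr).ext

/-- Safe memory reclamation: all accesses through invalid references are to program space, do not
change the node, and what they read is never used.  Accesses are those to the memory of a node, by
a call that is performed directly or inside the code of the scheme, and also a whole operation of
the scheme that replaces a read: what it delivers counts as read from the node it is called for. -/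
def Safe : Prop :=
  ∀ s i,
    -- accesses performed directly
    (∀ c v d r f, I.event s i = .direct c v d → c.target = some (r, f) →
      ¬ (I.conf s i).Valid r →
        I.Harmless s i r ∧
        ((∃ p, c = .read p f) → ∀ x, d = some x → I.NeverUsed s (s i).1 x i)) ∧
    -- reads performed by an operation of the scheme
    (∀ p r f j v d, I.event s i = .apiInv (.read p f) → p.ref? = some r →
      ¬ (I.conf s i).Valid r → I.ApiRes s i j v → I.event s j = .apiRes (.read p f) v d →
        ∀ x, d = some x → I.NeverUsed s (s i).1 x j) ∧
    -- accesses inside the code of the scheme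
    (∀ a d, I.event s i = .inner a d →
      match a with
      | .write r _ _ _ | .cas r _ _ _ _ => ¬ (I.conf s i).Valid r → I.Harmless s i r
      | .read r _ _ | .ext r _ => ¬ (I.conf s i).Valid r →
          I.Harmless s i r ∧ ∀ x, d = some x → I.NeverUsedReg s (s i).1 x i
      | _ => True)

/-! ## Robustness -/

end Integrated

/-- The number of addresses with a given status among those ever used. -/
def Config.count {A : Scheme.Obj N} (c : Config A) (st : Status) : ℕ :=
  ((Finset.range c.brk).filter fun a => (c.mem a).status = st).card

namespace Integrated

variable (I : Integrated N)

/-- The maximal number of active nodes in the configurations up to the `i`-th one. -/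
noncomputable def maxActive (s : Schedule N) (i : ℕ) : ℕ :=
  (Finset.range (i + 1)).sup fun j => (I.conf s j).count .active

/-- In every execution, the number of retired nodes is bounded by `N` times a sublinear function of
the maximal number of active nodes so far. -/
def Robust : Prop :=
  ∀ s, ∃ g : ℕ → ℕ, (fun n => (g n : ℝ)) =o[atTop] (fun n => (n : ℝ)) ∧
    ∀ i, (I.conf s i).count .retired ≤ g (I.maxActive s i) * N

/-- In every execution, the number of retired nodes is bounded by `N` times a polynomial in the
maximal number of active nodes so far. -/
def WeaklyRobust : Prop :=
  ∀ s, ∃ p : Polynomial ℕ,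
    ∀ i, (I.conf s i).count .retired ≤ p.eval (I.maxActive s i) * N

end Integrated

/-! ## Plain implementations -/

/-- The node at the address `b` is reachable from an entry point. -/
def Reachable (P : Program) {A : Scheme.Obj N} (c : Config A) (b : ℕ) : Prop :=
  ∃ a ∈ P.entry, Relation.ReflTransGen
    (fun x y => ∃ f r, ((c.mem x).fields f).ref? = some r ∧ r.addr = y) a b

/-- Plain implementations: no use of any reclamation scheme, sound initial data, and the life-cycle
of nodes (only active nodes get retired, so each at most once, and retired nodes are
unreachable). -/
structure IsPlain (N : ℕ) (P : Program) : Prop where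
  no_aux : ∀ pc d k args, P.code pc ≠ .aux d k args
  entry_lt : ∀ a ∈ P.entry, a < P.init.length
  init_ref : ∀ fs ∈ P.init, ∀ f r, (fs f).ref? = some r → r.addr < P.init.length ∧ r.id = r.addr
  retire_active : ∀ s i p v d, (plain N P).event s i = .direct (.retire p) v d →
    ∃ r, p.ref? = some r ∧ (((plain N P).conf s i).mem r.addr).status = .active
  retired_unreachable : ∀ s i a, (((plain N P).conf s i).mem a).status = .retired →
    ¬ Reachable P ((plain N P).conf s i) a

section AccessAware

variable (N) (P : Program) (s : Schedule N)

/-- An active node that has not become reachable so far. -/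
def IsLocal (a m : ℕ) : Prop :=
  (((plain N P).conf s m).mem a).status = .active ∧
    ∀ k ≤ m, ¬ Reachable P ((plain N P).conf s k) a

/-- The last step before the `m`-th configuration in which `t` overwrites `p` is step `i`. -/
def LastWrite (t : Fin N) (p : Var) (i m : ℕ) : Prop :=
  i < m ∧ (plain N P).Writes s t p i ∧ ∀ k, i < k → k < m → ¬ (plain N P).Writes s t p k

/-- The variable `p` of the thread `t` is `j`-permitted in the `m`-th configuration: it has got its
value by an allocation of a node that is still local, from an entry point, or through a
`j`-permitted pointer, not before the `j`-th configuration. -/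
inductive Permitted (t : Fin N) (j : ℕ) : Var → ℕ → Prop
  | alloc {p i m init r} : LastWrite N P s t p i m →
      (plain N P).instr s i = some (.alloc p init) →
      ((plain N P).thread s t m).vars p = .ptr (some r) 0 →
      IsLocal N P s r.addr m → Permitted t j p m
  | global {p i m g} : LastWrite N P s t p i m →
      (plain N P).instr s i = some (.global p g) → j ≤ i + 1 → Permitted t j p m
  | deref {p q i m f} : LastWrite N P s t p i m →
      (plain N P).instr s i = some (.read p q f) → j ≤ i →
      Permitted t j q i → Permitted t j p m
  | move {p q i m} : LastWrite N P s t p i m →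
      (plain N P).instr s i = some (.move p q) →
      Permitted t j q i → Permitted t j p m
  | setMark {p q i m mk} : LastWrite N P s t p i m →
      (plain N P).instr s i = some (.setMark p q mk) →
      Permitted t j q i → Permitted t j p m

/-- The phase of the thread `t` in the `k`-th configuration, when `φ` labels the instructions by
`true` for write phases and `false` for read-only phases. -/
noncomputable def phase (φ : ℕ → Bool) (t : Fin N) (k : ℕ) : Option Bool :=
  match ((plain N P).thread s t k).ctrl with
  | .body _ pc => some (φ pc)
  | _ => none

/-- The phase of `t` that includes the `m`-th configuration has started in the `j`-th one. -/
def PhaseStart (φ : ℕ → Bool) (t : Fin N) (j m : ℕ) : Prop :=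
  j ≤ m ∧ (∀ k, j ≤ k → k ≤ m → phase N P s φ t k = phase N P s φ t m) ∧
    ∀ k, k + 1 = j → phase N P s φ t k ≠ phase N P s φ t m

/-- In the `j`-th configuration, where a write phase starts, `p` is permitted with respect to the
preceding read-only phase. -/
def Reserved (φ : ℕ → Bool) (t : Fin N) (p : Var) (j : ℕ) : Prop :=
  ∃ k b, k + 1 = j ∧ phase N P s φ t k = some false ∧ PhaseStart N P s φ t b k ∧
    Permitted N P s t b p j

/-- The code can be divided into read-only and write phases such that pointers read in a read-only
phase are permitted with respect to that phase, pointers are read in a write phase only by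
allocations, from entry points, or through pointers reserved when the phase started, and writes
occur only in write phases and through reserved pointers. -/
def AccessAware : Prop :=
  ∃ φ : ℕ → Bool, ∀ (s : Schedule N) (m : ℕ) (ins : Instr), (plain N P).instr s m = some ins →
    ∀ j, PhaseStart N P s φ (s m).1 j m →
      (phase N P s φ (s m).1 m = some false →
        match ins with
        | .alloc p _ | .global p _ | .read p _ _ =>
          (((plain N P).thread s (s m).1 (m + 1)).vars p).IsPtr →
            Permitted N P s (s m).1 j p (m + 1)
        | .write _ _ _ | .cas _ _ _ _ _ => False
        | _ => True) ∧
      (phase N P s φ (s m).1 m = some true →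
        match ins with
        | .read p q _ =>
          (((plain N P).thread s (s m).1 (m + 1)).vars p).IsPtr →
            Reserved N P s φ (s m).1 q j
        | .write p _ _ | .cas _ p _ _ _ => Reserved N P s φ (s m).1 p j
        | _ => True)

end AccessAware

/-! ## The three properties of reclamation schemes -/

namespace Scheme

variable (S : Scheme N)

/-- Inserting the object `A` into `P`: calls at the beginning and at the end of operations, and
replacements of allocations, retirements and primitive memory accesses only. -/
def Obj.insertInto (A : Obj N) (pro epi : SetOp → List ℕ) (P : Program) : Integrated N :=
  ⟨A, pro, epi, P⟩

/-- `S` is easily integrated into the implementations in a class: it is an object, the same for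
all of them, that is inserted into them only in the way above, with linearizable replacements of
primitive accesses, well-formed histories, and no access to the original fields of nodes. -/
def EasilyIntegratedInto (K : Program → Prop) : Prop :=
  ∃ (A : Obj N) (pro epi : SetOp → List ℕ), ∀ P, K P →
    S P = A.insertInto pro epi P ∧ (S P).LinearizableWords ∧ (S P).WellFormed ∧
      (S P).RespectsLayout

/-- `S` is easily integrated. -/
def EasilyIntegrated : Prop := S.EasilyIntegratedInto (IsPlain N)

/-- `S` is robust. -/
def Robust : Prop := ∀ P, IsPlain N P → (S P).Robust

/-- `S` is weakly robust. -/
def WeaklyRobust : Prop := ∀ P, IsPlain N P → (S P).WeaklyRobust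

/-- `S` is applicable to `P`: it is safe, and preserves linearizability and every progress
guarantee. -/
def ApplicableTo (P : Program) : Prop :=
  (S P).Safe ∧
  ((plain N P).LinearizableSet → (S P).LinearizableSet) ∧
  ∀ C : SchedClass,
    ((plain N P).GuaranteesMinimal C → (S P).GuaranteesMinimal C) ∧
    ((plain N P).GuaranteesMaximal C → (S P).GuaranteesMaximal C)

/-- `S` is applicable to all access-aware implementations. -/
def WidelyApplicable : Prop := ∀ P, IsPlain N P → AccessAware N P → S.ApplicableTo P

end Scheme

/-! ## Harris's linked list -/

namespace Harris

/-- Fields of nodes. -/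
def keyF : ℕ := 0
def nextF : ℕ := 1

/-- Local variables. -/
def vKey : Var := 0
def vPred : Var := 1
def vPredNext : Var := 2
def vCurr : Var := 3
def vCurrNext : Var := 4
def vTmp : Var := 5
def vFlag : Var := 6
def vNew : Var := 7
def vSucc : Var := 8
def vMarked : Var := 9
def vVictim : Var := 10

def isMarked (v : Var) : Cond := .hasMark v 1
noncomputable def keyLt (u v : Var) : Cond :=
  .keys [u, v] fun l => match l with
    | [a, b] => decide (a < b)
    | _ => false
def keyEq (u v : Var) : Cond :=
  .keys [u, v] fun l => match l with
    | [a, b] => decide (a = b)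
    | _ => false

/-- Entry points `0` and `1`: the head and the tail. -/
def head : ℕ := 0
def tail : ℕ := 1

noncomputable def code : List Instr := [
  -- 0: search; on return the window is in `vPred`, `vCurr`
  .global vPred head,
  .read vPredNext vPred nextF,
  .move vCurr vPredNext,
  .read vCurrNext vCurr nextF,
  -- 4: while marked (curr_next) or curr.key < key
  .jumpIf (isMarked vCurrNext) 7,
  .read vTmp vCurr keyF,
  .jumpIf (.neg (keyLt vTmp vKey)) 15,
  -- 7: loop body
  .jumpIf (isMarked vCurrNext) 10,
  .move vPred vCurr,
  .move vPredNext vCurrNext,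
  -- 10
  .setMark vCurr vCurrNext 0,
  .global vTmp tail,
  .jumpIf (.same vCurr vTmp) 15,
  .read vCurrNext vCurr nextF,
  .goto 4,
  -- 15: after the loop
  .jumpIf (.neg (.same vPredNext vCurr)) 19,
  .read vTmp vCurr nextF,
  .jumpIf (isMarked vTmp) 0,
  .return,
  -- 19: unlink the marked nodes between pred and curr
  .cas vFlag vPred nextF vPredNext vCurr,
  .jumpIf (.neg (.isTrue vFlag)) 0,
  .read vTmp vCurr nextF,
  .jumpIf (isMarked vTmp) 0,
  .return,
  -- 24: contains
  .call 0,
  .read vTmp vCurr nextF,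
  .jumpIf (isMarked vTmp) 31,
  .read vTmp vCurr keyF,
  .jumpIf (.neg (keyEq vTmp vKey)) 31,
  .bool vFlag true,
  .ret vFlag,
  -- 31
  .bool vFlag false,
  .ret vFlag,
  -- 33: insert
  .alloc vNew fun f => if f = keyF then some vKey else none,
  -- 34
  .call 0,
  .read vTmp vCurr keyF,
  .jumpIf (.neg (keyEq vTmp vKey)) 40,
  .retire vNew,
  .bool vFlag false,
  .ret vFlag,
  -- 40
  .write vNew nextF vCurr,
  .cas vFlag vPred nextF vCurr vNew,
  .jumpIf (.neg (.isTrue vFlag)) 34,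
  .ret vFlag,
  -- 44: delete
  .call 0,
  .read vTmp vCurr keyF,
  .jumpIf (.neg (keyEq vTmp vKey)) 59,
  .read vSucc vCurr nextF,
  .setMark vSucc vSucc 0,
  .setMark vMarked vSucc 1,
  .cas vFlag vCurr nextF vSucc vMarked,
  .jumpIf (.neg (.isTrue vFlag)) 44,
  .move vVictim vCurr,
  .cas vFlag vPred nextF vCurr vSucc,
  .jumpIf (.isTrue vFlag) 56,
  .call 0,
  -- 56
  .retire vVictim,
  .bool vFlag true,
  .ret vFlag,
  -- 59
  .bool vFlag false,
  .ret vFlag]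

/-- The head points to the tail. -/
def headNode : ℕ → Val := fun f =>
  if f = keyF then .key ⊥ else if f = nextF then .ptr (some ⟨1, 1⟩) 0 else .null

def tailNode : ℕ → Val := fun f => if f = keyF then .key ⊤ else .null

end Harris

/-- Harris's linked list, with calls of `retire`. -/
noncomputable def harris : Program where
  init := [Harris.headNode, Harris.tailNode]
  entry := [0, 1]
  start := fun o => match o with
    | .contains => 24
    | .insert => 33
    | .delete => 44
  code := fun pc => Harris.code.getD pc (.goto pc)

end ERA

/-!
A reader that is overtaken by updates makes it impossible to bound the number of retired nodes.

Let the scheme be easily integrated into Harris's list, and applicable to it. A thread `u` starts a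
membership test, reads the pointer to the first node `n 0` from the head, and is stopped. Another
thread `t` then alternately inserts a node `n (j + 1)` at the end of the list and deletes the node
`n j` in front of it. The marked next field of `n j` keeps pointing to `n (j + 1)`, so that the
deleted nodes form a chain that starts where `u` has been stopped, and at most four nodes are active
at any time. If `u` went on alone now, then it would traverse the whole chain, and at each node it
would use what it has read from there to decide how to proceed. By safety, it must not do so through
an invalid pointer; hence no node of the chain has been reclaimed (`At.valid_of_chain`), although
`t` has no way to learn whether `u` will go on. So the number of retired nodes grows without bound
(`exists_unbounded_retired`). This contradicts weak robustness, and all the more so robustness.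

For the runs of `t` and `u` to be as described, the operations of an unknown scheme have to behave.
While a thread runs alone, its calls do not overlap with others, so that linearizability of the
words of memory determines what they return (`word_response`). That they return at all
(`InCall.completes`) is a consequence of progress: Harris's list is clash-free, that is, lock-free
with respect to the schedules in which threads run alone for long enough
(`harris_guaranteesMinimal`), and the scheme preserves this guarantee; well-formedness excludes that
an operation of the scheme is left in any other way. The effects of single instructions and of whole
operations of the list in such runs are derived from the calls that they issue (`At.issue`).

Progress of the list without reclamation rests on an invariant with one assertion for each
instruction (`assertions`, `Inv`), on a rank that decreases in each step of a thread that runs alone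
(`Advances`), and on a bound for the number of nodes. The same invariant shows that Harris's list is
a plain implementation (`harris_isPlain`) and that it is access-aware (`harris_accessAware`), which
makes the theorem apply to schemes that are widely applicable.
-/

namespace ERA

/-! ### The graph of nodes of a linked list -/

section Graph

variable {X : Type}

/-- The pointer with mark `m` to the node at the address `a`, in a memory whose addresses are never
reused, so that identities and addresses of nodes agree. -/
def nd (a m : ℕ) : Val := .ptr (some ⟨a, a⟩) m

/-- The next field of a node. -/
def fld (M : ℕ → Cell X) (a : ℕ) : Val := (M a).fields 1

/-- The key of a node. -/
def nkey (M : ℕ → Cell X) (a : ℕ) : Key := ((M a).fields 0).toKey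

/-- The node `b` is the successor of `a`; the mark of `a` is disregarded. -/
def Edge (M : ℕ → Cell X) (a b : ℕ) : Prop := ∃ m, fld M a = nd b m

/-- Following next pointers leads from `a` to `b`. -/
def Reach (M : ℕ → Cell X) (a b : ℕ) : Prop := Relation.ReflTransGen (Edge M) a b

/-- Following next pointers leads from `a` to `b`, through marked nodes only (`b` is exempt). -/
def Chain (M : ℕ → Cell X) (a b : ℕ) : Prop :=
  Relation.ReflTransGen (fun x y => fld M x = nd y 1) a b

/-- The memory after the next field of `a` has received the value `v`. -/
def setFld (M : ℕ → Cell X) (a : ℕ) (v : Val) : ℕ → Cell X :=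
  Function.update M a { M a with fields := Function.update (M a).fields 1 v }

@[simp] theorem nd_mark (a m : ℕ) : (nd a m).mark = m := rfl

@[simp] theorem nd_ref? (a m : ℕ) : (nd a m).ref? = some ⟨a, a⟩ := rfl

@[simp] theorem nd_inj {a b m n : ℕ} : nd a m = nd b n ↔ a = b ∧ m = n := by
  simp [nd]

@[simp] theorem nd_same (a b m n : ℕ) :
    (nd a m).same (nd b n) = (decide (a = b) && decide (m = n)) := by
  simp [nd, Val.same]

@[simp] theorem nd_ne_null (a m : ℕ) : nd a m ≠ .null := by simp [nd, Val.null]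

theorem fld_setFld (M : ℕ → Cell X) (a b : ℕ) (v : Val) :
    fld (setFld M a v) b = if b = a then v else fld M b := by
  unfold fld setFld
  split <;> rename_i h
  · subst h; simp
  · rw [Function.update_of_ne h]

theorem nkey_setFld (M : ℕ → Cell X) (a b : ℕ) (v : Val) :
    nkey (setFld M a v) b = nkey M b := by
  unfold nkey setFld
  by_cases h : b = a
  · subst h; simp [Function.update_of_ne]
  · rw [Function.update_of_ne h]

theorem fields_setFld (M : ℕ → Cell X) (a b f : ℕ) (v : Val) (hf : f ≠ 1) :
    (setFld M a v b).fields f = (M b).fields f := by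
  unfold setFld
  by_cases h : b = a
  · subst h; simp [Function.update_of_ne hf]
  · rw [Function.update_of_ne h]

theorem status_setFld (M : ℕ → Cell X) (a b : ℕ) (v : Val) :
    (setFld M a v b).status = (M b).status := by
  unfold setFld
  by_cases h : b = a
  · subst h; simp
  · rw [Function.update_of_ne h]

theorem id_setFld (M : ℕ → Cell X) (a b : ℕ) (v : Val) :
    (setFld M a v b).id = (M b).id := by
  unfold setFld
  by_cases h : b = a
  · subst h; simp
  · rw [Function.update_of_ne h]

theorem edge_rightUnique (M : ℕ → Cell X) : Relator.RightUnique (Edge M) := by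
  rintro a b c ⟨m, hm⟩ ⟨n, hn⟩
  rw [hm] at hn
  exact (nd_inj.1 hn).1

theorem Chain.reach {M : ℕ → Cell X} {x y : ℕ} (c : Chain M x y) : Reach M x y :=
  Relation.ReflTransGen.mono (r := fun x y => fld M x = nd y 1) (fun _ _ e => ⟨1, e⟩) _ _ c

/-- An unmarked node is not passed by a chain, so that it lies beyond the end of the chain. -/
theorem Chain.reach_of_unmarked {M : ℕ → Cell X} {x y v : ℕ} (c : Chain M x y)
    (hv : Reach M x v) (hm : (fld M v).mark = 0) : Reach M y v := by
  induction c using Relation.ReflTransGen.head_induction_on with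
  | refl => exact hv
  | @head x z e _ ih =>
    rcases Relation.ReflTransGen.cases_head hv with rfl | ⟨w, hw, h2⟩
    · rw [e] at hm; exact absurd hm (by simp)
    · exact ih (edge_rightUnique M hw ⟨1, e⟩ ▸ h2)

/-- The shape of the memory of a linked list without reclamation: the addresses below `b` are in
use, `E` is the set of those nodes that have been linked into the list at some time.  Keys increase
along next pointers, the nodes `0` and `1` are the sentinels, unmarked nodes of `E` are in the
list, and retired nodes are not. -/
structure ListShape (M : ℕ → Cell X) (b : ℕ) (E : Set ℕ) : Prop where
  id_eq : ∀ a, a < b → (M a).id = a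
  status : ∀ a, a < b → (M a).status = .active ∨ (M a).status = .retired
  keyForm : ∀ a, a < b → ∃ k, (M a).fields 0 = .key k
  noRef : ∀ a f, f ≠ 1 → ((M a).fields f).ref? = none
  lt : ∀ a ∈ E, a < b
  next : ∀ a ∈ E, a ≠ 1 → ∃ d m, fld M a = nd d m ∧ m ≤ 1 ∧ d ∈ E ∧ nkey M a < nkey M d
  fld_tail : fld M 1 = .null
  fld_head : ∃ d, fld M 0 = nd d 0
  head_mem : 0 ∈ E
  tail_mem : 1 ∈ E
  key_head : nkey M 0 = ⊥
  key_tail : nkey M 1 = ⊤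
  unmarked : ∀ a ∈ E, (fld M a).mark = 0 → Reach M 0 a
  retired : ∀ a, (M a).status = .retired → ¬ Reach M 0 a

namespace ListShape

variable {M : ℕ → Cell X} {b : ℕ} {E : Set ℕ} (h : ListShape M b E)
include h

theorem edge {x y : ℕ} (hx : x ∈ E) (e : Edge M x y) : y ∈ E ∧ nkey M x < nkey M y := by
  obtain ⟨m, hm⟩ := e
  have : x ≠ 1 := by
    rintro rfl
    rw [h.fld_tail] at hm
    exact nd_ne_null _ _ hm.symm
  obtain ⟨d, m', hd, -, hE, hk⟩ := h.next x hx this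
  rw [hm, nd_inj] at hd
  exact hd.1 ▸ ⟨hE, hk⟩

theorem reach {x y : ℕ} (hx : x ∈ E) (r : Reach M x y) :
    y ∈ E ∧ (x = y ∨ nkey M x < nkey M y) := by
  induction r with
  | refl => exact ⟨hx, .inl rfl⟩
  | tail _ e ih =>
    obtain ⟨h1, h2⟩ := h.edge ih.1 e
    refine ⟨h1, .inr ?_⟩
    rcases ih.2 with rfl | h3
    · exact h2
    · exact h3.trans h2

theorem not_reach_of_lt {x y : ℕ} (hx : x ∈ E) (hk : nkey M y < nkey M x) : ¬ Reach M x y := by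
  intro r
  rcases (h.reach hx r).2 with rfl | h1
  · exact lt_irrefl _ hk
  · exact lt_asymm hk h1

theorem mem_of_reach {y : ℕ} (r : Reach M 0 y) : y ∈ E := (h.reach h.head_mem r).1

/-- The list is linearly ordered by its keys: from the successor of `p`, one reaches every node of
the list whose key exceeds the key of `p`. -/
theorem reach_next {p r v : ℕ} (hp : Reach M 0 p) (hv : Reach M 0 v) (e : Edge M p r)
    (hk : nkey M p < nkey M v) : Reach M r v := by
  rcases Relation.ReflTransGen.total_of_right_unique (edge_rightUnique M) hp hv with h1 | h1
  · rcases Relation.ReflTransGen.cases_head h1 with rfl | ⟨c, hc, h2⟩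
    · exact absurd hk (lt_irrefl _)
    · rwa [edge_rightUnique M e hc]
  · exact absurd h1 (h.not_reach_of_lt (h.mem_of_reach hv) hk)

theorem ne_tail_of_lt {x : ℕ} {k : Key} (hk : nkey M x < k) : x ≠ 1 := by
  rintro rfl
  rw [h.key_tail] at hk
  exact absurd hk not_top_lt

/-- Reachability is inherited when the nodes of `E` keep their edges. -/
theorem reach_mono {M' : ℕ → Cell X} (hE : ∀ a ∈ E, ∀ d, Edge M a d → Edge M' a d) {x y : ℕ}
    (hx : x ∈ E) (r : Reach M x y) : Reach M' x y := by
  induction r with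
  | refl => exact .refl
  | tail r e ih => exact ih.tail (hE _ (h.reach hx r).1 _ e)

end ListShape

/-- How the memory may change in a step, from the point of view of the other threads.  `own` is a
node that nobody else may link into the list, mark, or retire. -/
structure Env (M : ℕ → Cell X) (b : ℕ) (E : Set ℕ) (M' : ℕ → Cell X) (b' : ℕ) (E' : Set ℕ)
    (own : Option ℕ) : Prop where
  sub : E ⊆ E'
  le : b ≤ b'
  key : ∀ a, a < b → nkey M' a = nkey M a
  frozen : ∀ a ∈ E, (fld M a).mark = 1 → fld M' a = fld M a
  reach : ∀ x ∈ E, ∀ v, Reach M' 0 v → Reach M x v → Reach M' x v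
  old : ∀ v ∈ E, Reach M' 0 v → Reach M 0 v
  own_new : ∀ n, own = some n → n ∉ E → n ∉ E' ∧ fld M' n = fld M n
  own_status : ∀ n, own = some n → (M' n).status = (M n).status

theorem Env.rfl' (M : ℕ → Cell X) (b : ℕ) (E : Set ℕ) (own : Option ℕ) : Env M b E M b E own :=
  ⟨subset_rfl, le_rfl, fun _ _ => rfl, fun _ _ _ => rfl, fun _ _ _ _ r => r, fun _ _ r => r,
    fun _ _ h => ⟨h, rfl⟩, fun _ _ => rfl⟩

section Changes

variable {M : ℕ → Cell X} {b : ℕ} {E : Set ℕ} (h : ListShape M b E)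
include h

/-- A change of the memory that leaves the edges of the list as they are, like the allocation of a
node, a write to a node that has never been in the list, the marking or the retirement of a node. -/
theorem ListShape.of_edges {M' : ℕ → Cell X} {b' : ℕ} (hb : b ≤ b')
    (hid : ∀ a, a < b' → (M' a).id = a)
    (hst : ∀ a, a < b' → (M' a).status = .active ∨ (M' a).status = .retired)
    (hkf : ∀ a, a < b' → ∃ k, (M' a).fields 0 = .key k)
    (hnr : ∀ a f, f ≠ 1 → ((M' a).fields f).ref? = none)
    (hk : ∀ a ∈ E, nkey M' a = nkey M a)
    (hf : ∀ a ∈ E, fld M' a = fld M a ∨ ∃ d, fld M a = nd d 0 ∧ fld M' a = nd d 1 ∧ a ≠ 0)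
    (hret : ∀ a, (M' a).status = .retired → ¬ Reach M 0 a) :
    ListShape M' b' E ∧ ∀ x ∈ E, ∀ y, Reach M' x y ↔ Reach M x y := by
  have he : ∀ a ∈ E, ∀ d, Edge M' a d ↔ Edge M a d := by
    intro a ha d
    rcases hf a ha with h1 | ⟨d', h1, h2, -⟩
    · simp [Edge, h1]
    · simp [Edge, h1, h2]
  have hr : ∀ x ∈ E, ∀ y, Reach M' x y ↔ Reach M x y := by
    refine fun x hx y => ⟨fun r => ?_, fun r => h.reach_mono (fun a ha d => (he a ha d).2) hx r⟩
    have : Reach M x y ∧ y ∈ E := by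
      induction r with
      | refl => exact ⟨.refl, hx⟩
      | tail _ e ih =>
        have e' := (he _ ih.2 _).1 e
        exact ⟨ih.1.tail e', (h.edge ih.2 e').1⟩
    exact this.1
  refine ⟨⟨hid, hst, hkf, hnr, fun a ha => (h.lt a ha).trans_le hb, ?_, ?_, ?_, h.head_mem,
    h.tail_mem, ?_, ?_, ?_, ?_⟩, hr⟩
  · intro a ha ha1
    obtain ⟨d, m, h1, h2, h3, h4⟩ := h.next a ha ha1
    rw [hk a ha]
    rcases hf a ha with h5 | ⟨d', h5, h6, -⟩
    · exact ⟨d, m, h5 ▸ h1, h2, h3, by rwa [hk d h3]⟩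
    · rw [h1, nd_inj] at h5
      exact ⟨d, 1, by rw [h6, h5.1], le_rfl, h3, by rwa [hk d h3]⟩
  · rcases hf 1 h.tail_mem with h5 | ⟨d', h5, h6, -⟩
    · rw [h5, h.fld_tail]
    · rw [h.fld_tail] at h5
      exact absurd h5.symm (nd_ne_null _ _)
  · rcases hf 0 h.head_mem with h5 | ⟨d', h5, h6, h7⟩
    · rw [h5]; exact h.fld_head
    · exact absurd rfl h7
  · rw [hk _ h.head_mem, h.key_head]
  · rw [hk _ h.tail_mem, h.key_tail]
  · intro a ha hm
    rw [hr _ h.head_mem]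
    rcases hf a ha with h5 | ⟨d', h5, h6, -⟩
    · exact h.unmarked a ha (h5 ▸ hm)
    · rw [h6] at hm
      exact absurd hm (by simp)
  · intro a ha
    rw [hr _ h.head_mem]
    exact hret a ha

/-- The unlinking of the marked nodes between `p` and `r`. -/
theorem ListShape.unlink {p q r : ℕ} (hp : p ∈ E) (hq : fld M p = nd q 0) (hc : Chain M q r) :
    ListShape (setFld M p (nd r 0)) b E ∧
      (∀ v, Reach (setFld M p (nd r 0)) 0 v → Reach M 0 v) ∧
      (∀ x ∈ E, ∀ v, Reach (setFld M p (nd r 0)) 0 v → Reach M x v →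
        Reach (setFld M p (nd r 0)) x v) ∧
      (∀ v, Reach (setFld M p (nd r 0)) 0 v → nkey M p < nkey M v →
        Reach (setFld M p (nd r 0)) r v) := by
  set M' := setFld M p (nd r 0) with hM'
  have epq : Edge M p q := ⟨0, hq⟩
  have hpq := h.edge hp epq
  have hqr := h.reach hpq.1 hc.reach
  have hpr : nkey M p < nkey M r := by
    rcases hqr.2 with rfl | h1
    · exact hpq.2
    · exact hpq.2.trans h1
  have hk : ∀ a, nkey M' a = nkey M a := fun a => nkey_setFld _ _ _ _
  have hfp : fld M' p = nd r 0 := by rw [hM', fld_setFld, if_pos rfl]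
  have hf : ∀ a, a ≠ p → fld M' a = fld M a := fun a ha => by rw [hM', fld_setFld, if_neg ha]
  have hsub : ∀ x ∈ E, ∀ y, Reach M' x y → Reach M x y ∧ y ∈ E := by
    intro x hx y r'
    induction r' with
    | refl => exact ⟨.refl, hx⟩
    | @tail y z _ e ih =>
      by_cases hy : y = p
      · subst hy
        obtain ⟨m, hm⟩ := e
        rw [hfp, nd_inj] at hm
        obtain ⟨rfl, -⟩ := hm
        exact ⟨(ih.1.tail epq).trans hc.reach, hqr.1⟩
      · obtain ⟨m, hm⟩ := e
        rw [hf y hy] at hm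
        exact ⟨ih.1.tail ⟨m, hm⟩, (h.edge ih.2 ⟨m, hm⟩).1⟩
  have hRp : Reach M 0 p := h.unmarked p hp (by rw [hq]; rfl)
  -- the path to `p` does not use the edge that is replaced
  have hbelow : ∀ x y, x ∈ E → Reach M x y → nkey M y ≤ nkey M p → Reach M' x y := by
    intro x y hx r'
    induction r' with
    | refl => exact fun _ => .refl
    | @tail y z r1 e ih =>
      intro hz
      have hy := h.reach hx r1
      have hyz := h.edge hy.1 e
      refine (ih (hyz.2.le.trans hz)).tail ?_
      obtain ⟨m, hm⟩ := e
      refine ⟨m, ?_⟩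
      rw [hf, hm]
      rintro rfl
      exact absurd hyz.2 (not_lt_of_ge hz)
  have habove : ∀ x y, x ∈ E → Reach M x y → nkey M p < nkey M x → Reach M' x y := by
    intro x y hx r'
    induction r' with
    | refl => exact fun _ => .refl
    | @tail y z r1 e ih =>
      intro hz
      refine (ih hz).tail ?_
      obtain ⟨m, hm⟩ := e
      refine ⟨m, ?_⟩
      rw [hf, hm]
      rintro rfl
      rcases (h.reach hx r1).2 with rfl | h1
      · exact lt_irrefl _ hz
      · exact lt_asymm hz h1
  have hR'p : Reach M' 0 p := hbelow 0 p h.head_mem hRp le_rfl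
  have hshape0 : ∀ v, Reach M' 0 v → nkey M p < nkey M v → Reach M' r v := by
    intro v hv hkv
    rcases Relation.ReflTransGen.total_of_right_unique (edge_rightUnique M') hR'p hv with h1 | h1
    · rcases Relation.ReflTransGen.cases_head h1 with rfl | ⟨c, hc, h2⟩
      · exact absurd hkv (lt_irrefl _)
      · have : Edge M' p r := ⟨0, hfp⟩
        rwa [edge_rightUnique M' this hc]
    · exact absurd (hsub v (hsub 0 h.head_mem v hv).2 p h1).1
        (h.not_reach_of_lt (hsub 0 h.head_mem v hv).2 hkv)
  have hmono : ∀ x ∈ E, ∀ v, Reach M' 0 v → Reach M x v → Reach M' x v := by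
    intro x hx v hv hxv
    rcases lt_or_ge (nkey M p) (nkey M x) with h1 | h1
    · exact habove x v hx hxv h1
    rcases lt_or_ge (nkey M p) (nkey M v) with h2 | h2
    · -- the path from `x` to `v` passes `p`
      induction hxv using Relation.ReflTransGen.head_induction_on with
      | refl => exact .refl
      | @head x y e r1 ih =>
        have hxy := h.edge hx e
        by_cases hxp : x = p
        · subst hxp
          exact (Relation.ReflTransGen.single ⟨0, hfp⟩).trans (hshape0 v hv h2)
        · have e' : Edge M' x y := by
            obtain ⟨m, hm⟩ := e
            exact ⟨m, by rw [hf x hxp, hm]⟩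
          refine Relation.ReflTransGen.head e' ?_
          rcases lt_or_ge (nkey M p) (nkey M y) with h3 | h3
          · exact habove y v hxy.1 r1 h3
          · exact ih hxy.1 h3
    · exact hbelow x v hx hxv h2
  refine ⟨⟨?_, ?_, ?_, ?_, h.lt, ?_, ?_, ?_, h.head_mem, h.tail_mem, ?_, ?_, ?_, ?_⟩,
    fun v hv => (hsub 0 h.head_mem v hv).1, hmono, hshape0⟩
  · intro a; rw [hM', id_setFld]; exact h.id_eq a
  · intro a; rw [hM', status_setFld]; exact h.status a
  · intro a; rw [hM', fields_setFld _ _ _ _ _ (by decide)]; exact h.keyForm a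
  · intro a f hf; rw [hM', fields_setFld _ _ _ _ _ hf]; exact h.noRef a f hf
  · intro a ha ha1
    simp only [hk]
    by_cases hap : a = p
    · subst hap
      exact ⟨r, 0, hfp, by simp, hqr.1, hpr⟩
    · rw [hf a hap]
      exact h.next a ha ha1
  · rw [hf _ (h.ne_tail_of_lt hpr).symm]; exact h.fld_tail
  · by_cases h0 : 0 = p
    · subst h0; exact ⟨r, hfp⟩
    · rw [hf _ h0]; exact h.fld_head
  · rw [hk]; exact h.key_head
  · rw [hk]; exact h.key_tail
  · intro a ha hm
    by_cases hap : a = p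
    · subst hap; exact hR'p
    rw [hf a hap] at hm
    have hRa := h.unmarked a ha hm
    rcases lt_or_ge (nkey M p) (nkey M a) with h1 | h1
    · -- an unmarked node beyond `p` is not on the chain that is unlinked
      have hqa := h.reach_next hRp hRa epq h1
      have hra := hc.reach_of_unmarked hqa hm
      exact (hR'p.tail ⟨0, hfp⟩).trans (habove r a hqr.1 hra hpr)
    · exact hbelow 0 a h.head_mem hRa h1
  · intro a ha
    rw [hM', status_setFld] at ha
    exact fun hr => h.retired a ha (hsub 0 h.head_mem a hr).1

/-- The insertion of the node `n` between `p` and `q`. -/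
theorem ListShape.link {p q n : ℕ} (hp : p ∈ E) (hq : fld M p = nd q 0) (hn : n ∉ E)
    (hnb : n < b) (hna : (M n).status = .active) (hnq : fld M n = nd q 0)
    (hpn : nkey M p < nkey M n) (hnk : nkey M n < nkey M q) :
    ListShape (setFld M p (nd n 0)) b (insert n E) ∧
      Reach (setFld M p (nd n 0)) 0 n ∧
      (∀ v, Reach (setFld M p (nd n 0)) 0 v → v = n ∨ Reach M 0 v) ∧
      (∀ x ∈ E, ∀ v, Reach M x v → Reach (setFld M p (nd n 0)) x v) := by
  set M' := setFld M p (nd n 0) with hM'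
  have epq : Edge M p q := ⟨0, hq⟩
  have hpq := h.edge hp epq
  have hnp : n ≠ p := by rintro rfl; exact hn hp
  have hk : ∀ a, nkey M' a = nkey M a := fun a => nkey_setFld _ _ _ _
  have hfp : fld M' p = nd n 0 := by rw [hM', fld_setFld, if_pos rfl]
  have hf : ∀ a, a ≠ p → fld M' a = fld M a := fun a ha => by rw [hM', fld_setFld, if_neg ha]
  have hfn : fld M' n = nd q 0 := by rw [hf n hnp, hnq]
  have hup : ∀ x ∈ E, ∀ v, Reach M x v → Reach M' x v := by
    intro x hx v r
    induction r with
    | refl => exact .refl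
    | @tail y z r1 e ih =>
      by_cases hy : y = p
      · subst hy
        have : z = q := edge_rightUnique M e epq
        subst this
        exact (ih.tail ⟨0, hfp⟩).tail ⟨0, hfn⟩
      · obtain ⟨m, hm⟩ := e
        exact ih.tail ⟨m, by rw [hf y hy, hm]⟩
  have hdown : ∀ v, Reach M' 0 v → (v = n ∧ Reach M 0 p) ∨ Reach M 0 v := by
    intro v r
    induction r with
    | refl => exact .inr .refl
    | @tail y z r1 e ih =>
      rcases ih with ⟨rfl, h1⟩ | h1
      · obtain ⟨m, hm⟩ := e
        rw [hfn, nd_inj] at hm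
        obtain ⟨rfl, -⟩ := hm
        exact .inr (h1.tail epq)
      · by_cases hy : y = p
        · subst hy
          obtain ⟨m, hm⟩ := e
          rw [hfp, nd_inj] at hm
          exact .inl ⟨hm.1.symm, h1⟩
        · obtain ⟨m, hm⟩ := e
          rw [hf y hy] at hm
          exact .inr (h1.tail ⟨m, hm⟩)
  have hRp : Reach M 0 p := h.unmarked p hp (by rw [hq]; rfl)
  have hRn : Reach M' 0 n := (hup 0 h.head_mem p hRp).tail ⟨0, hfp⟩
  refine ⟨⟨?_, ?_, ?_, ?_, ?_, ?_, ?_, ?_, .inr h.head_mem, .inr h.tail_mem, ?_, ?_, ?_, ?_⟩,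
    hRn, fun v hv => (hdown v hv).imp_left And.left, hup⟩
  · intro a; rw [hM', id_setFld]; exact h.id_eq a
  · intro a; rw [hM', status_setFld]; exact h.status a
  · intro a; rw [hM', fields_setFld _ _ _ _ _ (by decide)]; exact h.keyForm a
  · intro a f hf; rw [hM', fields_setFld _ _ _ _ _ hf]; exact h.noRef a f hf
  · rintro a (rfl | ha)
    · exact hnb
    · exact h.lt a ha
  · rintro a (rfl | ha) ha1
    · exact ⟨q, 0, hfn, by simp, .inr hpq.1, by rwa [hk, hk]⟩
    · simp only [hk]
      by_cases hap : a = p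
      · subst hap
        exact ⟨n, 0, hfp, by simp, .inl rfl, hpn⟩
      · rw [hf a hap]
        obtain ⟨d, m, h1, h2, h3, h4⟩ := h.next a ha ha1
        exact ⟨d, m, h1, h2, .inr h3, h4⟩
  · rw [hf _ (h.ne_tail_of_lt hpn).symm]; exact h.fld_tail
  · by_cases h0 : 0 = p
    · subst h0; exact ⟨n, hfp⟩
    · rw [hf _ h0]; exact h.fld_head
  · rw [hk]; exact h.key_head
  · rw [hk]; exact h.key_tail
  · rintro a (rfl | ha) hm
    · exact hRn
    by_cases hap : a = p
    · subst hap; exact hup 0 h.head_mem a hRp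
    · rw [hf a hap] at hm
      exact hup 0 h.head_mem a (h.unmarked a ha hm)
  · intro a ha hr
    rw [hM', status_setFld] at ha
    rcases hdown a hr with ⟨rfl, -⟩ | h1
    · rw [hna] at ha; cases ha
    · exact h.retired a ha h1

end Changes
end Graph

/-! ### Assertions for the code of Harris's list -/

section Assertions

variable {X : Type} (fr : Bool) (M : ℕ → Cell X) (b : ℕ) (E : Set ℕ) (own : Option ℕ) (k : Key)
  (st : List ℕ) (ρ : Var → Val)

/-- The new node of a pending insertion has never been in the list. -/
def Priv (n : ℕ) : Prop :=
  ρ 7 = nd n 0 ∧ own = some n ∧ n ∉ E ∧ n < b ∧ nkey M n = k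

/-- The node `v` has been marked by the pending deletion, and awaits its retirement. -/
def Victim (v : ℕ) : Prop :=
  own = some v ∧ v ∈ E ∧ nkey M v = k ∧ (fld M v).mark = 1

/-- What the caller of a search relies on; the callers are told apart by the return address. -/
def Saved : Prop :=
  st = [25] ∨ (st = [35] ∧ ∃ n, Priv M b E own k ρ n) ∨ st = [45] ∨
    (st = [56] ∧ ∃ v, Victim M E own k v ∧ ρ 10 = nd v 0)

/-- If the victim of a deletion is still in the list, then it is reachable from `x`. -/
def VictimBeyond (x : ℕ) : Prop :=
  ∀ v, st = [56] → ρ 10 = nd v 0 → Reach M 0 v → Reach M x v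

/-- The victim of a deletion is not in the list any more. -/
def VictimGone : Prop :=
  ∀ v, st = [56] → ρ 10 = nd v 0 → ¬ Reach M 0 v

/-- The variable `vPred` is `p`, to the left of the key `k`. -/
def AtPred (p : ℕ) : Prop := ρ 1 = nd p 0 ∧ p ∈ E ∧ nkey M p < k

/-- The left end of a search window: the successor of `p` has been `q`, without a mark; and this is
still so if the thread has been running alone. -/
def AtLeft (p q : ℕ) : Prop :=
  AtPred M E k ρ p ∧ q ∈ E ∧ nkey M p < nkey M q ∧ VictimBeyond M st ρ q ∧
    (fr = true → fld M p = nd q 0)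

/-- The variables during a traversal, which has got from `q` to `c` through marked nodes. -/
def AtCurr (p q c : ℕ) : Prop :=
  AtLeft fr M E k st ρ p q ∧ ρ 2 = nd q 0 ∧ ρ 3 = nd c 0 ∧ c ∈ E ∧ Chain M q c

/-- The variable `vCurrNext` has been read from the next field of `c`. -/
def AtNext (c : ℕ) : Prop :=
  (fr = true → fld M c = ρ 4) ∧
    ((ρ 4 = .null ∧ c = 1) ∨ ∃ d m, ρ 4 = nd d m ∧ d ∈ E ∧ nkey M c < nkey M d ∧ m ≤ 1 ∧
      (m = 1 → fld M c = nd d 1) ∧ (m = 0 → nkey M c < k → VictimBeyond M st ρ d))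

/-- The result of a search: `p` to the left of the key `k`, and `c` not to the left of it. -/
def Window (p c : ℕ) : Prop :=
  AtPred M E k ρ p ∧ ρ 3 = nd c 0 ∧ c ∈ E ∧ k ≤ nkey M c ∧
    (fr = true → fld M p = nd c 0 ∧ (fld M c).mark = 0)

/-- The search has found a window, but has not made sure that its right end is unmarked. -/
def Found (p c : ℕ) : Prop := Window fr M E k ρ p c ∧ VictimBeyond M st ρ c

/-- The variable `vTmp` tells whether the right end of the window has been found marked. -/
def Checked : Prop :=
  (∃ p c, Window fr M E k ρ p c) ∧ ((ρ 5).mark ≠ 1 → VictimGone M st ρ) ∧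
    (fr = true → (ρ 5).mark ≠ 1)

/-- The deletion has marked the node `c`, and is about to unlink it. -/
def Marked (p c d : ℕ) : Prop :=
  AtPred M E k ρ p ∧ ρ 3 = nd c 0 ∧ Victim M E own k c ∧ ρ 8 = nd d 0 ∧ fld M c = nd d 1 ∧
    (fr = true → fld M p = nd c 0)

/-- The deletion has read the successor `d` of the node `c`, with mark `m`. -/
def HasSucc (p c d m : ℕ) : Prop :=
  Window fr M E k ρ p c ∧ nkey M c = k ∧ ρ 8 = nd d m ∧ d ∈ E ∧ nkey M c < nkey M d ∧
    (fr = true → fld M c = nd d m)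

/-- What holds before each instruction of the code, when a thread is executing an operation with
key `k`: `st` is its stack, `ρ` its local variables, and `own` the node that it is responsible for.
The flag `fr` says that the thread has been running alone since it has last started a search; then
what it has read from memory is up to date. -/
def assertions : List Prop := [
  Saved M b E own k st ρ,
  Saved M b E own k st ρ ∧ ρ 1 = nd 0 0,
  Saved M b E own k st ρ ∧ ∃ p q, AtLeft fr M E k st ρ p q ∧ ρ 2 = nd q 0,
  Saved M b E own k st ρ ∧ ∃ p q c, AtCurr fr M E k st ρ p q c,
  -- 4
  Saved M b E own k st ρ ∧ ∃ p q c, AtCurr fr M E k st ρ p q c ∧ AtNext fr M E k st ρ c,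
  Saved M b E own k st ρ ∧ ∃ p q c, AtCurr fr M E k st ρ p q c ∧ AtNext fr M E k st ρ c ∧
    (ρ 4).mark ≠ 1,
  Saved M b E own k st ρ ∧ ∃ p q c, AtCurr fr M E k st ρ p q c ∧ AtNext fr M E k st ρ c ∧
    (ρ 4).mark ≠ 1 ∧ ρ 5 = .key (nkey M c),
  -- 7
  Saved M b E own k st ρ ∧ ∃ p q c, AtCurr fr M E k st ρ p q c ∧ AtNext fr M E k st ρ c ∧
    ((ρ 4).mark ≠ 1 → nkey M c < k),
  Saved M b E own k st ρ ∧ ∃ p q c, AtCurr fr M E k st ρ p q c ∧ AtNext fr M E k st ρ c ∧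
    (ρ 4).mark ≠ 1 ∧ nkey M c < k,
  Saved M b E own k st ρ ∧ ∃ p d, AtLeft fr M E k st ρ p d ∧ ρ 4 = nd d 0 ∧ ρ 3 = nd p 0,
  -- 10
  Saved M b E own k st ρ ∧ ∃ p q c d m, AtLeft fr M E k st ρ p q ∧ ρ 2 = nd q 0 ∧ ρ 3 = nd c 0 ∧
    c ∈ E ∧ ρ 4 = nd d m ∧ d ∈ E ∧ Chain M q d ∧ nkey M c < nkey M d,
  Saved M b E own k st ρ ∧ ∃ p q c, AtCurr fr M E k st ρ p q c,
  Saved M b E own k st ρ ∧ (∃ p q c, AtCurr fr M E k st ρ p q c) ∧ ρ 5 = nd 1 0,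
  Saved M b E own k st ρ ∧ ∃ p q c, AtCurr fr M E k st ρ p q c,
  Saved M b E own k st ρ ∧ ∃ p q c, AtCurr fr M E k st ρ p q c ∧ AtNext fr M E k st ρ c,
  -- 15
  Saved M b E own k st ρ ∧ ∃ p q c, AtCurr fr M E k st ρ p q c ∧ k ≤ nkey M c ∧
    (fr = true → (fld M c).mark = 0),
  Saved M b E own k st ρ ∧ ∃ p c, Found fr M E k st ρ p c,
  Saved M b E own k st ρ ∧ Checked fr M E k st ρ,
  Saved M b E own k st ρ ∧ (∃ p c, Window fr M E k ρ p c) ∧ VictimGone M st ρ,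
  -- 19
  Saved M b E own k st ρ ∧ ∃ p q c, AtCurr fr M E k st ρ p q c ∧ k ≤ nkey M c ∧
    (fr = true → (fld M c).mark = 0),
  Saved M b E own k st ρ ∧ ((ρ 6).isTrue = true → ∃ p c, Found fr M E k st ρ p c) ∧
    (fr = true → (ρ 6).isTrue = true),
  Saved M b E own k st ρ ∧ ∃ p c, Found fr M E k st ρ p c,
  Saved M b E own k st ρ ∧ Checked fr M E k st ρ,
  Saved M b E own k st ρ ∧ (∃ p c, Window fr M E k ρ p c) ∧ VictimGone M st ρ,
  -- 24: contains
  st = [] ∧ fr = false,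
  st = [], st = [], st = [], st = [], st = [], st = [], st = [], st = [],
  -- 33: insert
  st = [] ∧ fr = false,
  st = [] ∧ fr = false ∧ ∃ n, Priv M b E own k ρ n,
  st = [] ∧ (∃ n, Priv M b E own k ρ n) ∧ ∃ p c, Window fr M E k ρ p c,
  st = [] ∧ (∃ n, Priv M b E own k ρ n) ∧ ∃ p c, Window fr M E k ρ p c ∧ ρ 5 = .key (nkey M c),
  -- 37
  st = [] ∧ ∃ n, Priv M b E own k ρ n,
  st = [], st = [],
  -- 40
  st = [] ∧ (∃ n, Priv M b E own k ρ n) ∧ ∃ p c, Window fr M E k ρ p c ∧ k < nkey M c,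
  st = [] ∧ ∃ n, Priv M b E own k ρ n ∧ ∃ p c, Window fr M E k ρ p c ∧ k < nkey M c ∧
    fld M n = nd c 0,
  st = [] ∧ ((ρ 6).isTrue = false → fr = false ∧ ∃ n, Priv M b E own k ρ n),
  st = [],
  -- 44: delete
  st = [] ∧ fr = false,
  st = [] ∧ ∃ p c, Window fr M E k ρ p c,
  st = [] ∧ ∃ p c, Window fr M E k ρ p c ∧ ρ 5 = .key (nkey M c),
  st = [] ∧ ∃ p c, Window fr M E k ρ p c ∧ nkey M c = k,
  st = [] ∧ ∃ p c d m, HasSucc fr M E k ρ p c d m,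
  -- 49
  st = [] ∧ ∃ p c d, HasSucc fr M E k ρ p c d 0,
  st = [] ∧ ∃ p c d, HasSucc fr M E k ρ p c d 0 ∧ ρ 9 = nd d 1,
  st = [] ∧ ((ρ 6).isTrue = true → ∃ p c d, Marked fr M E own k ρ p c d) ∧
    (fr = true → (ρ 6).isTrue = true),
  st = [] ∧ ∃ p c d, Marked fr M E own k ρ p c d,
  -- 53
  st = [] ∧ ∃ p c d, Marked fr M E own k ρ p c d ∧ ρ 10 = nd c 0,
  st = [] ∧ (∃ v, ρ 10 = nd v 0 ∧ Victim M E own k v ∧ ((ρ 6).isTrue = true → ¬ Reach M 0 v)) ∧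
    (fr = true → (ρ 6).isTrue = true),
  st = [] ∧ fr = false ∧ ∃ v, Victim M E own k v ∧ ρ 10 = nd v 0,
  -- 56
  st = [] ∧ ∃ v, Victim M E own k v ∧ ρ 10 = nd v 0 ∧ ¬ Reach M 0 v,
  st = [], st = [], st = [], st = []]

/-- The assertion before the instruction with number `pc`. -/
def Assertion (pc : ℕ) : Prop := (assertions fr M b E own k st ρ).getD pc False

end Assertions

section Stability

variable {X : Type} {fr : Bool} {M M' : ℕ → Cell X} {b b' : ℕ} {E E' : Set ℕ} {own : Option ℕ}
  {k : Key} {st : List ℕ} {ρ : Var → Val} (h : ListShape M b E) (e : Env M b E M' b' E' own)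
include h e

theorem Env.nkey_eq {a : ℕ} (ha : a ∈ E) : nkey M' a = nkey M a := e.key a (h.lt a ha)

omit h in
theorem Env.priv {n : ℕ} (hp : Priv M b E own k ρ n) : Priv M' b' E' own k ρ n := by
  obtain ⟨h1, h2, h3, h4, h5⟩ := hp
  exact ⟨h1, h2, (e.own_new n h2 h3).1, h4.trans_le e.le, by rw [e.key n h4, h5]⟩

theorem Env.victim {n : ℕ} (hp : Victim M E own k n) : Victim M' E' own k n := by
  obtain ⟨h1, h2, h3, h4⟩ := hp
  exact ⟨h1, e.sub h2, by rw [e.nkey_eq h h2, h3], by rw [e.frozen n h2 h4, h4]⟩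

theorem Env.saved (hs : Saved M b E own k st ρ) : Saved M' b' E' own k st ρ := by
  rcases hs with h1 | ⟨h1, n, h2⟩ | h1 | ⟨h1, v, h2, h3⟩
  · exact .inl h1
  · exact .inr (.inl ⟨h1, n, e.priv h2⟩)
  · exact .inr (.inr (.inl h1))
  · exact .inr (.inr (.inr ⟨h1, v, e.victim h h2, h3⟩))

omit h e in
theorem Saved.victim (hs : Saved M b E own k st ρ) {v : ℕ} (h1 : st = [56]) (h2 : ρ 10 = nd v 0) :
    Victim M E own k v := by
  subst h1
  rcases hs with h3 | ⟨h3, -⟩ | h3 | ⟨-, w, h3, h4⟩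
  · simp at h3
  · simp at h3
  · simp at h3
  · rw [h4, nd_inj] at h2
    exact h2.1 ▸ h3

omit h in
theorem Env.victimBeyond (hs : Saved M b E own k st ρ) {x : ℕ} (hx : x ∈ E)
    (hv : VictimBeyond M st ρ x) : VictimBeyond M' st ρ x := by
  intro v h1 h2 hr
  have hvE := (hs.victim h1 h2).2.1
  exact e.reach x hx v hr (hv v h1 h2 (e.old v hvE hr))

omit h in
theorem Env.victimGone (hs : Saved M b E own k st ρ)
    (hv : VictimGone M st ρ) : VictimGone M' st ρ :=
  fun v h1 h2 hr => hv v h1 h2 (e.old v (hs.victim h1 h2).2.1 hr)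

theorem Env.atPred {p : ℕ} (hp : AtPred M E k ρ p) : AtPred M' E' k ρ p :=
  ⟨hp.1, e.sub hp.2.1, by rw [e.nkey_eq h hp.2.1]; exact hp.2.2⟩

theorem Env.atLeft (hs : Saved M b E own k st ρ) {p q : ℕ}
    (hl : AtLeft fr M E k st ρ p q) : AtLeft false M' E' k st ρ p q := by
  obtain ⟨h1, h2, h3, h4, -⟩ := hl
  exact ⟨e.atPred h h1, e.sub h2, by rwa [e.nkey_eq h h1.2.1, e.nkey_eq h h2],
    e.victimBeyond hs h2 h4, by simp⟩

theorem Env.chain {q c : ℕ} (hq : q ∈ E) (hc : Chain M q c) : Chain M' q c := by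
  induction hc with
  | refl => exact .refl
  | tail r s ih =>
    exact ih.tail (by rw [e.frozen _ (h.reach hq (Chain.reach r)).1 (by rw [s]; rfl), s])

theorem Env.atCurr (hs : Saved M b E own k st ρ) {p q c : ℕ}
    (hl : AtCurr fr M E k st ρ p q c) : AtCurr false M' E' k st ρ p q c := by
  obtain ⟨h1, h2, h3, h4, h5⟩ := hl
  exact ⟨e.atLeft h hs h1, h2, h3, e.sub h4, e.chain h h1.2.1 h5⟩

theorem Env.atNext (hs : Saved M b E own k st ρ) {c : ℕ} (hc : c ∈ E)
    (hl : AtNext fr M E k st ρ c) : AtNext false M' E' k st ρ c := by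
  refine ⟨by simp, ?_⟩
  rcases hl.2 with h1 | ⟨d, m, h1, h2, h3, h4, h5, h6⟩
  · exact .inl h1
  · refine .inr ⟨d, m, h1, e.sub h2, by rwa [e.nkey_eq h hc, e.nkey_eq h h2], h4, fun hm => ?_,
      fun hm hk => ?_⟩
    · rw [e.frozen c hc (by rw [h5 hm]; rfl), h5 hm]
    · rw [e.nkey_eq h hc] at hk
      exact e.victimBeyond hs h2 (h6 hm hk)

theorem Env.window {p c : ℕ} (hw : Window fr M E k ρ p c) : Window false M' E' k ρ p c := by
  obtain ⟨h1, h2, h3, h4, -⟩ := hw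
  exact ⟨e.atPred h h1, h2, e.sub h3, by rwa [e.nkey_eq h h3], by simp⟩

theorem Env.found (hs : Saved M b E own k st ρ) {p c : ℕ} (hf : Found fr M E k st ρ p c) :
    Found false M' E' k st ρ p c :=
  ⟨e.window h hf.1, e.victimBeyond hs hf.1.2.2.1 hf.2⟩

theorem Env.checked (hs : Saved M b E own k st ρ) (hf : Checked fr M E k st ρ) :
    Checked false M' E' k st ρ := by
  obtain ⟨⟨p, c, h1⟩, h2, -⟩ := hf
  exact ⟨⟨p, c, e.window h h1⟩, fun hm => e.victimGone hs (h2 hm), by simp⟩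

theorem Env.marked {p c d : ℕ} (hm : Marked fr M E own k ρ p c d) :
    Marked false M' E' own k ρ p c d := by
  obtain ⟨h1, h2, h3, h4, h5, -⟩ := hm
  exact ⟨e.atPred h h1, h2, e.victim h h3, h4,
    by rw [e.frozen c h3.2.1 h3.2.2.2, h5], by simp⟩

theorem Env.hasSucc {p c d m : ℕ} (hm : HasSucc fr M E k ρ p c d m) :
    HasSucc false M' E' k ρ p c d m := by
  obtain ⟨h1, h2, h3, h4, h5, -⟩ := hm
  have hc := h1.2.2.1
  exact ⟨e.window h h1, by rwa [e.nkey_eq h hc], h3, e.sub h4,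
    by rwa [e.nkey_eq h hc, e.nkey_eq h h4], by simp⟩

omit h e in
theorem Assertion.lt {pc : ℕ} (ha : Assertion fr M b E own k st ρ pc) : pc < 61 := by
  by_contra hn
  unfold Assertion at ha
  rw [List.getD_eq_default] at ha
  · exact ha
  · simp only [assertions, List.length_cons, List.length_nil]
    omega

/-- The assertions survive the steps of other threads. -/
theorem Env.assertion {pc : ℕ} (ha : Assertion fr M b E own k st ρ pc) :
    Assertion false M' b' E' own k st ρ pc := by
  have hlt := ha.lt
  interval_cases pc
  · exact e.saved h ha
  · obtain ⟨hs, h1⟩ := ha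
    exact ⟨e.saved h hs, h1⟩
  · obtain ⟨hs, p, q, h1, h2⟩ := ha
    exact ⟨e.saved h hs, p, q, e.atLeft h hs h1, h2⟩
  · obtain ⟨hs, p, q, c, h1⟩ := ha
    exact ⟨e.saved h hs, p, q, c, e.atCurr h hs h1⟩
  · obtain ⟨hs, p, q, c, h1, h2⟩ := ha
    exact ⟨e.saved h hs, p, q, c, e.atCurr h hs h1, e.atNext h hs h1.2.2.2.1 h2⟩
  · obtain ⟨hs, p, q, c, h1, h2, h3⟩ := ha
    exact ⟨e.saved h hs, p, q, c, e.atCurr h hs h1, e.atNext h hs h1.2.2.2.1 h2, h3⟩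
  · obtain ⟨hs, p, q, c, h1, h2, h3, h4⟩ := ha
    exact ⟨e.saved h hs, p, q, c, e.atCurr h hs h1, e.atNext h hs h1.2.2.2.1 h2, h3,
      by rwa [e.nkey_eq h h1.2.2.2.1]⟩
  · obtain ⟨hs, p, q, c, h1, h2, h3⟩ := ha
    exact ⟨e.saved h hs, p, q, c, e.atCurr h hs h1, e.atNext h hs h1.2.2.2.1 h2,
      by rwa [e.nkey_eq h h1.2.2.2.1]⟩
  · obtain ⟨hs, p, q, c, h1, h2, h3, h4⟩ := ha
    exact ⟨e.saved h hs, p, q, c, e.atCurr h hs h1, e.atNext h hs h1.2.2.2.1 h2, h3,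
      by rwa [e.nkey_eq h h1.2.2.2.1]⟩
  · obtain ⟨hs, p, d, h1, h2, h3⟩ := ha
    exact ⟨e.saved h hs, p, d, e.atLeft h hs h1, h2, h3⟩
  · obtain ⟨hs, p, q, c, d, m, h1, h2, h3, h4, h5, h6, h7, h8⟩ := ha
    exact ⟨e.saved h hs, p, q, c, d, m, e.atLeft h hs h1, h2, h3, e.sub h4, h5, e.sub h6,
      e.chain h h1.2.1 h7, by rwa [e.nkey_eq h h4, e.nkey_eq h h6]⟩
  · obtain ⟨hs, p, q, c, h1⟩ := ha
    exact ⟨e.saved h hs, p, q, c, e.atCurr h hs h1⟩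
  · obtain ⟨hs, ⟨p, q, c, h1⟩, h2⟩ := ha
    exact ⟨e.saved h hs, ⟨p, q, c, e.atCurr h hs h1⟩, h2⟩
  · obtain ⟨hs, p, q, c, h1⟩ := ha
    exact ⟨e.saved h hs, p, q, c, e.atCurr h hs h1⟩
  · obtain ⟨hs, p, q, c, h1, h2⟩ := ha
    exact ⟨e.saved h hs, p, q, c, e.atCurr h hs h1, e.atNext h hs h1.2.2.2.1 h2⟩
  · obtain ⟨hs, p, q, c, h1, h2, -⟩ := ha
    exact ⟨e.saved h hs, p, q, c, e.atCurr h hs h1, by rwa [e.nkey_eq h h1.2.2.2.1], by simp⟩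
  · obtain ⟨hs, p, c, h1⟩ := ha
    exact ⟨e.saved h hs, p, c, e.found h hs h1⟩
  · obtain ⟨hs, h1⟩ := ha
    exact ⟨e.saved h hs, e.checked h hs h1⟩
  · obtain ⟨hs, ⟨p, c, h1⟩, h2⟩ := ha
    exact ⟨e.saved h hs, ⟨p, c, e.window h h1⟩, e.victimGone hs h2⟩
  · obtain ⟨hs, p, q, c, h1, h2, -⟩ := ha
    exact ⟨e.saved h hs, p, q, c, e.atCurr h hs h1, by rwa [e.nkey_eq h h1.2.2.2.1], by simp⟩
  · obtain ⟨hs, h1, -⟩ := ha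
    refine ⟨e.saved h hs, fun hf => ?_, by simp⟩
    obtain ⟨p, c, h2⟩ := h1 hf
    exact ⟨p, c, e.found h hs h2⟩
  · obtain ⟨hs, p, c, h1⟩ := ha
    exact ⟨e.saved h hs, p, c, e.found h hs h1⟩
  · obtain ⟨hs, h1⟩ := ha
    exact ⟨e.saved h hs, e.checked h hs h1⟩
  · obtain ⟨hs, ⟨p, c, h1⟩, h2⟩ := ha
    exact ⟨e.saved h hs, ⟨p, c, e.window h h1⟩, e.victimGone hs h2⟩
  · exact ⟨ha.1, rfl⟩
  iterate 8 exact ha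
  · exact ⟨ha.1, rfl⟩
  · obtain ⟨hs, -, n, h1⟩ := ha
    exact ⟨hs, rfl, n, e.priv h1⟩
  · obtain ⟨hs, ⟨n, h1⟩, p, c, h2⟩ := ha
    exact ⟨hs, ⟨n, e.priv h1⟩, p, c, e.window h h2⟩
  · obtain ⟨hs, ⟨n, h1⟩, p, c, h2, h3⟩ := ha
    exact ⟨hs, ⟨n, e.priv h1⟩, p, c, e.window h h2, by rwa [e.nkey_eq h h2.2.2.1]⟩
  · obtain ⟨hs, n, h1⟩ := ha
    exact ⟨hs, n, e.priv h1⟩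
  iterate 2 exact ha
  · obtain ⟨hs, ⟨n, h1⟩, p, c, h2, h3⟩ := ha
    exact ⟨hs, ⟨n, e.priv h1⟩, p, c, e.window h h2, by rwa [e.nkey_eq h h2.2.2.1]⟩
  · obtain ⟨hs, n, h1, p, c, h2, h3, h4⟩ := ha
    exact ⟨hs, n, e.priv h1, p, c, e.window h h2, by rwa [e.nkey_eq h h2.2.2.1],
      by rw [(e.own_new n h1.2.1 h1.2.2.1).2, h4]⟩
  · obtain ⟨hs, h1⟩ := ha
    refine ⟨hs, fun hf => ⟨rfl, ?_⟩⟩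
    obtain ⟨-, n, h2⟩ := h1 hf
    exact ⟨n, e.priv h2⟩
  · exact ha
  · exact ⟨ha.1, rfl⟩
  · obtain ⟨hs, p, c, h2⟩ := ha
    exact ⟨hs, p, c, e.window h h2⟩
  · obtain ⟨hs, p, c, h2, h3⟩ := ha
    exact ⟨hs, p, c, e.window h h2, by rwa [e.nkey_eq h h2.2.2.1]⟩
  · obtain ⟨hs, p, c, h2, h3⟩ := ha
    exact ⟨hs, p, c, e.window h h2, by rwa [e.nkey_eq h h2.2.2.1]⟩
  · obtain ⟨hs, p, c, d, m, h1⟩ := ha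
    exact ⟨hs, p, c, d, m, e.hasSucc h h1⟩
  · obtain ⟨hs, p, c, d, h1⟩ := ha
    exact ⟨hs, p, c, d, e.hasSucc h h1⟩
  · obtain ⟨hs, p, c, d, h1, h2⟩ := ha
    exact ⟨hs, p, c, d, e.hasSucc h h1, h2⟩
  · obtain ⟨hs, h1, -⟩ := ha
    refine ⟨hs, fun hf => ?_, by simp⟩
    obtain ⟨p, c, d, h2⟩ := h1 hf
    exact ⟨p, c, d, e.marked h h2⟩
  · obtain ⟨hs, p, c, d, h1⟩ := ha
    exact ⟨hs, p, c, d, e.marked h h1⟩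
  · obtain ⟨hs, p, c, d, h1, h2⟩ := ha
    exact ⟨hs, p, c, d, e.marked h h1, h2⟩
  · obtain ⟨hs, ⟨v, h1, h2, h3⟩, -⟩ := ha
    exact ⟨hs, ⟨v, h1, e.victim h h2, fun hf hr => h3 hf (e.old v h2.2.1 hr)⟩, by simp⟩
  · obtain ⟨hs, -, v, h1, h2⟩ := ha
    exact ⟨hs, rfl, v, e.victim h h1, h2⟩
  · obtain ⟨hs, v, h1, h2, h3⟩ := ha
    exact ⟨hs, v, e.victim h h1, h2, fun hr => h3 (e.old v h1.2.1 hr)⟩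
  iterate 4 exact ha

end Stability

/-! ### Steps of implementations -/

section LocalSteps

variable {N : ℕ} {I : Integrated N} {c : Config I.obj} {t : Fin N} {req : SetOp × ℤ}
  {o : SetOp} {pc : ℕ} {st : List ℕ} {ρ : Var → Val} {regs : I.obj.Reg → I.obj.Word}

variable (h : c.thr t = ⟨.body o pc, st, ρ, none, regs⟩)
include h

theorem step_body :
    I.step t req c = I.bodyStep t c o pc := by
  simp [Integrated.step, h]

theorem step_bool {d : Var} {x : Bool} (hi : I.prog.code pc = .bool d x) :
    I.step t req c = (c.setThr t ⟨.body o (pc + 1), st,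
      Function.update ρ d (.bool x), none, regs⟩, .quiet (some d)) := by
  simp [step_body h, Integrated.bodyStep, hi, h]

theorem step_move {d s : Var} (hi : I.prog.code pc = .move d s) :
    I.step t req c = (c.setThr t ⟨.body o (pc + 1), st,
      Function.update ρ d (ρ s), none, regs⟩, .quiet (some d)) := by
  simp [step_body h, Integrated.bodyStep, hi, h]

theorem step_setMark {d s : Var} {m : ℕ} (hi : I.prog.code pc = .setMark d s m) :
    I.step t req c = (c.setThr t ⟨.body o (pc + 1), st,
      Function.update ρ d ((ρ s).setMark m), none, regs⟩, .quiet (some d)) := by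
  simp [step_body h, Integrated.bodyStep, hi, h]

theorem step_global {d g : ℕ} (hi : I.prog.code pc = .global d g) :
    I.step t req c = (c.setThr t ⟨.body o (pc + 1), st,
      Function.update ρ d (I.prog.global g), none, regs⟩, .quiet (some d)) := by
  simp [step_body h, Integrated.bodyStep, hi, h]

theorem step_jumpIf {b : Cond} {q : ℕ} (hi : I.prog.code pc = .jumpIf b q) :
    I.step t req c = (c.setThr t ⟨.body o (if b.eval ρ then q else pc + 1), st,
      ρ, none, regs⟩, .quiet none) := by
  simp [step_body h, Integrated.bodyStep, hi, h]

theorem step_goto {q : ℕ} (hi : I.prog.code pc = .goto q) :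
    I.step t req c = (c.setThr t ⟨.body o q, st, ρ, none, regs⟩, .quiet none) := by
  simp [step_body h, Integrated.bodyStep, hi, h]

theorem step_call {q : ℕ} (hi : I.prog.code pc = .call q) :
    I.step t req c = (c.setThr t ⟨.body o q, (pc + 1) :: st, ρ, none, regs⟩,
      .quiet none) := by
  simp [step_body h, Integrated.bodyStep, hi, h]

theorem step_return (hi : I.prog.code pc = .return) :
    I.step t req c = (c.setThr t ⟨.body o (st.headD 0), st.tail, ρ, none, regs⟩,
      .quiet none) := by
  simp [step_body h, Integrated.bodyStep, hi, h]

end LocalSteps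

section PlainSteps

variable {N : ℕ} {P : Program} {c : Config (plain N P).obj} {t : Fin N} {req : SetOp × ℤ}
  {o : SetOp} {pc : ℕ} {st : List ℕ} {ρ : Var → Val}
  {regs : (plain N P).obj.Reg → (plain N P).obj.Word}

theorem plain_step_idle (h : c.thr t = ⟨.idle, st, ρ, none, regs⟩) :
    (plain N P).step t req c = (c.setThr t ⟨.pro req.1 [], [],
      Function.update (fun _ => .null) 0 (.key ((req.2 : WithTop ℤ) : Key)), none, regs⟩,
      .opInv req.1 req.2) := by
  simp [Integrated.step, h]; rfl

theorem plain_step_pro (h : c.thr t = ⟨.pro o [], st, ρ, none, regs⟩) :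
    (plain N P).step t req c = (c.setThr t ⟨.body o (P.start o), st, ρ, none, regs⟩,
      .quiet none) := by
  simp [Integrated.step, h]; rfl

theorem plain_step_epi {v : Val} (h : c.thr t = ⟨.epi o [] v, st, ρ, none, regs⟩) :
    (plain N P).step t req c = (c.setThr t ⟨.idle, st, ρ, none, regs⟩, .opRes v) := by
  simp [Integrated.step, h]

variable (h : c.thr t = ⟨.body o pc, st, ρ, none, regs⟩)
include h

theorem plain_step_ret {s : Var} (hi : P.code pc = .ret s) :
    (plain N P).step t req c = (c.setThr t ⟨.epi o [] (ρ s), st, ρ, none, regs⟩,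
      .quiet none) := by
  have hi' : (plain N P).prog.code pc = _ := hi
  simp [step_body h, Integrated.bodyStep, hi', h]; rfl

theorem plain_issue {a : Call} :
    (plain N P).issue t c a = ((performDirect c a).1.setThr t ⟨.body o (pc + 1), st,
      setVar ρ (P.code pc).dst (performDirect c a).2, none, regs⟩,
      .direct a (performDirect c a).2 (P.code pc).dst) := by
  have : (plain N P).obj.enter a = none := rfl
  simp [Integrated.issue, this, Integrated.resume, h]; exact ⟨rfl, rfl⟩

theorem plain_step_read {d p f : ℕ} (hi : P.code pc = .read d p f) {r : Ref} {m : ℕ}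
    (hp : ρ p = .ptr (some r) m) :
    (plain N P).step t req c = (c.setThr t ⟨.body o (pc + 1), st,
      Function.update ρ d ((c.mem r.addr).fields f), none, regs⟩,
      .direct (.read (ρ p) f) ((c.mem r.addr).fields f) (some d)) := by
  have hi' : (plain N P).prog.code pc = _ := hi
  simp [step_body h, Integrated.bodyStep, hi', plain_issue h, hi, Instr.dst, h, hp,
    performDirect, Val.ref?, setVar, Config.readField]

theorem plain_step_write {p f s : ℕ} (hi : P.code pc = .write p f s) {r : Ref} {m : ℕ}
    (hp : ρ p = .ptr (some r) m) :
    (plain N P).step t req c = ((c.writeField r f (ρ s)).setThr t ⟨.body o (pc + 1), st,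
      ρ, none, regs⟩, .direct (.write (ρ p) f (ρ s)) .null none) := by
  have hi' : (plain N P).prog.code pc = _ := hi
  simp [step_body h, Integrated.bodyStep, hi', plain_issue h, hi, Instr.dst, h, hp,
    performDirect, Val.ref?, setVar]

theorem plain_step_cas {d p f e n : ℕ} (hi : P.code pc = .cas d p f e n) {r : Ref} {m : ℕ}
    (hp : ρ p = .ptr (some r) m) :
    (plain N P).step t req c = ((c.casField r f (ρ e) (ρ n)).1.setThr t ⟨.body o (pc + 1), st,
      Function.update ρ d (.bool (c.casField r f (ρ e) (ρ n)).2), none, regs⟩,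
      .direct (.cas (ρ p) f (ρ e) (ρ n)) (.bool (c.casField r f (ρ e) (ρ n)).2) (some d)) := by
  have hi' : (plain N P).prog.code pc = _ := hi
  simp [step_body h, Integrated.bodyStep, hi', plain_issue h, hi, Instr.dst, h, hp,
    performDirect, Val.ref?, setVar]

theorem plain_step_alloc {d : ℕ} {i : ℕ → Option Var} (hi : P.code pc = .alloc d i) :
    (plain N P).step t req c = ((c.allocAt c.brk fun f => ((i f).map ρ).getD .null).setThr t
      ⟨.body o (pc + 1), st, Function.update ρ d (.ptr (some ⟨c.brk, c.nextId⟩) 0), none, regs⟩,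
      .direct (.alloc fun f => ((i f).map ρ).getD .null) (.ptr (some ⟨c.brk, c.nextId⟩) 0)
        (some d)) := by
  have hi' : (plain N P).prog.code pc = _ := hi
  simp [step_body h, Integrated.bodyStep, hi', plain_issue h, hi, Instr.dst, h,
    performDirect, setVar]

theorem plain_step_retire {p : ℕ} (hi : P.code pc = .retire p) {r : Ref} {m : ℕ}
    (hp : ρ p = .ptr (some r) m) :
    (plain N P).step t req c = ((c.retireRef r).setThr t ⟨.body o (pc + 1), st,
      ρ, none, regs⟩, .direct (.retire (ρ p)) .null none) := by
  have hi' : (plain N P).prog.code pc = _ := hi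
  simp [step_body h, Integrated.bodyStep, hi', plain_issue h, hi, Instr.dst, h, hp,
    performDirect, setVar, Config.retireCall]

end PlainSteps

/-! ### The changes that the code of Harris's list makes to the memory -/

section MemoryChanges

variable {X : Type} {M : ℕ → Cell X} {b : ℕ} {E : Set ℕ} (h : ListShape M b E)
include h

theorem ListShape.union_eq {M' : ℕ → Cell X} (hr : ∀ v, Reach M' 0 v → Reach M 0 v) :
    E ∪ {a | Reach M' 0 a} = E :=
  Set.union_eq_self_of_subset_right fun a ha => h.mem_of_reach (hr a ha)

theorem ListShape.env_of_edges {M' : ℕ → Cell X} {b' : ℕ} {own : Option ℕ} (hb : b ≤ b')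
    (hk : ∀ a, a < b → nkey M' a = nkey M a)
    (hf : ∀ a ∈ E, (fld M a).mark = 1 → fld M' a = fld M a)
    (hr : ∀ x ∈ E, ∀ y, Reach M' x y ↔ Reach M x y)
    (ho : ∀ n, own = some n → n ∉ E → fld M' n = fld M n)
    (hs : ∀ n, own = some n → (M' n).status = (M n).status) : Env M b E M' b' E own :=
  ⟨subset_rfl, hb, hk, hf, fun x hx v _ r => (hr x hx v).2 r,
    fun v _ r => (hr 0 h.head_mem v).1 r, fun n h1 h2 => ⟨h2, ho n h1 h2⟩, hs⟩

/-- A write to the next field of a node that has never been in the list. -/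
theorem ListShape.writePrivate {n : ℕ} (hn : n ∉ E) (v : Val) :
    ListShape (setFld M n v) b E ∧ (∀ x ∈ E, ∀ y, Reach (setFld M n v) x y ↔ Reach M x y) ∧
      ∀ own, own ≠ some n → Env M b E (setFld M n v) b E own := by
  have hf : ∀ a, a ≠ n → fld (setFld M n v) a = fld M a := fun a ha => by
    rw [fld_setFld, if_neg ha]
  have hE : ∀ a ∈ E, a ≠ n := by rintro a ha rfl; exact hn ha
  obtain ⟨h1, h2⟩ := h.of_edges (M' := setFld M n v) le_rfl
    (by intro a; rw [id_setFld]; exact h.id_eq a)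
    (by intro a; rw [status_setFld]; exact h.status a)
    (by intro a; rw [fields_setFld _ _ _ _ _ (by decide)]; exact h.keyForm a)
    (by intro a f hf; rw [fields_setFld _ _ _ _ _ hf]; exact h.noRef a f hf)
    (fun a _ => nkey_setFld _ _ _ _) (fun a ha => .inl (hf a (hE a ha)))
    (by intro a; rw [status_setFld]; exact h.retired a)
  refine ⟨h1, h2, fun own hown => h.env_of_edges le_rfl (fun a _ => nkey_setFld _ _ _ _)
    (fun a ha _ => hf a (hE a ha)) h2 ?_ (fun m _ => status_setFld _ _ _ _)⟩
  intro m hm _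
  exact hf m (by rintro rfl; exact hown hm)

theorem ListShape.markNode {c d : ℕ} (hc : c ∈ E) (hd : fld M c = nd d 0) (hc0 : c ≠ 0) :
    ListShape (setFld M c (nd d 1)) b E ∧
      (∀ x ∈ E, ∀ y, Reach (setFld M c (nd d 1)) x y ↔ Reach M x y) ∧
      ∀ own, Env M b E (setFld M c (nd d 1)) b E own := by
  have hf : ∀ a, a ≠ c → fld (setFld M c (nd d 1)) a = fld M a := fun a ha => by
    rw [fld_setFld, if_neg ha]
  obtain ⟨h1, h2⟩ := h.of_edges (M' := setFld M c (nd d 1)) le_rfl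
    (by intro a; rw [id_setFld]; exact h.id_eq a)
    (by intro a; rw [status_setFld]; exact h.status a)
    (by intro a; rw [fields_setFld _ _ _ _ _ (by decide)]; exact h.keyForm a)
    (by intro a f hf; rw [fields_setFld _ _ _ _ _ hf]; exact h.noRef a f hf)
    (fun a _ => nkey_setFld _ _ _ _)
    (by
      intro a ha
      by_cases hac : a = c
      · subst hac
        exact .inr ⟨d, hd, by rw [fld_setFld, if_pos rfl], hc0⟩
      · exact .inl (hf a hac))
    (by intro a; rw [status_setFld]; exact h.retired a)
  refine ⟨h1, h2, fun own => h.env_of_edges le_rfl (fun a _ => nkey_setFld _ _ _ _)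
    (fun a ha hm => hf a ?_) h2 (fun n _ hn => hf n ?_) (fun m _ => status_setFld _ _ _ _)⟩
  · rintro rfl
    rw [hd] at hm
    exact absurd hm (by simp)
  · rintro rfl
    exact hn hc

theorem ListShape.retireNode {v : ℕ} (hv : ¬ Reach M 0 v) :
    ListShape (Function.update M v { M v with status := .retired }) b E ∧
      (∀ x ∈ E, ∀ y, Reach (Function.update M v { M v with status := .retired }) x y ↔
        Reach M x y) ∧
      ∀ own, own ≠ some v → Env M b E (Function.update M v { M v with status := .retired }) b E
        own := by
  set M' := Function.update M v { M v with status := .retired } with hM'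
  have hfields : ∀ a, (M' a).fields = (M a).fields ∧ (M' a).id = (M a).id := by
    intro a
    by_cases ha : a = v
    · subst ha; simp [hM']
    · simp [hM', Function.update_of_ne ha]
  have hst : ∀ a, a ≠ v → (M' a).status = (M a).status := fun a ha => by
    simp [hM', Function.update_of_ne ha]
  have hk : ∀ a, nkey M' a = nkey M a := fun a => by simp [nkey, (hfields a).1]
  have hf : ∀ a, fld M' a = fld M a := fun a => by simp [fld, (hfields a).1]
  obtain ⟨h1, h2⟩ := h.of_edges (M' := M') le_rfl
    (by intro a; rw [(hfields a).2]; exact h.id_eq a)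
    (by
      intro a ha
      by_cases hav : a = v
      · subst hav; right; simp [hM']
      · rw [hst a hav]; exact h.status a ha)
    (by intro a; rw [(hfields a).1]; exact h.keyForm a)
    (by intro a; rw [(hfields a).1]; exact h.noRef a)
    (fun a _ => hk a) (fun a _ => .inl (hf a))
    (by
      intro a ha
      by_cases hav : a = v
      · subst hav; exact hv
      · rw [hst a hav] at ha; exact h.retired a ha)
  exact ⟨h1, h2, fun own hown => h.env_of_edges le_rfl (fun a _ => hk a) (fun a _ _ => hf a) h2
    (fun n _ _ => hf n) (fun n hn => hst n (by rintro rfl; exact hown hn))⟩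

theorem ListShape.allocNode {x : X} {fs : ℕ → Val} (hkey : ∃ k, fs 0 = .key k)
    (href : ∀ f, f ≠ 1 → (fs f).ref? = none) :
    ListShape (Function.update M b ⟨fs, x, b, .active⟩) (b + 1) E ∧
      (∀ x' ∈ E, ∀ y, Reach (Function.update M b ⟨fs, x, b, .active⟩) x' y ↔ Reach M x' y) ∧
      ∀ own, (∀ n, own = some n → n < b) →
        Env M b E (Function.update M b ⟨fs, x, b, .active⟩) (b + 1) E own := by
  set M' : ℕ → Cell X := Function.update M b ⟨fs, x, b, .active⟩ with hM'
  have hb : M' b = ⟨fs, x, b, .active⟩ := by simp [hM']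
  have hne : ∀ a, a ≠ b → M' a = M a := fun a ha => by simp [hM', Function.update_of_ne ha]
  have hf : ∀ a, a < b → fld M' a = fld M a := fun a ha => by simp [fld, hne a ha.ne]
  have hk : ∀ a, a < b → nkey M' a = nkey M a := fun a ha => by simp [nkey, hne a ha.ne]
  obtain ⟨h1, h2⟩ := h.of_edges (M' := M') (Nat.le_succ b)
    (by
      intro a ha
      rcases Nat.lt_succ_iff_lt_or_eq.1 ha with h1 | rfl
      · rw [hne a h1.ne]; exact h.id_eq a h1
      · rw [hb])
    (by
      intro a ha
      rcases Nat.lt_succ_iff_lt_or_eq.1 ha with h1 | rfl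
      · rw [hne a h1.ne]; exact h.status a h1
      · rw [hb]; exact .inl rfl)
    (by
      intro a ha
      rcases Nat.lt_succ_iff_lt_or_eq.1 ha with h1 | rfl
      · rw [hne a h1.ne]; exact h.keyForm a h1
      · rw [hb]; exact hkey)
    (by
      intro a f hf1
      by_cases hab : a = b
      · rw [hab, hb]; exact href f hf1
      · rw [hne a hab]; exact h.noRef a f hf1)
    (fun a ha => hk a (h.lt a ha)) (fun a ha => .inl (hf a (h.lt a ha)))
    (by
      intro a ha
      by_cases hab : a = b
      · subst hab; rw [hb] at ha; cases ha
      · rw [hne a hab] at ha; exact h.retired a ha)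
  exact ⟨h1, h2, fun own hown => h.env_of_edges (Nat.le_succ b) hk
    (fun a ha _ => hf a (h.lt a ha)) h2 (fun n hn _ => hf n (hown n hn))
    (fun n hn => by rw [hne n (hown n hn).ne])⟩

theorem ListShape.env_unlink {p q r : ℕ} (hp : p ∈ E) (hq : fld M p = nd q 0) (hc : Chain M q r)
    (own : Option ℕ) : Env M b E (setFld M p (nd r 0)) b E own := by
  obtain ⟨-, h2, h3, -⟩ := h.unlink hp hq hc
  have hf : ∀ a, a ≠ p → fld (setFld M p (nd r 0)) a = fld M a := fun a ha => by
    rw [fld_setFld, if_neg ha]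
  refine ⟨subset_rfl, le_rfl, fun a _ => nkey_setFld _ _ _ _, fun a ha hm => hf a ?_, h3,
    fun v _ => h2 v, fun n _ hn => ⟨hn, hf n ?_⟩, fun n _ => status_setFld _ _ _ _⟩
  · rintro rfl
    rw [hq] at hm
    exact absurd hm (by simp)
  · rintro rfl
    exact hn hp

theorem ListShape.env_link {p q n : ℕ} (hp : p ∈ E) (hq : fld M p = nd q 0) (hn : n ∉ E)
    (hnb : n < b) (hna : (M n).status = .active) (hnq : fld M n = nd q 0)
    (hpn : nkey M p < nkey M n) (hnk : nkey M n < nkey M q)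
    (own : Option ℕ) (hown : own ≠ some n) :
    Env M b E (setFld M p (nd n 0)) b (insert n E) own := by
  obtain ⟨-, -, h2, h3⟩ := h.link hp hq hn hnb hna hnq hpn hnk
  have hf : ∀ a, a ≠ p → fld (setFld M p (nd n 0)) a = fld M a := fun a ha => by
    rw [fld_setFld, if_neg ha]
  refine ⟨Set.subset_insert _ _, le_rfl, fun a _ => nkey_setFld _ _ _ _, fun a ha hm => hf a ?_,
    fun x hx v _ => h3 x hx v, fun v hv hr => ?_, fun m hm hmE => ⟨?_, hf m ?_⟩,
    fun n _ => status_setFld _ _ _ _⟩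
  · rintro rfl
    rw [hq] at hm
    exact absurd hm (by simp)
  · rcases h2 v hr with rfl | h4
    · exact absurd hv hn
    · exact h4
  · rintro (rfl | h4)
    · exact hown hm
    · exact hmE h4
  · rintro rfl
    exact hmE hp

end MemoryChanges

/-! ### The invariant of Harris's list without reclamation -/

section Invariant

variable {N : ℕ}

/-- The state of a thread is as it should be. -/
def ThreadOK (fr : Bool) {A : Scheme.Obj N} (c : Config A) (E : Set ℕ) (own : Option ℕ)
    (th : Thread A) : Prop :=
  th.frame = none ∧
    match th.ctrl with
    | .idle => True
    | .pro _ ks => ks = [] ∧ th.stack = [] ∧ fr = false ∧ ∃ i : ℤ, th.vars 0 = .key (i : WithTop ℤ)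
    | .body _ pc => ∃ i : ℤ, th.vars 0 = .key (i : WithTop ℤ) ∧
        Assertion fr c.mem c.brk E own (i : WithTop ℤ) th.stack th.vars pc
    | .epi _ ks _ => ks = []

/-- The invariant. `E` is the set of nodes that have been in the list at some time, and `own t` is
the node that the thread `t` is going to link or to retire. -/
structure Inv {A : Scheme.Obj N} (c : Config A) (E : Set ℕ) (own : Fin N → Option ℕ) : Prop where
  shape : ListShape c.mem c.brk E
  nextId : c.nextId = c.brk
  own_ok : ∀ t a, own t = some a →
    a < c.brk ∧ (c.mem a).status = .active ∧ (a ∈ E → (fld c.mem a).mark = 1)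
  own_inj : ∀ t t', t ≠ t' → ∀ a, own t = some a → own t' ≠ some a
  thr : ∀ t, ThreadOK false c E (own t) (c.thr t)

/-- The set of nodes that are in the list or have been in `E`. -/
def grow {A : Scheme.Obj N} (E : Set ℕ) (c : Config A) : Set ℕ := E ∪ {a | Reach c.mem 0 a}

/-- The number of nodes whose key exceeds the key of the node that `v` points to. -/
noncomputable def keysAbove {X : Type} (M : ℕ → Cell X) (b : ℕ) (v : Val) : ℕ :=
  ((Finset.range b).filter fun a => nkey M ((v.ref?.map Ref.addr).getD 0) < nkey M a).card

/-- A bound for the number of steps that a thread running alone takes from the instruction `pc` to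
the end of the operation; `b` is the number of nodes, and `n` the number of those beyond the
current node of a traversal.  At the latest a failed compare-and-swap or a marked node leads a
thread that has not been running alone to a new search; afterwards everything succeeds.  So stale
states (`fr = false`) are ranked above all fresh ones. -/
def bodyRank (fr : Bool) (b n pc : ℕ) : ℕ :=
  (if fr then 0 else 12 * b + 200) +
    (if pc < 3 then 12 * b + 122 - pc
    else if pc < 15 then
      12 * n + [0, 0, 0, 108, 107, 106, 105, 104, 103, 102, 101, 111, 110, 109, 108].getD pc 0
    else if pc = 24 ∨ pc = 34 ∨ pc = 44 then 1
    else if pc = 33 then 14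
    else 100 - pc)

/-- The rank of a thread in an operation. -/
noncomputable def threadRank (fr : Bool) {A : Scheme.Obj N} (c : Config A) (t : Fin N) : ℕ :=
  match (c.thr t).ctrl with
  | .idle | .epi _ _ _ => 0
  | .pro _ _ => 12 * c.brk + 500
  | .body _ pc => bodyRank fr c.brk (keysAbove c.mem c.brk ((c.thr t).vars 3)) pc

theorem keysAbove_le {X : Type} (M : ℕ → Cell X) (b : ℕ) (v : Val) : keysAbove M b v ≤ b :=
  (Finset.card_filter_le _ _).trans (Finset.card_range b).le

theorem keysAbove_lt {X : Type} {M : ℕ → Cell X} {b c d m n : ℕ} (hd : d < b)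
    (hk : nkey M c < nkey M d) : keysAbove M b (nd d m) < keysAbove M b (nd c n) := by
  simp only [keysAbove, nd_ref?, Option.map_some, Option.getD_some]
  refine Finset.card_lt_card ((Finset.ssubset_iff_of_subset fun a ha => ?_).2 ⟨d, ?_, ?_⟩)
  · exact Finset.mem_filter.2 ⟨(Finset.mem_filter.1 ha).1, hk.trans (Finset.mem_filter.1 ha).2⟩
  · exact Finset.mem_filter.2 ⟨Finset.mem_range.2 hd, hk⟩
  · exact fun h => lt_irrefl _ (Finset.mem_filter.1 h).2

theorem keysAbove_congr {X : Type} {M M' : ℕ → Cell X} {b : ℕ} (v : Val)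
    (hk : ∀ a, nkey M' a = nkey M a) : keysAbove M' b v = keysAbove M b v := by
  simp [keysAbove, hk]

variable {A : Scheme.Obj N} {c : Config A} {E : Set ℕ} {own : Fin N → Option ℕ}

/-- The number of nodes that a thread may still allocate before it responds; an idle thread counts
as if it had invoked an operation. -/
def allocsLeft : Ctrl → ℕ
  | .idle | .pro _ _ => 1
  | .body _ pc => if pc = 33 then 1 else 0
  | .epi _ _ _ => 0

/-- The thread `t` with a step to `c'` keeps up the invariant, and gets closer to the end of its
operation. -/
def Advances (fr : Bool) (c : Config A) (E : Set ℕ) (t : Fin N) (c' : Config A) : Prop :=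
  ∃ (own' : Fin N → Option ℕ) (fr' : Bool), Inv c' (grow E c') own' ∧
    ThreadOK fr' c' (grow E c') (own' t) (c'.thr t) ∧ threadRank fr' c' t < threadRank fr c t ∧
    (c'.thr t).ctrl ≠ .idle ∧
    c'.brk + allocsLeft (c'.thr t).ctrl ≤ c.brk + allocsLeft (c.thr t).ctrl

theorem ThreadOK.env {fr : Bool} {c' : Config A} {E' : Set ℕ} {o : Option ℕ} {th : Thread A}
    (h : ListShape c.mem c.brk E) (e : Env c.mem c.brk E c'.mem c'.brk E' o)
    (ht : ThreadOK fr c E o th) : ThreadOK false c' E' o th := by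
  obtain ⟨h1, h2⟩ := ht
  refine ⟨h1, ?_⟩
  split <;> rename_i hc <;> simp only [hc] at h2
  · trivial
  · exact ⟨h2.1, h2.2.1, rfl, h2.2.2.2⟩
  · obtain ⟨i, h3, h4⟩ := h2
    exact ⟨i, h3, e.assertion h h4⟩
  · exact h2

theorem Inv.update (I : Inv c E own) (t : Fin N) {c' : Config A} {E' : Set ℕ} {th : Thread A}
    (hthr : c'.thr = Function.update c.thr t th) (hid : c'.nextId = c'.brk)
    (hs : ListShape c'.mem c'.brk E')
    (henv : ∀ t', t' ≠ t → Env c.mem c.brk E c'.mem c'.brk E' (own t'))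
    (o : Option ℕ)
    (ho : ∀ a, o = some a → (a < c'.brk ∧ (c'.mem a).status = .active ∧
      (a ∈ E' → (fld c'.mem a).mark = 1)) ∧ ∀ t', t' ≠ t → own t' ≠ some a)
    {fr : Bool} (hth : ThreadOK fr c' E' o th) : Inv c' E' (Function.update own t o) := by
  refine ⟨hs, hid, ?_, ?_, ?_⟩
  · intro t' a ha
    by_cases ht : t' = t
    · subst ht
      rw [Function.update_self] at ha
      exact (ho a ha).1
    · rw [Function.update_of_ne ht] at ha
      obtain ⟨h1, h2, h3⟩ := I.own_ok t' a ha
      have e := henv t' ht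
      refine ⟨h1.trans_le e.le, by rw [e.own_status a ha, h2], fun haE => ?_⟩
      by_cases hE : a ∈ E
      · rw [e.frozen a hE (h3 hE), h3 hE]
      · exact absurd haE (e.own_new a ha hE).1
  · intro t1 t2 hne a h1 h2
    by_cases ht1 : t1 = t
    · subst ht1
      rw [Function.update_self] at h1
      rw [Function.update_of_ne hne.symm] at h2
      exact (ho a h1).2 t2 hne.symm h2
    · rw [Function.update_of_ne ht1] at h1
      by_cases ht2 : t2 = t
      · subst ht2
        rw [Function.update_self] at h2
        exact (ho a h2).2 t1 ht1 h1
      · rw [Function.update_of_ne ht2] at h2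
        exact I.own_inj t1 t2 hne a h1 h2
  · intro t'
    by_cases ht : t' = t
    · subst ht
      rw [Function.update_self, hthr, Function.update_self]
      exact hth.env hs (Env.rfl' _ _ _ _)
    · rw [Function.update_of_ne ht, hthr, Function.update_of_ne ht]
      exact (I.thr t').env I.shape (henv t' ht)

/-- A step of the thread `t` inside the code, with the effect given on its own state and on the
memory. -/
theorem Inv.advances (I : Inv c E own) {t : Fin N} {fr fr' : Bool} {op : SetOp} {pc pc' : ℕ}
    {st st' : List ℕ} {ρ ρ' : Var → Val} {regs regs' : A.Reg → A.Word} {i : ℤ} {c' : Config A}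
    {E' : Set ℕ} (o : Option ℕ)
    (hth : c.thr t = ⟨.body op pc, st, ρ, none, regs⟩)
    (hthr : c'.thr = Function.update c.thr t ⟨.body op pc', st', ρ', none, regs'⟩)
    (hid : c'.nextId = c'.brk)
    (hE : grow E c' = E')
    (hs : ListShape c'.mem c'.brk E')
    (henv : ∀ t', t' ≠ t → Env c.mem c.brk E c'.mem c'.brk E' (own t'))
    (ho : ∀ a, o = some a → (a < c'.brk ∧ (c'.mem a).status = .active ∧
      (a ∈ E' → (fld c'.mem a).mark = 1)) ∧ ∀ t', t' ≠ t → own t' ≠ some a)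
    (hi : ρ' 0 = .key (i : WithTop ℤ))
    (ha : Assertion fr' c'.mem c'.brk E' o (i : WithTop ℤ) st' ρ' pc')
    (hr : bodyRank fr' c'.brk (keysAbove c'.mem c'.brk (ρ' 3)) pc' <
      bodyRank fr c.brk (keysAbove c.mem c.brk (ρ 3)) pc)
    (hpc : pc' ≠ 33 := by decide)
    (hb : c'.brk = c.brk ∨ pc = 33 ∧ c'.brk = c.brk + 1 := by exact .inl rfl) :
    Advances fr c E t c' := by
  have hok : ThreadOK fr' c' E' o (⟨.body op pc', st', ρ', none, regs'⟩ : Thread A) :=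
    ⟨rfl, i, hi, ha⟩
  refine ⟨Function.update own t o, fr', ?_, ?_, ?_, by simp [hthr], ?_⟩
  · rw [hE]
    exact I.update t hthr hid hs henv o ho hok
  · rw [hE, Function.update_self, hthr, Function.update_self]
    exact hok
  · simp only [threadRank, hth, hthr, Function.update_self]
    exact hr
  · simp only [hthr, hth, Function.update_self, allocsLeft, if_neg hpc]
    rcases hb with h | ⟨h1, h2⟩
    · omega
    · rw [if_pos h1, h2]

/-- A step of the thread `t` inside the code that does not change the memory. -/
theorem Inv.advances_of_eq (I : Inv c E own) {t : Fin N} {fr : Bool} (fr' : Bool) {op : SetOp}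
    {pc pc' : ℕ} {st st' : List ℕ} {ρ ρ' : Var → Val} {regs regs' : A.Reg → A.Word} {i : ℤ}
    (hth : c.thr t = ⟨.body op pc, st, ρ, none, regs⟩)
    (hi : ρ' 0 = .key (i : WithTop ℤ))
    (ha : Assertion fr' c.mem c.brk E (own t) (i : WithTop ℤ) st' ρ' pc')
    {v : Val} (hv : ρ' 3 = v)
    (hr : bodyRank fr' c.brk (keysAbove c.mem c.brk v) pc' <
      bodyRank fr c.brk (keysAbove c.mem c.brk (ρ 3)) pc)
    (hpc : pc' ≠ 33 := by decide) :
    Advances fr c E t (c.setThr t ⟨.body op pc', st', ρ', none, regs'⟩) :=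
  I.advances (own t) hth rfl I.nextId (I.shape.union_eq fun _ r => r) I.shape
    (fun _ _ => Env.rfl' _ _ _ _)
    (fun a ha => ⟨I.own_ok t a ha, fun t' ht => I.own_inj t t' ht.symm a ha⟩) hi ha
    (by subst hv; exact hr) hpc

/-- A step of the thread `t` inside the code that changes neither the memory nor the current node
of the traversal. -/
theorem Inv.advances_local (I : Inv c E own) {t : Fin N} {fr : Bool} (fr' : Bool) {op : SetOp}
    {pc pc' : ℕ} {st st' : List ℕ} {ρ ρ' : Var → Val} {regs regs' : A.Reg → A.Word} {i : ℤ}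
    (hth : c.thr t = ⟨.body op pc, st, ρ, none, regs⟩)
    (hi : ρ' 0 = .key (i : WithTop ℤ)) (hv : ρ' 3 = ρ 3)
    (ha : Assertion fr' c.mem c.brk E (own t) (i : WithTop ℤ) st' ρ' pc')
    (hr : ∀ n, n ≤ c.brk → bodyRank fr' c.brk n pc' < bodyRank fr c.brk n pc)
    (hpc : pc' ≠ 33 := by decide) :
    Advances fr c E t (c.setThr t ⟨.body op pc', st', ρ', none, regs'⟩) :=
  I.advances_of_eq fr' hth hi ha hv (hr _ (keysAbove_le _ _ _)) hpc

end Invariant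

/-! ### The steps of Harris's list preserve the invariant -/

section HarrisSteps

variable {N : ℕ}

theorem plain_step_jumpIf_true {P : Program} {c : Config (plain N P).obj} {t : Fin N}
    {req : SetOp × ℤ} {o : SetOp} {pc : ℕ} {st : List ℕ} {ρ : Var → Val}
    {regs : (plain N P).obj.Reg → (plain N P).obj.Word} {b : Cond} {q : ℕ}
    (h : c.thr t = ⟨.body o pc, st, ρ, none, regs⟩) (hi : P.code pc = .jumpIf b q)
    (hb : b.eval ρ = true) :
    (plain N P).step t req c = (c.setThr t ⟨.body o q, st, ρ, none, regs⟩, .quiet none) := by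
  rw [step_jumpIf h hi, if_pos hb]

theorem plain_step_jumpIf_false {P : Program} {c : Config (plain N P).obj} {t : Fin N}
    {req : SetOp × ℤ} {o : SetOp} {pc : ℕ} {st : List ℕ} {ρ : Var → Val}
    {regs : (plain N P).obj.Reg → (plain N P).obj.Word} {b : Cond} {q : ℕ}
    (h : c.thr t = ⟨.body o pc, st, ρ, none, regs⟩) (hi : P.code pc = .jumpIf b q)
    (hb : b.eval ρ = false) :
    (plain N P).step t req c =
      (c.setThr t ⟨.body o (pc + 1), st, ρ, none, regs⟩, .quiet none) := by
  rw [step_jumpIf h hi, hb]; rfl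

theorem casField_of_same {A : Scheme.Obj N} {c : Config A} {r : Ref} {e v : Val} {f : ℕ}
    (h : ((c.mem r.addr).fields f).same e = true) :
    c.casField r f e v = (c.writeField r f v, true) := if_pos h

theorem casField_of_not_same {A : Scheme.Obj N} {c : Config A} {r : Ref} {e v : Val} {f : ℕ}
    (h : ((c.mem r.addr).fields f).same e = false) :
    c.casField r f e v = (c, false) := if_neg (by rw [Config.readField, h]; decide)

theorem eval_keyLt {ρ : Var → Val} {u v : ℕ} :
    (Harris.keyLt u v).eval ρ = decide ((ρ u).toKey < (ρ v).toKey) := by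
  simp [Harris.keyLt, Cond.eval]

theorem eval_keyEq {ρ : Var → Val} {u v : ℕ} :
    (Harris.keyEq u v).eval ρ = decide ((ρ u).toKey = (ρ v).toKey) := by
  simp [Harris.keyEq, Cond.eval]

theorem bot_lt_key (i : ℤ) : (⊥ : Key) < ((i : WithTop ℤ) : Key) := WithBot.bot_lt_coe _

theorem key_lt_top (i : ℤ) : ((i : WithTop ℤ) : Key) < (⊤ : Key) :=
  WithBot.coe_lt_coe.2 (WithTop.coe_lt_top i)

variable {c : Config (plain N harris).obj} {E : Set ℕ} {own : Fin N → Option ℕ} {t : Fin N}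
  {req : SetOp × ℤ} {op : SetOp} {pc : ℕ} {st : List ℕ} {ρ : Var → Val}
  {regs : (plain N harris).obj.Reg → (plain N harris).obj.Word} {fr : Bool} {i : ℤ}

/-- A read of the next field of a node that the traversal has reached. -/
theorem atNext_of_read (I : Inv c E own) {b : ℕ} {o : Option ℕ} {x : ℕ}
    (hs : Saved c.mem b E o (i : WithTop ℤ) st ρ) (hx : x ∈ E) (h4 : ρ 4 = fld c.mem x) :
    AtNext fr c.mem E (i : WithTop ℤ) st ρ x := by
  have S := I.shape
  refine ⟨fun _ => h4.symm, ?_⟩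
  by_cases hx1 : x = 1
  · subst hx1
    exact .inl ⟨h4.trans S.fld_tail, rfl⟩
  · obtain ⟨d, m, h1, h2, h3, h5⟩ := S.next x hx hx1
    refine .inr ⟨d, m, h4.trans h1, h3, h5, h2, fun hm => hm ▸ h1, fun hm hk v hst hv hR => ?_⟩
    have hvk : nkey c.mem v = _ := (hs.victim hst hv).2.2.1
    have hRx := S.unmarked x hx (by rw [h1, hm]; rfl)
    exact S.reach_next hRx hR ⟨m, h1⟩ (by rwa [hvk])

/-- The key of the current node and its mark decide how the search goes on. -/
theorem AtNext.mark_eq_zero {X : Type} {M : ℕ → Cell X} {k : Key} {x : ℕ}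
    (h : AtNext fr M E k st ρ x) (hm : (ρ 4).mark ≠ 1) : (ρ 4).mark = 0 := by
  rcases h.2 with ⟨h1, -⟩ | ⟨d, m, h1, -, -, h2, -⟩
  · rw [h1]; rfl
  · rw [h1] at hm ⊢
    simp only [nd_mark] at hm ⊢
    omega

/-- The beginning of a search, up to the first test of the loop condition; one case for each
instruction. -/
theorem search_start_advances (I : Inv c E own) (hpc : pc < 4)
    (h : c.thr t = ⟨.body op pc, st, ρ, none, regs⟩) (hi : ρ 0 = .key (i : WithTop ℤ))
    (ha : Assertion fr c.mem c.brk E (own t) (i : WithTop ℤ) st ρ pc) :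
    Advances fr c E t ((plain N harris).step t req c).1 := by
  have S := I.shape
  have hkl := keysAbove_le c.mem c.brk
  interval_cases pc
  · rw [step_global h (show harris.code 0 = .global 1 0 from rfl)]
    exact I.advances_local true h hi rfl ⟨ha, rfl⟩ (by
      intro n hn
      cases fr <;> simp [bodyRank]
      omega)
  · obtain ⟨hs, h1⟩ := ha
    rw [plain_step_read h (show harris.code 1 = .read 2 1 1 from rfl) h1]
    obtain ⟨q, hq⟩ := S.fld_head
    have hqE := S.edge S.head_mem ⟨0, hq⟩
    refine I.advances_local fr h hi rfl ⟨hs, 0, q, ⟨⟨h1, S.head_mem, ?_⟩, hqE.1, hqE.2, ?_,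
      fun _ => hq⟩,
      hq⟩ (by intro n hn; cases fr <;> simp [bodyRank])
    · rw [S.key_head]; exact bot_lt_key i
    · intro v hst hv hR
      have hvk : nkey c.mem v = _ := (hs.victim hst hv).2.2.1
      exact S.reach_next .refl hR ⟨0, hq⟩ (by rw [hvk, S.key_head]; exact bot_lt_key i)
  · obtain ⟨hs, p, q, h1, h2⟩ := ha
    rw [step_move h (show harris.code 2 = .move 3 2 from rfl)]
    have := hkl (ρ 2)
    exact I.advances_of_eq fr h hi ⟨hs, p, q, q, h1, h2, h2, h1.2.1, .refl⟩ (v := ρ 2) rfl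
      (by cases fr <;> simp [bodyRank] <;> omega)
  · obtain ⟨hs, p, q, x, h1⟩ := ha
    have h3 := h1.2.2.1
    rw [plain_step_read h (show harris.code 3 = .read 4 3 1 from rfl) h3]
    exact I.advances_local fr h hi rfl ⟨hs, p, q, x, h1,
      atNext_of_read I (b := c.brk) (o := own t) hs h1.2.2.2.1 rfl⟩
      (by intro n hn; cases fr <;> simp [bodyRank])

/-- The loop of a search; one case for each instruction. -/
theorem traversal_advances (I : Inv c E own) (hpc : 4 ≤ pc) (hpc' : pc < 15)
    (h : c.thr t = ⟨.body op pc, st, ρ, none, regs⟩) (hi : ρ 0 = .key (i : WithTop ℤ))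
    (ha : Assertion fr c.mem c.brk E (own t) (i : WithTop ℤ) st ρ pc) :
    Advances fr c E t ((plain N harris).step t req c).1 := by
  have S := I.shape
  have hkl := keysAbove_le c.mem c.brk
  interval_cases pc
  · obtain ⟨hs, p, q, x, h1, h2⟩ := ha
    by_cases hm : (ρ 4).mark = 1
    · rw [plain_step_jumpIf_true h (show harris.code 4 = .jumpIf (.hasMark 4 1) 7 from rfl)
        (decide_eq_true hm)]
      exact I.advances_local fr h hi rfl ⟨hs, p, q, x, h1, h2, fun hm' => absurd hm hm'⟩
        (by intro n hn; cases fr <;> simp [bodyRank])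
    · rw [plain_step_jumpIf_false h (show harris.code 4 = .jumpIf (.hasMark 4 1) 7 from rfl)
        (decide_eq_false hm)]
      exact I.advances_local fr h hi rfl ⟨hs, p, q, x, h1, h2, hm⟩
        (by intro n hn; cases fr <;> simp [bodyRank])
  · obtain ⟨hs, p, q, x, h1, h2, h3⟩ := ha
    rw [plain_step_read h (show harris.code 5 = .read 5 3 0 from rfl) h1.2.2.1]
    obtain ⟨k, hk⟩ := S.keyForm x (S.lt x h1.2.2.2.1)
    refine I.advances_local fr h hi rfl ⟨hs, p, q, x, h1, h2, h3, ?_⟩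
      (by intro n hn; cases fr <;> simp [bodyRank])
    show (c.mem x).fields 0 = _
    rw [nkey, hk]; rfl
  · obtain ⟨hs, p, q, x, h1, h2, h3, h4⟩ := ha
    have hev : (Cond.neg (Harris.keyLt 5 0)).eval ρ =
        !decide (nkey c.mem x < ((i : WithTop ℤ) : Key)) := by
      rw [Cond.eval, eval_keyLt, h4, hi]; rfl
    by_cases hk : nkey c.mem x < ((i : WithTop ℤ) : Key)
    · rw [plain_step_jumpIf_false h (show harris.code 6 =
        .jumpIf (.neg (Harris.keyLt 5 0)) 15 from rfl)
        (by rw [hev]; simp [hk])]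
      exact I.advances_local fr h hi rfl ⟨hs, p, q, x, h1, h2, fun _ => hk⟩
        (by intro n hn; cases fr <;> simp [bodyRank])
    · rw [plain_step_jumpIf_true h (show harris.code 6 =
        .jumpIf (.neg (Harris.keyLt 5 0)) 15 from rfl)
        (by rw [hev]; simp [hk])]
      refine I.advances_local fr h hi rfl ⟨hs, p, q, x, h1, not_lt.1 hk, fun hf => ?_⟩
        (by intro n hn; cases fr <;> simp [bodyRank])
      rw [h2.1 hf]
      exact h2.mark_eq_zero h3
  · obtain ⟨hs, p, q, x, h1, h2, h3⟩ := ha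
    by_cases hm : (ρ 4).mark = 1
    · rw [plain_step_jumpIf_true h (show harris.code 7 = .jumpIf (.hasMark 4 1) 10 from rfl)
        (decide_eq_true hm)]
      rcases h2.2 with ⟨h4, -⟩ | ⟨d, m, h4, h5, h6, h7, h8, h9⟩
      · rw [h4] at hm; cases hm
      · rw [h4] at hm
        exact I.advances_local fr h hi rfl ⟨hs, p, q, x, d, m, h1.1, h1.2.1, h1.2.2.1, h1.2.2.2.1, h4,
          h5, h1.2.2.2.2.tail (h8 hm), h6⟩ (by intro n hn; cases fr <;> simp [bodyRank])
    · rw [plain_step_jumpIf_false h (show harris.code 7 = .jumpIf (.hasMark 4 1) 10 from rfl)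
        (decide_eq_false hm)]
      exact I.advances_local fr h hi rfl ⟨hs, p, q, x, h1, h2, hm, h3 hm⟩
        (by intro n hn; cases fr <;> simp [bodyRank])
  · obtain ⟨hs, p, q, x, h1, h2, h3, h4⟩ := ha
    rw [step_move h (show harris.code 8 = .move 1 3 from rfl)]
    have hx := h1.2.2.2.1
    rcases h2.2 with ⟨-, rfl⟩ | ⟨d, m, h5, h6, h7, h8, h9, h10⟩
    · exact absurd rfl (S.ne_tail_of_lt h4)
    · have hm : m = 0 := by
        have := h2.mark_eq_zero h3
        rwa [h5] at this
      subst hm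
      exact I.advances_local fr h hi rfl ⟨hs, x, d, ⟨⟨h1.2.2.1, hx, h4⟩, h6, h7, h10 rfl h4,
        fun hf => (h2.1 hf).trans h5⟩, h5, h1.2.2.1⟩
        (by intro n hn; cases fr <;> simp [bodyRank])
  · obtain ⟨hs, p, d, h1, h2, h3⟩ := ha
    rw [step_move h (show harris.code 9 = .move 2 4 from rfl)]
    exact I.advances_local fr h hi rfl ⟨hs, p, d, p, d, 0, h1, h2, h3, h1.1.2.1, h2, h1.2.1, .refl,
      h1.2.2.1⟩ (by intro n hn; cases fr <;> simp [bodyRank])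
  · obtain ⟨hs, p, q, x, d, m, h1, h2, h3, h4, h5, h6, h7, h8⟩ := ha
    rw [step_setMark h (show harris.code 10 = .setMark 3 4 0 from rfl)]
    have hlt : keysAbove c.mem c.brk ((ρ 4).setMark 0) < keysAbove c.mem c.brk (ρ 3) := by
      rw [h5, h3]
      exact keysAbove_lt (S.lt d h6) h8
    have h5' : (ρ 4).setMark 0 = nd d 0 := by rw [h5]; rfl
    exact I.advances_of_eq fr h hi ⟨hs, p, q, d, h1, h2, h5', h6, h7⟩ (v := (ρ 4).setMark 0) rfl
      (by cases fr <;> simp [bodyRank] <;> omega)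
  · obtain ⟨hs, h1⟩ := ha
    rw [step_global h (show harris.code 11 = .global 5 1 from rfl)]
    exact I.advances_local fr h hi rfl ⟨hs, h1, rfl⟩ (by intro n hn; cases fr <;> simp [bodyRank])
  · obtain ⟨hs, ⟨p, q, x, h1⟩, h2⟩ := ha
    have hev : (Cond.same 3 5).eval ρ = decide (x = 1) := by
      simp [Cond.eval, h1.2.2.1, h2]
    by_cases hx : x = 1
    · rw [plain_step_jumpIf_true h (show harris.code 12 = .jumpIf (.same 3 5) 15 from rfl)
        (by rw [hev, decide_eq_true hx])]
      subst hx
      refine I.advances_local fr h hi rfl ⟨hs, p, q, 1, h1, ?_, fun _ => ?_⟩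
        (by intro n hn; cases fr <;> simp [bodyRank])
      · rw [S.key_tail]; exact le_top
      · rw [S.fld_tail]; rfl
    · rw [plain_step_jumpIf_false h (show harris.code 12 = .jumpIf (.same 3 5) 15 from rfl)
        (by rw [hev, decide_eq_false hx])]
      exact I.advances_local fr h hi rfl ⟨hs, p, q, x, h1⟩
        (by intro n hn; cases fr <;> simp [bodyRank])
  · obtain ⟨hs, p, q, x, h1⟩ := ha
    have h3 := h1.2.2.1
    rw [plain_step_read h (show harris.code 13 = .read 4 3 1 from rfl) h3]
    exact I.advances_local fr h hi rfl ⟨hs, p, q, x, h1,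
      atNext_of_read I (b := c.brk) (o := own t) hs h1.2.2.2.1 rfl⟩
      (by intro n hn; cases fr <;> simp [bodyRank])
  · rw [step_goto h (show harris.code 14 = .goto 4 from rfl)]
    exact I.advances_local fr h hi rfl ha (by intro n hn; cases fr <;> simp [bodyRank])

end HarrisSteps

section SearchWindow

variable {N : ℕ}

theorem Inv.advances_ret {A : Scheme.Obj N} {c : Config A} {E : Set ℕ} {own : Fin N → Option ℕ}
    (I : Inv c E own) {t : Fin N} {fr : Bool} {op : SetOp}
    {pc : ℕ} {st : List ℕ} {ρ : Var → Val} {regs : A.Reg → A.Word} {v : Val}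
    (hth : c.thr t = ⟨.body op pc, st, ρ, none, regs⟩) (hr : ∀ b n, 0 < bodyRank fr b n pc) :
    Advances fr c E t (c.setThr t ⟨.epi op [] v, st, ρ, none, regs⟩) := by
  have hE : grow E (c.setThr t ⟨.epi op [] v, st, ρ, none, regs⟩) = E :=
    I.shape.union_eq fun _ r => r
  refine ⟨Function.update own t (own t), false, ?_, ?_, ?_, by simp [Config.setThr], ?_⟩
  · rw [hE]
    exact I.update (fr := false) (c' := c.setThr t ⟨.epi op [] v, st, ρ, none, regs⟩) t rfl I.nextId
      I.shape (fun _ _ => Env.rfl' _ _ _ _) (own t)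
      (fun a ha => ⟨I.own_ok t a ha, fun t' ht => I.own_inj t t' ht.symm a ha⟩) ⟨rfl, rfl⟩
  · simp [Config.setThr, ThreadOK]
  · simp only [threadRank, Config.setThr, Function.update_self, hth]
    exact hr _ _
  · simp [Config.setThr, allocsLeft]

theorem retireRef_of_active {A : Scheme.Obj N} {c : Config A} {a : ℕ} (hid : (c.mem a).id = a)
    (hs : (c.mem a).status = .active) :
    c.retireRef ⟨a, a⟩ =
      { c with mem := Function.update c.mem a { c.mem a with status := .retired } } :=
  if_pos ⟨hid, hs⟩

theorem Inv.advances_retire {A : Scheme.Obj N} {c : Config A} {E : Set ℕ} {own : Fin N → Option ℕ}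
    (I : Inv c E own) {t : Fin N} {fr : Bool} {op : SetOp} {a : ℕ}
    {pc pc' : ℕ} {st st' : List ℕ} {ρ : Var → Val} {regs : A.Reg → A.Word} {i : ℤ}
    (hth : c.thr t = ⟨.body op pc, st, ρ, none, regs⟩) (hi : ρ 0 = .key (i : WithTop ℤ))
    (hown : own t = some a) (hR : ¬ Reach c.mem 0 a)
    (ha : ∀ M b E o, Assertion (X := A.X) fr M b E o (i : WithTop ℤ) st' ρ pc')
    (hr : ∀ n n', bodyRank fr c.brk n pc' < bodyRank fr c.brk n' pc)
    (hpc : pc' ≠ 33 := by decide) :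
    Advances fr c E t ((c.retireRef ⟨a, a⟩).setThr t ⟨.body op pc', st', ρ, none, regs⟩) := by
  obtain ⟨h1, h2, h3⟩ := I.own_ok t a hown
  rw [retireRef_of_active (I.shape.id_eq a h1) h2]
  obtain ⟨h4, h5, h6⟩ := I.shape.retireNode hR
  exact I.advances none hth rfl I.nextId
    (I.shape.union_eq fun v hv => (h5 0 I.shape.head_mem v).1 hv) h4
    (fun t' ht => h6 _ (I.own_inj t t' ht.symm a hown)) (by simp) hi (ha _ _ _ _) (hr _ _) hpc

variable {c : Config (plain N harris).obj} {E : Set ℕ} {own : Fin N → Option ℕ} {t : Fin N}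
  {req : SetOp × ℤ} {op : SetOp} {pc : ℕ} {st : List ℕ} {ρ : Var → Val}
  {regs : (plain N harris).obj.Reg → (plain N harris).obj.Word} {fr : Bool} {i : ℤ}

theorem ListShape.same_iff {X : Type} {M : ℕ → Cell X} {b : ℕ} {E : Set ℕ} (S : ListShape M b E)
    {a q : ℕ} (ha : a ∈ E) : (fld M a).same (nd q 0) = true ↔ fld M a = nd q 0 := by
  by_cases ha1 : a = 1
  · subst ha1
    rw [S.fld_tail]
    simp [Val.null, nd, Val.same]
  · obtain ⟨d, m, h1, -⟩ := S.next a ha ha1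
    rw [h1, nd_same, nd_inj]
    simp

/-- Compare-and-swaps compare addresses only.  As addresses are not reused, this makes no difference
for the next fields of nodes. -/
theorem casField_cases (S : ListShape c.mem c.brk E) {a q : ℕ} {e v : Val} (ha : a ∈ E)
    (he : e = nd q 0) :
    (fld c.mem a = nd q 0 ∧ c.casField ⟨a, a⟩ 1 e v = (c.writeField ⟨a, a⟩ 1 v, true)) ∨
    (fld c.mem a ≠ nd q 0 ∧ c.casField ⟨a, a⟩ 1 e v = (c, false)) := by
  subst he
  by_cases hs : fld c.mem a = nd q 0
  · exact .inl ⟨hs, casField_of_same ((S.same_iff ha).2 hs)⟩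
  · exact .inr ⟨hs, casField_of_not_same (Bool.eq_false_iff.2 fun h => hs ((S.same_iff ha).1 h))⟩

/-- An empty chain of marked nodes makes a window. -/
theorem AtCurr.window {k : Key} {p x : ℕ}
    (h1 : AtCurr fr c.mem E k st ρ p x x) (h2 : k ≤ nkey c.mem x)
    (h3 : fr = true → (fld c.mem x).mark = 0) : Found fr c.mem E k st ρ p x :=
  ⟨⟨h1.1.1, h1.2.2.1, h1.1.2.1, h2, fun hf => ⟨h1.1.2.2.2.2 hf, h3 hf⟩⟩, h1.1.2.2.2.1⟩

/-- In case of a search by a deletion that has failed to unlink its victim, this is where the victim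
turns out to have left the list: its key is that of the operation, so that it could only be the
right end of the window, which is not marked. -/
theorem Found.checked (S : ListShape c.mem c.brk E) {k : Key} {p x b : ℕ} {o : Option ℕ}
    (hs : Saved c.mem b E o k st ρ)
    (h : Found fr c.mem E k st ρ p x) (h5 : ρ 5 = fld c.mem x) : Checked fr c.mem E k st ρ := by
  refine ⟨⟨p, x, h.1⟩, fun hm v hst hv hR => ?_, fun hf => ?_⟩
  · obtain ⟨-, hvE, hvk, hvm⟩ := hs.victim hst hv
    rcases (S.reach h.1.2.2.1 (h.2 v hst hv hR)).2 with rfl | h1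
    · rw [h5] at hm
      exact hm hvm
    · rw [hvk] at h1
      exact absurd h.1.2.2.2.1 (not_le_of_gt h1)
  · rw [h5, (h.1.2.2.2.2 hf).2]
    decide

/-- The end of a search: unlinking marked nodes, and checking the right end of the window. -/
theorem window_advances (I : Inv c E own) (hpc : 15 ≤ pc) (hpc' : pc < 24)
    (h : c.thr t = ⟨.body op pc, st, ρ, none, regs⟩) (hi : ρ 0 = .key (i : WithTop ℤ))
    (ha : Assertion fr c.mem c.brk E (own t) (i : WithTop ℤ) st ρ pc) :
    Advances fr c E t ((plain N harris).step t req c).1 := by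
  have S := I.shape
  have hchecked : ∀ pc, pc = 17 ∨ pc = 22 → harris.code pc = .jumpIf (.hasMark 5 1) 0 →
      c.thr t = ⟨.body op pc, st, ρ, none, regs⟩ → Saved c.mem c.brk E (own t) (i : WithTop ℤ) st ρ →
      Checked fr c.mem E (i : WithTop ℤ) st ρ →
      Advances fr c E t ((plain N harris).step t req c).1 := by
    intro pc hpc hcode h hs hc
    by_cases hm : (ρ 5).mark = 1
    · rw [plain_step_jumpIf_true h hcode (decide_eq_true hm)]
      have hfr : fr = false := Bool.eq_false_iff.2 fun hf => hc.2.2 hf hm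
      exact I.advances_local true h hi rfl hs
        (by intro n hn; rcases hpc with rfl | rfl <;> simp [bodyRank, hfr])
    · rw [plain_step_jumpIf_false h hcode (decide_eq_false hm)]
      refine I.advances_local fr h hi rfl ?_
        (by intro n hn; rcases hpc with rfl | rfl <;> cases fr <;> simp [bodyRank]) (by omega)
      rcases hpc with rfl | rfl
      · exact ⟨hs, hc.1, hc.2.1 hm⟩
      · exact ⟨hs, hc.1, hc.2.1 hm⟩
  have hreturn : ∀ pc, pc = 18 ∨ pc = 23 → harris.code pc = .return →
      c.thr t = ⟨.body op pc, st, ρ, none, regs⟩ → Saved c.mem c.brk E (own t) (i : WithTop ℤ) st ρ →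
      (∃ p x, Window fr c.mem E (i : WithTop ℤ) ρ p x) → VictimGone c.mem st ρ →
      Advances fr c E t ((plain N harris).step t req c).1 := by
    intro pc hpc hcode h hs hw hg
    rw [step_return h hcode]
    rcases hs with rfl | ⟨rfl, hn⟩ | rfl | ⟨rfl, v, hv, hv'⟩
    · exact I.advances_local fr h hi rfl (show [] = [] from rfl)
        (by intro n hn; rcases hpc with rfl | rfl <;> cases fr <;> simp [bodyRank])
    · exact I.advances_local fr h hi rfl ⟨rfl, hn, hw⟩
        (by intro n hn; rcases hpc with rfl | rfl <;> cases fr <;> simp [bodyRank])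
    · exact I.advances_local fr h hi rfl ⟨rfl, hw⟩
        (by intro n hn; rcases hpc with rfl | rfl <;> cases fr <;> simp [bodyRank])
    · exact I.advances_local fr h hi rfl ⟨rfl, v, hv, hv', hg v rfl hv'⟩
        (by intro n hn; rcases hpc with rfl | rfl <;> cases fr <;> simp [bodyRank])
  interval_cases pc
  · obtain ⟨hs, p, q, x, h1, h2, h3⟩ := ha
    have hev : (Cond.neg (.same 2 3)).eval ρ = !decide (q = x) := by
      simp [Cond.eval, h1.2.2.1, h1.2.1]
    by_cases hx : q = x
    · rw [plain_step_jumpIf_false h (show harris.code 15 = .jumpIf (.neg (.same 2 3)) 19 from rfl)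
        (by rw [hev, decide_eq_true hx]; rfl)]
      subst hx
      exact I.advances_local fr h hi rfl ⟨hs, p, q, h1.window h2 h3⟩
        (by intro n hn; cases fr <;> simp [bodyRank])
    · rw [plain_step_jumpIf_true h (show harris.code 15 = .jumpIf (.neg (.same 2 3)) 19 from rfl)
        (by rw [hev, decide_eq_false hx]; rfl)]
      exact I.advances_local fr h hi rfl ⟨hs, p, q, x, h1, h2, h3⟩
        (by intro n hn; cases fr <;> simp [bodyRank])
  · obtain ⟨hs, p, x, h1⟩ := ha
    rw [plain_step_read h (show harris.code 16 = .read 5 3 1 from rfl) h1.1.2.1]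
    exact I.advances_local fr h hi rfl ⟨hs, Found.checked S (o := own t) (b := c.brk) 
      (ρ := Function.update ρ 5 (fld c.mem x)) hs h1 rfl⟩
      (by intro n hn; cases fr <;> simp [bodyRank])
  · exact hchecked 17 (.inl rfl) rfl h ha.1 ha.2
  · exact hreturn 18 (.inl rfl) rfl h ha.1 ha.2.1 ha.2.2
  · obtain ⟨hs, p, q, x, h1, h2, h3⟩ := ha
    rw [plain_step_cas h (show harris.code 19 = .cas 6 1 1 2 3 from rfl) h1.1.1.1]
    rcases casField_cases S (v := ρ 3) h1.1.1.2.1 h1.2.1 with ⟨h4, h5⟩ | ⟨h4, h5⟩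
    · rw [h5, h1.2.2.1]
      obtain ⟨u1, u2, u3, u4⟩ := S.unlink h1.1.1.2.1 h4 h1.2.2.2.2
      have hpx : nkey c.mem p < nkey c.mem x := h1.1.1.2.2.trans_le h2
      have hE := I.shape.union_eq u2
      have e := fun o => S.env_unlink (b := c.brk) h1.1.1.2.1 h4 h1.2.2.2.2 o
      have hs' := (e (own t)).saved S hs
      have hk : ∀ a, nkey (setFld c.mem p (nd x 0)) a = nkey c.mem a := fun a => nkey_setFld _ _ _ _
      refine I.advances (own t) (fr' := fr) h rfl I.nextId hE u1 (fun t' _ => e _) ?_ hi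
        ⟨hs', fun _ => ⟨p, x, ⟨⟨h1.1.1.1, h1.1.1.2.1, ?_⟩, h1.2.2.1, h1.2.2.2.1, ?_, fun hf => ⟨?_, ?_⟩⟩,
          fun v hst hv hR => ?_⟩, fun _ => rfl⟩ ?_
      · exact fun a ha => ⟨⟨(I.own_ok t a ha).1, (status_setFld _ _ _ _).trans (I.own_ok t a ha).2.1,
          fun haE => by
            have := (I.own_ok t a ha).2.2 haE
            show (fld (setFld c.mem p (nd x 0)) a).mark = 1
            rw [(e none).frozen a haE this, this]⟩, fun t' ht => I.own_inj t t' ht.symm a ha⟩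
      · exact (hk p).trans_lt h1.1.1.2.2
      · exact h2.trans_eq (hk x).symm
      · exact (fld_setFld _ _ _ _).trans (if_pos rfl)
      · show (fld (setFld c.mem p (nd x 0)) x).mark = 0
        rw [fld_setFld, if_neg (by rintro rfl; exact lt_irrefl _ hpx)]
        exact h3 hf
      · refine u4 v hR ?_
        rw [(hs.victim hst hv).2.2.1]
        exact h1.1.1.2.2
      · show bodyRank fr c.brk (keysAbove (setFld c.mem p (nd x 0)) c.brk (ρ 3)) 20 < _
        rw [keysAbove_congr _ hk]
        cases fr <;> simp [bodyRank]
    · rw [h5]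
      refine I.advances_local fr h hi rfl ⟨hs, fun hf => ?_, fun hf => absurd (h1.1.2.2.2.2 hf) h4⟩
        (by intro n hn; cases fr <;> simp [bodyRank])
      cases hf
  · obtain ⟨hs, h1, h2⟩ := ha
    by_cases hm : (ρ 6).isTrue = true
    · rw [plain_step_jumpIf_false h (show harris.code 20 = .jumpIf (.neg (.isTrue 6)) 0 from rfl)
        (by simp [Cond.eval, hm])]
      exact I.advances_local fr h hi rfl ⟨hs, h1 hm⟩
        (by intro n hn; cases fr <;> simp [bodyRank])
    · rw [plain_step_jumpIf_true h (show harris.code 20 = .jumpIf (.neg (.isTrue 6)) 0 from rfl)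
        (by simp [Cond.eval, hm])]
      have hfr : fr = false := Bool.eq_false_iff.2 fun hf => hm (h2 hf)
      exact I.advances_local true h hi rfl hs
        (by intro n hn; simp [bodyRank, hfr])
  · obtain ⟨hs, p, x, h1⟩ := ha
    rw [plain_step_read h (show harris.code 21 = .read 5 3 1 from rfl) h1.1.2.1]
    exact I.advances_local fr h hi rfl ⟨hs, Found.checked S (o := own t) (b := c.brk) 
      (ρ := Function.update ρ 5 (fld c.mem x)) hs h1 rfl⟩
      (by intro n hn; cases fr <;> simp [bodyRank])
  · exact hchecked 22 (.inr rfl) rfl h ha.1 ha.2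
  · exact hreturn 23 (.inr rfl) rfl h ha.1 ha.2.1 ha.2.2

end SearchWindow

section HarrisOperations

variable {N : ℕ} {c : Config (plain N harris).obj} {E : Set ℕ} {own : Fin N → Option ℕ} {t : Fin N}
  {req : SetOp × ℤ} {op : SetOp} {pc : ℕ} {st : List ℕ} {ρ : Var → Val}
  {regs : (plain N harris).obj.Reg → (plain N harris).obj.Word} {fr : Bool} {i : ℤ}

/-- A read into `vTmp` does not affect the course of the operation if the assertions at the two
instructions agree; the pointer read through may be null. -/
theorem Inv.advances_read_any (I : Inv c E own) {d p f pc' : ℕ}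
    (h : c.thr t = ⟨.body op pc, st, ρ, none, regs⟩) (hcode : harris.code pc = .read d p f)
    (hd : d ≠ 0) (hd3 : d ≠ 3) (hi : ρ 0 = .key (i : WithTop ℤ)) (hpc' : pc' = pc + 1)
    (ha : ∀ ρ', Assertion fr c.mem c.brk E (own t) (i : WithTop ℤ) st ρ' pc')
    (hr : ∀ n, n ≤ c.brk → bodyRank fr c.brk n pc' < bodyRank fr c.brk n pc)
    (hpc : pc + 1 ≠ 33 := by decide) :
    Advances fr c E t ((plain N harris).step t req c).1 := by
  have hi' : (plain N harris).prog.code pc = _ := hcode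
  have hx : ((plain N harris).step t req c).1 = c.setThr t ⟨.body op (pc + 1), st,
      Function.update ρ d (performDirect c (.read (ρ p) f)).2, none, regs⟩ := by
    have : (performDirect c (.read (ρ p) f)).1 = c := by
      unfold performDirect
      split <;> simp_all
      split <;> simp_all
    simp [step_body h, Integrated.bodyStep, hi', plain_issue h, h, hcode, Instr.dst, setVar,
      this]
  rw [hx]
  subst hpc'
  exact I.advances_local fr h (by rw [Function.update_of_ne hd.symm, hi])
    (by rw [Function.update_of_ne hd3.symm]) (ha _) hr hpc

/-- The code of membership tests. -/
theorem contains_advances (I : Inv c E own) (hpc : 24 ≤ pc) (hpc' : pc < 33)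
    (h : c.thr t = ⟨.body op pc, st, ρ, none, regs⟩) (hi : ρ 0 = .key (i : WithTop ℤ))
    (ha : Assertion fr c.mem c.brk E (own t) (i : WithTop ℤ) st ρ pc) :
    Advances fr c E t ((plain N harris).step t req c).1 := by
  interval_cases pc
  · obtain ⟨rfl, rfl⟩ := ha
    rw [step_call h (show harris.code 24 = .call 0 from rfl)]
    exact I.advances_local true h hi rfl (.inl rfl)
      (by intro n hn; simp [bodyRank])
  · exact I.advances_read_any h (show harris.code 25 = .read 5 3 1 from rfl) (by decide) (by decide)
      hi rfl (fun _ => ha) (by intro n hn; cases fr <;> simp [bodyRank])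
  · by_cases hm : (ρ 5).mark = 1
    · rw [plain_step_jumpIf_true h (show harris.code 26 = .jumpIf (.hasMark 5 1) 31 from rfl)
        (decide_eq_true hm)]
      exact I.advances_local fr h hi rfl ha (by intro n hn; cases fr <;> simp [bodyRank])
    · rw [plain_step_jumpIf_false h (show harris.code 26 = .jumpIf (.hasMark 5 1) 31 from rfl)
        (decide_eq_false hm)]
      exact I.advances_local fr h hi rfl ha (by intro n hn; cases fr <;> simp [bodyRank])
  · exact I.advances_read_any h (show harris.code 27 = .read 5 3 0 from rfl) (by decide) (by decide)
      hi rfl (fun _ => ha) (by intro n hn; cases fr <;> simp [bodyRank])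
  · rw [step_jumpIf h (show harris.code 28 = .jumpIf (.neg (Harris.keyEq 5 0)) 31 from rfl)]
    split
    · exact I.advances_local fr h hi rfl ha (by intro n hn; cases fr <;> simp [bodyRank])
    · exact I.advances_local fr h hi rfl ha (by intro n hn; cases fr <;> simp [bodyRank])
  · rw [step_bool h (show harris.code 29 = .bool 6 true from rfl)]
    exact I.advances_local fr h hi rfl ha (by intro n hn; cases fr <;> simp [bodyRank])
  · rw [plain_step_ret h (show harris.code 30 = .ret 6 from rfl)]
    exact I.advances_ret h (by intro b n; cases fr <;> simp [bodyRank])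
  · rw [step_bool h (show harris.code 31 = .bool 6 false from rfl)]
    exact I.advances_local fr h hi rfl ha (by intro n hn; cases fr <;> simp [bodyRank])
  · rw [plain_step_ret h (show harris.code 32 = .ret 6 from rfl)]
    exact I.advances_ret h (by intro b n; cases fr <;> simp [bodyRank])

/-- The code of insertions. -/
theorem insert_advances (I : Inv c E own) (hpc : 33 ≤ pc) (hpc' : pc < 44)
    (h : c.thr t = ⟨.body op pc, st, ρ, none, regs⟩) (hi : ρ 0 = .key (i : WithTop ℤ))
    (ha : Assertion fr c.mem c.brk E (own t) (i : WithTop ℤ) st ρ pc) :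
    Advances fr c E t ((plain N harris).step t req c).1 := by
  have S := I.shape
  interval_cases pc
  · obtain ⟨rfl, rfl⟩ := ha
    rw [plain_step_alloc h (show harris.code 33 =
      .alloc 7 fun f => if f = Harris.keyF then some 0 else none from rfl)]
    have hfs : ∀ f, (((if f = Harris.keyF then some 0 else none : Option Var).map ρ).getD .null) =
        if f = 0 then Val.key (i : WithTop ℤ) else .null := by
      intro f
      by_cases hf : f = 0
      · subst hf; exact hi
      · simp [Harris.keyF, hf]
    have hmem : ∀ fs : ℕ → Val, (c.allocAt c.brk fs).mem =
        Function.update c.mem c.brk ⟨fs, (c.mem c.brk).ext, c.brk, .active⟩ := by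
      intro fs; rw [← I.nextId]; rfl
    have hbrk : ∀ fs : ℕ → Val, (c.allocAt c.brk fs).brk = c.brk + 1 := by
      intro fs; simp [Config.allocAt]
    obtain ⟨a1, a2, a3⟩ := S.allocNode (x := (c.mem c.brk).ext)
      (fs := fun f => if f = 0 then Val.key (i : WithTop ℤ) else .null) ⟨_, rfl⟩
      (by
        intro f hf
        show Val.ref? (if f = 0 then _ else _) = none
        split <;> rfl)
    simp only [hfs]
    have hbE : c.brk ∉ E := fun hb => lt_irrefl _ (S.lt _ hb)
    refine I.advances (some c.brk) (fr' := false) (E' := E) (i := i) h rfl ?_ ?_ ?_ ?_ ?_ hi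
      ⟨rfl, rfl, c.brk, ?_, rfl, hbE, ?_, ?_⟩ ?_ (by decide)
      (.inr ⟨rfl, hbrk fun _ => .null⟩)
    · exact (congrArg (· + 1) I.nextId).trans (hbrk fun _ => .null).symm
    · show E ∪ {a | Reach (c.allocAt c.brk _).mem 0 a} = E
      rw [hmem]
      exact S.union_eq fun v => (a2 0 S.head_mem v).1
    · show ListShape (c.allocAt c.brk _).mem (c.allocAt c.brk fun _ => .null).brk E
      rw [hmem, hbrk]; exact a1
    · intro t' _
      show Env _ _ _ (c.allocAt c.brk _).mem (c.allocAt c.brk fun _ => .null).brk E _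
      rw [hmem, hbrk]
      exact a3 _ fun n hn => (I.own_ok t' n hn).1
    · rintro a ⟨⟩
      refine ⟨⟨?_, ?_, fun hb => absurd hb hbE⟩, fun t' _ ht => lt_irrefl _ (I.own_ok t' _ ht).1⟩
      · show _ < (c.allocAt c.brk fun _ => .null).brk
        rw [hbrk]; exact Nat.lt_succ_self _
      · show ((c.allocAt c.brk _).mem _).status = _
        rw [hmem, Function.update_self]
    · show Val.ptr (some ⟨c.brk, c.nextId⟩) 0 = _
      rw [I.nextId]; rfl
    · show _ < (c.allocAt c.brk fun _ => .null).brk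
      rw [hbrk]; exact Nat.lt_succ_self _
    · show nkey (c.allocAt c.brk _).mem _ = _
      rw [hmem, nkey, Function.update_self]; rfl
    · show bodyRank false (c.allocAt c.brk fun _ => .null).brk _ 34 < _
      rw [hbrk]
      simp [bodyRank]
      omega
  · obtain ⟨rfl, rfl, hn⟩ := ha
    rw [step_call h (show harris.code 34 = .call 0 from rfl)]
    exact I.advances_local true h hi rfl (.inr (.inl ⟨rfl, hn⟩))
      (by intro n hn; simp [bodyRank])
  · obtain ⟨rfl, hn, p, x, h1⟩ := ha
    rw [plain_step_read h (show harris.code 35 = .read 5 3 0 from rfl) h1.2.1]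
    obtain ⟨k, hk⟩ := S.keyForm x (S.lt x h1.2.2.1)
    refine I.advances_local fr h hi rfl ⟨rfl, hn, p, x, h1, ?_⟩
      (by intro n hn; cases fr <;> simp [bodyRank])
    show (c.mem x).fields 0 = _
    rw [nkey, hk]; rfl
  · obtain ⟨rfl, hn, p, x, h1, h2⟩ := ha
    have hev : (Cond.neg (Harris.keyEq 5 0)).eval ρ =
        !decide (nkey c.mem x = ((i : WithTop ℤ) : Key)) := by
      rw [Cond.eval, eval_keyEq, h2, hi]; rfl
    by_cases hk : nkey c.mem x = ((i : WithTop ℤ) : Key)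
    · rw [plain_step_jumpIf_false h (show harris.code 36 =
        .jumpIf (.neg (Harris.keyEq 5 0)) 40 from rfl)
        (hev.trans (by simp [hk]))]
      exact I.advances_local fr h hi rfl ⟨rfl, hn⟩
        (by intro n hn; cases fr <;> simp [bodyRank])
    · rw [plain_step_jumpIf_true h (show harris.code 36 =
        .jumpIf (.neg (Harris.keyEq 5 0)) 40 from rfl)
        (hev.trans (by simp [hk]))]
      exact I.advances_local fr h hi rfl ⟨rfl, hn, p, x, h1, lt_of_le_of_ne h1.2.2.2.1 (Ne.symm hk)⟩
        (by intro n hn; cases fr <;> simp [bodyRank])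
  · obtain ⟨rfl, n, h1⟩ := ha
    rw [plain_step_retire h (show harris.code 37 = .retire 7 from rfl) h1.1]
    exact I.advances_retire h hi h1.2.1 (fun hR => h1.2.2.1 (S.mem_of_reach hR))
      (fun _ _ _ _ => (rfl : [] = [])) (by intro n n'; cases fr <;> simp [bodyRank])
  · rw [step_bool h (show harris.code 38 = .bool 6 false from rfl)]
    exact I.advances_local fr h hi rfl ha (by intro n hn; cases fr <;> simp [bodyRank])
  · rw [plain_step_ret h (show harris.code 39 = .ret 6 from rfl)]
    exact I.advances_ret h (by intro b n; cases fr <;> simp [bodyRank])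
  · obtain ⟨rfl, ⟨n, h1⟩, p, x, h2, h3⟩ := ha
    rw [plain_step_write h (show harris.code 40 = .write 7 1 3 from rfl) h1.1, h2.2.1]
    obtain ⟨w1, w2, w3⟩ := S.writePrivate h1.2.2.1 (nd x 0)
    have hne : ∀ a ∈ E, fld (setFld c.mem n (nd x 0)) a = fld c.mem a := fun a ha => by
      rw [fld_setFld, if_neg (by rintro rfl; exact h1.2.2.1 ha)]
    have hk : ∀ a, nkey (setFld c.mem n (nd x 0)) a = nkey c.mem a := fun a => nkey_setFld _ _ _ _
    refine I.advances (own t) (fr' := fr) h rfl I.nextId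
      (S.union_eq fun v hv => (w2 0 S.head_mem v).1 hv) w1
      (fun t' ht => w3 _ (I.own_inj t t' ht.symm n h1.2.1)) ?_ hi
      ⟨rfl, n, ⟨h1.1, h1.2.1, h1.2.2.1, h1.2.2.2.1, (hk n).trans h1.2.2.2.2⟩, p, x,
        ⟨⟨h2.1.1, h2.1.2.1, (hk p).trans_lt h2.1.2.2⟩, h2.2.1, h2.2.2.1,
          h2.2.2.2.1.trans_eq (hk x).symm, fun hf => ⟨?_, ?_⟩⟩, h3.trans_eq (hk x).symm,
          (fld_setFld _ _ _ _).trans (if_pos rfl)⟩ ?_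
    · refine fun a ha => ⟨⟨(I.own_ok t a ha).1, (status_setFld _ _ _ _).trans (I.own_ok t a ha).2.1,
        fun haE => ?_⟩, fun t' ht => I.own_inj t t' ht.symm a ha⟩
      exact (congrArg Val.mark (hne a haE)).trans ((I.own_ok t a ha).2.2 haE)
    · exact (hne p h2.1.2.1).trans (h2.2.2.2.2 hf).1
    · exact (congrArg Val.mark (hne x h2.2.2.1)).trans (h2.2.2.2.2 hf).2
    · show bodyRank fr c.brk (keysAbove (setFld c.mem n (nd x 0)) c.brk (ρ 3)) 41 < _
      rw [keysAbove_congr _ hk]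
      cases fr <;> simp [bodyRank]
  · obtain ⟨rfl, n, h1, p, x, h2, h3, h4⟩ := ha
    rw [plain_step_cas h (show harris.code 41 = .cas 6 1 1 3 7 from rfl) h2.1.1]
    rcases casField_cases S (v := ρ 7) h2.1.2.1 h2.2.1 with ⟨h5, h6⟩ | ⟨h5, h6⟩
    · rw [h6, h1.1]
      have hpn : nkey c.mem p < nkey c.mem n := by rw [h1.2.2.2.2]; exact h2.1.2.2
      have hnx : nkey c.mem n < nkey c.mem x := by rw [h1.2.2.2.2]; exact h3
      have hna := (I.own_ok t n h1.2.1).2.1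
      obtain ⟨l1, l2, l3, -⟩ := S.link h2.1.2.1 h5 h1.2.2.1 h1.2.2.2.1 hna h4 hpn hnx
      have hE : E ∪ {a | Reach (setFld c.mem p (nd n 0)) 0 a} = insert n E := by
        ext a
        constructor
        · rintro (ha | ha)
          · exact .inr ha
          · exact (l3 a ha).imp_right S.mem_of_reach
        · rintro (rfl | ha)
          · exact .inr l2
          · exact .inl ha
      refine I.advances none (fr' := fr) h rfl I.nextId hE l1
        (fun t' ht => S.env_link h2.1.2.1 h5 h1.2.2.1 h1.2.2.2.1 hna h4 hpn hnx _
          (I.own_inj t t' ht.symm n h1.2.1)) (by simp) hi ⟨rfl, fun hf => by cases hf⟩ ?_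
      show bodyRank fr c.brk (keysAbove (setFld c.mem p (nd n 0)) c.brk (ρ 3)) 42 < _
      rw [keysAbove_congr _ fun a => nkey_setFld _ _ _ _]
      cases fr <;> simp [bodyRank]
    · rw [h6]
      have hfr : fr = false := Bool.eq_false_iff.2 fun hf => h5 (h2.2.2.2.2 hf).1
      exact I.advances_local fr h hi rfl ⟨rfl, fun _ => ⟨hfr, n, h1⟩⟩
        (by intro n hn; cases fr <;> simp [bodyRank])
  · obtain ⟨rfl, h1⟩ := ha
    by_cases hm : (ρ 6).isTrue = true
    · rw [plain_step_jumpIf_false h (show harris.code 42 = .jumpIf (.neg (.isTrue 6)) 34 from rfl)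
        (by simp [Cond.eval, hm])]
      exact I.advances_local fr h hi rfl (rfl : [] = [])
        (by intro n hn; cases fr <;> simp [bodyRank])
    · rw [plain_step_jumpIf_true h (show harris.code 42 = .jumpIf (.neg (.isTrue 6)) 34 from rfl)
        (by simp [Cond.eval, hm])]
      obtain ⟨hfr, hn⟩ := h1 (Bool.eq_false_iff.2 hm)
      exact I.advances_local fr h hi rfl ⟨rfl, hfr, hn⟩
        (by intro n hn; simp [bodyRank, hfr])
  · rw [plain_step_ret h (show harris.code 43 = .ret 6 from rfl)]
    exact I.advances_ret h (by intro b n; cases fr <;> simp [bodyRank])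

/-- The code of deletions. -/
theorem delete_advances (I : Inv c E own) (hpc : 44 ≤ pc)
    (h : c.thr t = ⟨.body op pc, st, ρ, none, regs⟩) (hi : ρ 0 = .key (i : WithTop ℤ))
    (ha : Assertion fr c.mem c.brk E (own t) (i : WithTop ℤ) st ρ pc) :
    Advances fr c E t ((plain N harris).step t req c).1 := by
  have S := I.shape
  have hpc' := ha.lt
  interval_cases pc
  · obtain ⟨rfl, rfl⟩ := ha
    rw [step_call h (show harris.code 44 = .call 0 from rfl)]
    exact I.advances_local true h hi rfl (.inr (.inr (.inl rfl)))
      (by intro n hn; simp [bodyRank])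
  · obtain ⟨rfl, p, x, h1⟩ := ha
    rw [plain_step_read h (show harris.code 45 = .read 5 3 0 from rfl) h1.2.1]
    obtain ⟨k, hk⟩ := S.keyForm x (S.lt x h1.2.2.1)
    refine I.advances_local fr h hi rfl ⟨rfl, p, x, h1, ?_⟩
      (by intro n hn; cases fr <;> simp [bodyRank])
    show (c.mem x).fields 0 = _
    rw [nkey, hk]; rfl
  · obtain ⟨rfl, p, x, h1, h2⟩ := ha
    have hev : (Cond.neg (Harris.keyEq 5 0)).eval ρ =
        !decide (nkey c.mem x = ((i : WithTop ℤ) : Key)) := by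
      rw [Cond.eval, eval_keyEq, h2, hi]; rfl
    by_cases hk : nkey c.mem x = ((i : WithTop ℤ) : Key)
    · rw [plain_step_jumpIf_false h (show harris.code 46 =
        .jumpIf (.neg (Harris.keyEq 5 0)) 59 from rfl)
        (hev.trans (by simp [hk]))]
      exact I.advances_local fr h hi rfl ⟨rfl, p, x, h1, hk⟩
        (by intro n hn; cases fr <;> simp [bodyRank])
    · rw [plain_step_jumpIf_true h (show harris.code 46 =
        .jumpIf (.neg (Harris.keyEq 5 0)) 59 from rfl)
        (hev.trans (by simp [hk]))]
      exact I.advances_local fr h hi rfl (rfl : [] = [])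
        (by intro n hn; cases fr <;> simp [bodyRank])
  · obtain ⟨rfl, p, x, h1, h2⟩ := ha
    rw [plain_step_read h (show harris.code 47 = .read 8 3 1 from rfl) h1.2.1]
    obtain ⟨d, m, h3, h4, h5, h6⟩ := S.next x h1.2.2.1 (by
      rintro rfl
      rw [S.key_tail] at h2
      exact absurd h2.symm (key_lt_top i).ne)
    exact I.advances_local fr h hi rfl ⟨rfl, p, x, d, m, h1, h2, h3, h5, h6, fun _ => h3⟩
      (by intro n hn; cases fr <;> simp [bodyRank])
  · obtain ⟨rfl, p, x, d, m, h1, h2, h3, h4, h5, h6⟩ := ha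
    rw [step_setMark h (show harris.code 48 = .setMark 8 8 0 from rfl), h3]
    refine I.advances_local fr h hi rfl ⟨rfl, p, x, d, h1, h2, rfl, h4, h5, fun hf => ?_⟩
      (by intro n hn; cases fr <;> simp [bodyRank])
    have hm := (h1.2.2.2.2 hf).2
    rw [h6 hf] at hm ⊢
    rw [nd_mark] at hm
    rw [hm]
  · obtain ⟨rfl, p, x, d, h1, h2, h3, h4⟩ := ha
    rw [step_setMark h (show harris.code 49 = .setMark 9 8 1 from rfl), h3]
    exact I.advances_local fr h hi rfl ⟨rfl, p, x, d, ⟨h1, h2, h3, h4⟩, rfl⟩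
      (by intro n hn; cases fr <;> simp [bodyRank])
  · obtain ⟨rfl, p, x, d, ⟨h1, h2, h3, h4, h5, h6⟩, h7⟩ := ha
    have hx := h1.2.2.1
    rw [plain_step_cas h (show harris.code 50 = .cas 6 3 1 8 9 from rfl) h1.2.1]
    rcases casField_cases S (v := ρ 9) hx h3 with ⟨h8, h9⟩ | ⟨h8, h9⟩
    · rw [h9, h7]
      have hx0 : x ≠ 0 := by
        rintro rfl
        rw [S.key_head] at h2
        exact absurd h2 (bot_lt_key i).ne
      have hpx : nkey c.mem p < nkey c.mem x := by rw [h2]; exact h1.1.2.2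
      obtain ⟨m1, m2, m3⟩ := S.markNode hx h8 hx0
      have hk : ∀ a, nkey (setFld c.mem x (nd d 1)) a = nkey c.mem a := fun a => nkey_setFld _ _ _ _
      have hfx : fld (setFld c.mem x (nd d 1)) x = nd d 1 := (fld_setFld _ _ _ _).trans (if_pos rfl)
      refine I.advances (some x) (fr' := fr) h rfl I.nextId
        (S.union_eq fun v hv => (m2 0 S.head_mem v).1 hv) m1 (fun _ _ => m3 _) ?_ hi
        ⟨rfl, fun _ => ⟨p, x, d, ⟨h1.1.1, h1.1.2.1, (hk p).trans_lt h1.1.2.2⟩, h1.2.1,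
          ⟨rfl, hx, (hk x).trans h2, congrArg Val.mark hfx⟩, h3, hfx, fun hf => ?_⟩, fun _ => rfl⟩ ?_
      · rintro a ⟨⟩
        refine ⟨⟨S.lt x hx, ?_, fun _ => congrArg Val.mark hfx⟩, fun t' _ ht => ?_⟩
        · -- an unmarked node is in the list, so that it is not retired
          refine (status_setFld _ _ _ _).trans ((S.status x (S.lt x hx)).resolve_right fun hr => ?_)
          exact S.retired x hr (S.unmarked x hx (by rw [h8]; rfl))
        · -- the nodes that other threads have marked are marked already
          have := (I.own_ok t' x ht).2.2 hx
          rw [h8] at this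
          exact absurd this (by simp)
      · refine (fld_setFld _ _ _ _).trans ((if_neg ?_).trans (h1.2.2.2.2 hf).1)
        rintro rfl
        exact lt_irrefl _ hpx
      · show bodyRank fr c.brk (keysAbove (setFld c.mem x (nd d 1)) c.brk (ρ 3)) 51 < _
        rw [keysAbove_congr _ hk]
        cases fr <;> simp [bodyRank]
    · rw [h9]
      refine I.advances_local fr h hi rfl ⟨rfl, fun hf => ?_, fun hf => absurd (h6 hf) h8⟩
        (by intro n hn; cases fr <;> simp [bodyRank])
      cases hf
  · obtain ⟨rfl, h1, h2⟩ := ha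
    by_cases hm : (ρ 6).isTrue = true
    · rw [plain_step_jumpIf_false h (show harris.code 51 = .jumpIf (.neg (.isTrue 6)) 44 from rfl)
        (by simp [Cond.eval, hm])]
      exact I.advances_local fr h hi rfl ⟨rfl, h1 hm⟩
        (by intro n hn; cases fr <;> simp [bodyRank])
    · rw [plain_step_jumpIf_true h (show harris.code 51 = .jumpIf (.neg (.isTrue 6)) 44 from rfl)
        (by simp [Cond.eval, hm])]
      have hfr : fr = false := Bool.eq_false_iff.2 fun hf => hm (h2 hf)
      exact I.advances_local fr h hi rfl ⟨rfl, hfr⟩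
        (by intro n hn; simp [bodyRank, hfr])
  · obtain ⟨rfl, p, x, d, h1⟩ := ha
    rw [step_move h (show harris.code 52 = .move 10 3 from rfl)]
    exact I.advances_local fr h hi rfl ⟨rfl, p, x, d, h1, h1.2.1⟩
      (by intro n hn; cases fr <;> simp [bodyRank])
  · obtain ⟨rfl, p, x, d, ⟨h1, h2, h3, h4, h5, h6⟩, h7⟩ := ha
    rw [plain_step_cas h (show harris.code 53 = .cas 6 1 1 3 8 from rfl) h1.1]
    rcases casField_cases S (v := ρ 8) h1.2.1 h2 with ⟨h8, h9⟩ | ⟨h8, h9⟩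
    · rw [h9, h4]
      have hch : Chain c.mem x d := .single h5
      obtain ⟨u1, u2, u3, u4⟩ := S.unlink h1.2.1 h8 hch
      have e := fun o => S.env_unlink (b := c.brk) h1.2.1 h8 hch o
      have hk : ∀ a, nkey (setFld c.mem p (nd d 0)) a = nkey c.mem a := fun a => nkey_setFld _ _ _ _
      have hxd := S.edge h3.2.1 ⟨1, h5⟩
      refine I.advances (own t) (fr' := fr) h rfl I.nextId (S.union_eq u2) u1 (fun t' _ => e _) ?_ hi
        ⟨rfl, ⟨x, h7, (e _).victim S h3, fun _ hR => ?_⟩, fun _ => rfl⟩ ?_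
      · exact fun a ha => ⟨⟨(I.own_ok t a ha).1, (status_setFld _ _ _ _).trans (I.own_ok t a ha).2.1,
          fun haE => by
            have := (I.own_ok t a ha).2.2 haE
            show (fld (setFld c.mem p (nd d 0)) a).mark = 1
            rw [(e none).frozen a haE this, this]⟩, fun t' ht => I.own_inj t t' ht.symm a ha⟩
      · have hdx := u4 x hR (by rw [h3.2.2.1]; exact h1.2.2)
        exact u1.not_reach_of_lt hxd.1 (by rw [hk, hk]; exact hxd.2) hdx
      · show bodyRank fr c.brk (keysAbove (setFld c.mem p (nd d 0)) c.brk (ρ 3)) 54 < _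
        rw [keysAbove_congr _ hk]
        cases fr <;> simp [bodyRank]
    · rw [h9]
      refine I.advances_local fr h hi rfl ⟨rfl, ⟨x, h7, h3, fun hf => ?_⟩,
          fun hf => absurd (h6 hf) h8⟩
        (by intro n hn; cases fr <;> simp [bodyRank])
      cases hf
  · obtain ⟨rfl, ⟨v, h1, h2, h3⟩, h4⟩ := ha
    by_cases hm : (ρ 6).isTrue = true
    · rw [plain_step_jumpIf_true h (show harris.code 54 = .jumpIf (.isTrue 6) 56 from rfl)
        (by simp [Cond.eval, hm])]
      exact I.advances_local fr h hi rfl ⟨rfl, v, h2, h1, h3 hm⟩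
        (by intro n hn; cases fr <;> simp [bodyRank])
    · rw [plain_step_jumpIf_false h (show harris.code 54 = .jumpIf (.isTrue 6) 56 from rfl)
        (by simp [Cond.eval, hm])]
      have hfr : fr = false := Bool.eq_false_iff.2 fun hf => hm (h4 hf)
      exact I.advances_local fr h hi rfl ⟨rfl, hfr, v, h2, h1⟩
        (by intro n hn; cases fr <;> simp [bodyRank])
  · obtain ⟨rfl, rfl, v, h1, h2⟩ := ha
    rw [step_call h (show harris.code 55 = .call 0 from rfl)]
    exact I.advances_local true h hi rfl (.inr (.inr (.inr ⟨rfl, v, h1, h2⟩)))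
      (by intro n hn; simp [bodyRank])
  · obtain ⟨rfl, v, h1, h2, h3⟩ := ha
    rw [plain_step_retire h (show harris.code 56 = .retire 10 from rfl) h2]
    exact I.advances_retire h hi h1.1 h3
      (fun _ _ _ _ => (rfl : [] = [])) (by intro n n'; cases fr <;> simp [bodyRank])
  · rw [step_bool h (show harris.code 57 = .bool 6 true from rfl)]
    exact I.advances_local fr h hi rfl ha (by intro n hn; cases fr <;> simp [bodyRank])
  · rw [plain_step_ret h (show harris.code 58 = .ret 6 from rfl)]
    exact I.advances_ret h (by intro b n; cases fr <;> simp [bodyRank])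
  · rw [step_bool h (show harris.code 59 = .bool 6 false from rfl)]
    exact I.advances_local fr h hi rfl ha (by intro n hn; cases fr <;> simp [bodyRank])
  · rw [plain_step_ret h (show harris.code 60 = .ret 6 from rfl)]
    exact I.advances_ret h (by intro b n; cases fr <;> simp [bodyRank])

end HarrisOperations

/-! ### Executions of Harris's list without reclamation -/

section HarrisExecutions

variable {N : ℕ}

theorem pro_advances {c : Config (plain N harris).obj} {E : Set ℕ} {own : Fin N → Option ℕ}
    (I : Inv c E own) {t : Fin N} {req : SetOp × ℤ} {op : SetOp} {st : List ℕ} {ρ : Var → Val}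
    {regs : (plain N harris).obj.Reg → (plain N harris).obj.Word} {i : ℤ} {fr : Bool}
    (h : c.thr t = ⟨.pro op [], st, ρ, none, regs⟩) (hst : st = [])
    (hi : ρ 0 = .key (i : WithTop ℤ)) :
    Advances fr c E t ((plain N harris).step t req c).1 := by
  rw [plain_step_pro h]
  have hE : grow E (c.setThr t ⟨.body op (harris.start op), st, ρ, none, regs⟩) = E :=
    I.shape.union_eq fun _ r => r
  have hok : ThreadOK false c E (own t)
      (⟨.body op (harris.start op), st, ρ, none, regs⟩ : Thread (plain N harris).obj) := by
    refine ⟨rfl, i, hi, ?_⟩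
    cases op
    · exact ⟨hst, rfl⟩
    · exact ⟨hst, rfl⟩
    · exact ⟨hst, rfl⟩
  refine ⟨Function.update own t (own t), false, ?_, ?_, ?_, ?_, ?_⟩
  · rw [hE]
    exact I.update (c' := c.setThr t ⟨.body op (harris.start op), st, ρ, none, regs⟩) t rfl I.nextId
      I.shape (fun _ _ => Env.rfl' _ _ _ _) (own t)
      (fun a ha => ⟨I.own_ok t a ha, fun t' ht => I.own_inj t t' ht.symm a ha⟩) hok
  · rw [hE]
    show ThreadOK false c E (Function.update own t (own t) t)
      (Function.update c.thr t
        (⟨.body op (harris.start op), st, ρ, none, regs⟩ : Thread (plain N harris).obj) t)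
    rw [Function.update_self, Function.update_self]
    exact hok
  · simp only [threadRank, Config.setThr, Function.update_self, h]
    have := keysAbove_le c.mem c.brk (ρ 3)
    cases op <;> simp [bodyRank, harris]
  · simp [Config.setThr]
  · simp only [Config.setThr, Function.update_self, h, allocsLeft]
    split <;> omega

theorem body_advances {c : Config (plain N harris).obj} {E : Set ℕ} {own : Fin N → Option ℕ}
    (I : Inv c E own) {t : Fin N} {req : SetOp × ℤ} {op : SetOp} {pc : ℕ} {st : List ℕ}
    {ρ : Var → Val} {regs : (plain N harris).obj.Reg → (plain N harris).obj.Word} {i : ℤ} {fr : Bool}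
    (h : c.thr t = ⟨.body op pc, st, ρ, none, regs⟩) (hi : ρ 0 = .key (i : WithTop ℤ))
    (ha : Assertion fr c.mem c.brk E (own t) (i : WithTop ℤ) st ρ pc) :
    Advances fr c E t ((plain N harris).step t req c).1 := by
  rcases lt_or_ge pc 4 with h1 | h1
  · exact search_start_advances I h1 h hi ha
  rcases lt_or_ge pc 15 with h2 | h2
  · exact traversal_advances I h1 h2 h hi ha
  rcases lt_or_ge pc 24 with h3 | h3
  · exact window_advances I h2 h3 h hi ha
  rcases lt_or_ge pc 33 with h4 | h4
  · exact contains_advances I h3 h4 h hi ha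
  rcases lt_or_ge pc 44 with h5 | h5
  · exact insert_advances I h4 h5 h hi ha
  · exact delete_advances I h5 h hi ha

/-- A thread that executes an operation either advances, or is about to respond. -/
theorem harris_advances {c : Config (plain N harris).obj} {E : Set ℕ} {own : Fin N → Option ℕ}
    (I : Inv c E own) {t : Fin N} (req : SetOp × ℤ) {fr : Bool}
    (h : ThreadOK fr c E (own t) (c.thr t)) (hidle : (c.thr t).ctrl ≠ .idle) :
    Advances fr c E t ((plain N harris).step t req c).1 ∨
      ∃ o v, (c.thr t).ctrl = .epi o [] v := by
  obtain ⟨h1, h2⟩ := h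
  rcases hth : c.thr t with ⟨ctrl, st, ρ, frame, regs⟩
  rw [hth] at h1 h2 hidle
  simp only at h1 h2 hidle
  subst h1
  cases ctrl with
  | idle => exact absurd rfl hidle
  | pro o ks =>
    obtain ⟨rfl, h3, -, i, h4⟩ := h2
    exact .inl (pro_advances I hth h3 h4)
  | body o pc =>
    obtain ⟨i, h3, h4⟩ := h2
    exact .inl (body_advances I hth h3 h4)
  | epi o ks v =>
    have h2 : ks = [] := h2
    subst h2
    exact .inr ⟨o, v, rfl⟩

/-- The invariant for a step that only changes the control state of a thread between operations. -/
theorem Inv.setThr {A : Scheme.Obj N} {c : Config A} {E : Set ℕ} {own : Fin N → Option ℕ}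
    (I : Inv c E own) (t : Fin N) {th : Thread A} (h : ThreadOK false c E (own t) th) :
    Inv (c.setThr t th) (grow E (c.setThr t th)) (Function.update own t (own t)) := by
  have hE : grow E (c.setThr t th) = E := I.shape.union_eq fun _ r => r
  rw [hE]
  exact I.update (c' := c.setThr t th) t rfl I.nextId I.shape (fun _ _ => Env.rfl' _ _ _ _) (own t)
    (fun a ha => ⟨I.own_ok t a ha, fun t' ht => I.own_inj t t' ht.symm a ha⟩) h

theorem Inv.step {c : Config (plain N harris).obj} {E : Set ℕ} {own : Fin N → Option ℕ}
    (I : Inv c E own) (t : Fin N) (req : SetOp × ℤ) :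
    ∃ own', Inv ((plain N harris).step t req c).1 (grow E ((plain N harris).step t req c).1) own' ∧
      ((∀ v, ((plain N harris).step t req c).2 ≠ .opRes v) →
        ((plain N harris).step t req c).1.brk +
          allocsLeft ((((plain N harris).step t req c).1.thr t).ctrl) ≤
        c.brk + allocsLeft ((c.thr t).ctrl)) := by
  by_cases hidle : (c.thr t).ctrl = .idle
  · have hf := (I.thr t).1
    rcases hth : c.thr t with ⟨ctrl, st, ρ, frame, regs⟩
    rw [hth] at hf hidle
    simp only at hf hidle
    subst hf hidle
    rw [plain_step_idle hth]
    refine ⟨_, I.setThr t ⟨rfl, rfl, rfl, rfl, req.2, rfl⟩, fun _ => ?_⟩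
    simp [Config.setThr, allocsLeft]
  · rcases harris_advances I req (I.thr t) hidle with ⟨own', fr', h1, -, -, -, h2⟩ | ⟨o, v, h1⟩
    · exact ⟨own', h1, fun _ => h2⟩
    · have hf := (I.thr t).1
      rcases hth : c.thr t with ⟨ctrl, st, ρ, frame, regs⟩
      rw [hth] at hf h1
      simp only at hf h1
      subst hf h1
      rw [plain_step_epi hth]
      exact ⟨_, I.setThr t ⟨rfl, trivial⟩, fun h => absurd rfl (h v)⟩

/-- The nodes that have been in the list in some configuration up to the `i`-th one. -/
noncomputable def everReached (N : ℕ) (s : Schedule N) : ℕ → Set ℕ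
  | 0 => {a | Reach ((plain N harris).conf s 0).mem 0 a}
  | i + 1 => grow (everReached N s i) ((plain N harris).conf s (i + 1))

theorem everReached_mono {s : Schedule N} {i j : ℕ} (h : i ≤ j) :
    everReached N s i ⊆ everReached N s j := by
  induction h with
  | refl => exact subset_rfl
  | step _ ih => exact ih.trans Set.subset_union_left

theorem reach_subset_everReached (s : Schedule N) (i : ℕ) {a : ℕ}
    (h : Reach ((plain N harris).conf s i).mem 0 a) : a ∈ everReached N s i := by
  cases i with
  | zero => exact h
  | succ i => exact .inr h

theorem initial_mem {a : ℕ} (ha : 2 ≤ a) : (plain N harris).initial.mem a =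
    { fields := fun _ => .null, ext := (), id := 0, status := .system } := by
  have : harris.init[a]? = none := by simp [harris]; omega
  simp only [Integrated.initial, plain, this]
  rfl

theorem inv_initial (s : Schedule N) :
    Inv ((plain N harris).conf s 0) (everReached N s 0) fun _ => none := by
  set M := ((plain N harris).conf s 0).mem with hM
  have f0 : fld M 0 = nd 1 0 := rfl
  have f1 : fld M 1 = .null := rfl
  have hR : ∀ a, Reach M 0 a ↔ a = 0 ∨ a = 1 := by
    intro a
    constructor
    · intro r
      induction r with
      | refl => exact .inl rfl
      | tail _ e ih =>
        obtain ⟨m, hm⟩ := e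
        rcases ih with rfl | rfl
        · rw [f0, nd_inj] at hm
          exact .inr hm.1.symm
        · rw [f1] at hm
          exact absurd hm.symm (nd_ne_null _ _)
    · rintro (rfl | rfl)
      · exact .refl
      · exact .single ⟨0, f0⟩
  have hE : ∀ a, a ∈ everReached N s 0 ↔ a = 0 ∨ a = 1 := hR
  have hlt : ∀ a, a < 2 → a = 0 ∨ a = 1 := by omega
  have hge : ∀ a, 2 ≤ a → M a = { fields := fun _ => .null, ext := (), id := 0, status := .system } :=
    fun a ha => initial_mem ha
  have k0 : nkey M 0 = ⊥ := rfl
  have k1 : nkey M 1 = ⊤ := rfl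
  refine ⟨⟨?_, ?_, ?_, ?_, ?_, ?_, f1, ⟨1, f0⟩, (hE 0).2 (.inl rfl), (hE 1).2 (.inr rfl), k0, k1,
    fun a ha _ => (hR a).2 ((hE a).1 ha), ?_⟩, rfl, by simp, by simp, fun t => ⟨rfl, trivial⟩⟩
  · intro a ha
    rcases hlt a ha with rfl | rfl <;> rfl
  · intro a ha
    rcases hlt a ha with rfl | rfl <;> exact .inl rfl
  · intro a ha
    rcases hlt a ha with rfl | rfl
    · exact ⟨⊥, rfl⟩
    · exact ⟨⊤, rfl⟩
  · intro a f hf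
    rcases lt_or_ge a 2 with ha | ha
    · rcases hlt a ha with rfl | rfl
      · show Val.ref? (if f = Harris.keyF then _ else if f = Harris.nextF then _ else _) = none
        split
        · rfl
        · rw [if_neg (show ¬ f = Harris.nextF from hf)]; rfl
      · show Val.ref? (if f = Harris.keyF then _ else _) = none
        split <;> rfl
    · show ((M a).fields f).ref? = none
      rw [hge a ha]; rfl
  · intro a ha
    rcases (hE a).1 ha with rfl | rfl
    · exact Nat.zero_lt_two
    · exact Nat.one_lt_two
  · intro a ha ha1
    rcases (hE a).1 ha with rfl | rfl
    · exact ⟨1, 0, f0, by simp, (hE 1).2 (.inr rfl), by rw [← hM, k0, k1]; exact bot_lt_top⟩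
    · exact absurd rfl ha1
  · intro a ha hr
    rcases (hR a).1 hr with rfl | rfl <;> cases ha

theorem exists_inv (s : Schedule N) (i : ℕ) :
    ∃ own, Inv ((plain N harris).conf s i) (everReached N s i) own := by
  induction i with
  | zero => exact ⟨_, inv_initial s⟩
  | succ i ih =>
    obtain ⟨own, I⟩ := ih
    obtain ⟨own', h, -⟩ := I.step (s i).1 (s i).2
    exact ⟨own', h⟩

/-! ### Progress of Harris's list without reclamation -/

/-- A thread that runs alone responds within a number of steps given by its rank. -/
theorem solo_responds {s : Schedule N} {t : Fin N} (r : ℕ) {k : ℕ} {fr : Bool}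
    {own : Fin N → Option ℕ} (I : Inv ((plain N harris).conf s k) (everReached N s k) own)
    (h : ThreadOK fr ((plain N harris).conf s k) (everReached N s k) (own t)
      ((plain N harris).thread s t k))
    (hr : threadRank fr ((plain N harris).conf s k) t ≤ r)
    (hidle : ((plain N harris).thread s t k).ctrl ≠ .idle)
    (hs : ∀ j, j ≤ r → (s (k + j)).1 = t) :
    ∃ j v, j ≤ r ∧ (plain N harris).event s (k + j) = .opRes v := by
  induction r generalizing k fr own with
  | zero =>
    have h0 := hs 0 le_rfl
    rcases harris_advances I (s k).2 h hidle with ⟨_, _, -, -, h2, -⟩ | ⟨o, v, h1⟩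
    · omega
    · refine ⟨0, v, le_rfl, ?_⟩
      have hf := h.1
      simp only [Integrated.thread] at hf h1
      rcases hth : ((plain N harris).conf s k).thr t with ⟨ctrl, st, ρ, frame, regs⟩
      rw [hth] at hf h1
      simp only at hf h1
      subst hf h1
      simp only [Integrated.event, Nat.add_zero] at h0 ⊢
      rw [h0, plain_step_epi hth]
  | succ r ih =>
    have h0 := hs 0 (Nat.zero_le _)
    rw [Nat.add_zero] at h0
    rcases harris_advances I (s k).2 h hidle with ⟨own', fr', I', h2, h3, h4, -⟩ | ⟨o, v, h1⟩
    · have hc : (plain N harris).conf s (k + 1) =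
          ((plain N harris).step t (s k).2 ((plain N harris).conf s k)).1 := by
        rw [← h0]; rfl
      have hE : everReached N s (k + 1) = grow (everReached N s k) ((plain N harris).conf s (k + 1)) :=
        rfl
      rw [← hc] at I' h2 h3 h4
      rw [← hE] at I' h2
      obtain ⟨j, v, h5, h6⟩ := ih I' h2 (by omega) h4 (fun j hj => by
        rw [Nat.add_assoc, Nat.add_comm 1 j]; exact hs (j + 1) (by omega))
      exact ⟨j + 1, v, by omega, by rw [Nat.add_comm j 1, ← Nat.add_assoc]; exact h6⟩
    · refine ⟨0, v, Nat.zero_le _, ?_⟩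
      have hf := h.1
      simp only [Integrated.thread] at hf h1
      rcases hth : ((plain N harris).conf s k).thr t with ⟨ctrl, st, ρ, frame, regs⟩
      rw [hth] at hf h1
      simp only at hf h1
      subst hf h1
      simp only [Integrated.event, Nat.add_zero]
      rw [h0, plain_step_epi hth]

theorem threadRank_le (fr : Bool) {A : Scheme.Obj N} (c : Config A) (t : Fin N) :
    threadRank fr c t ≤ 24 * c.brk + 500 := by
  unfold threadRank
  split
  · omega
  · omega
  · omega
  · rename_i pc _
    have := keysAbove_le c.mem c.brk ((c.thr t).vars 3)
    have h2 : ∀ pc, [0, 0, 0, 108, 107, 106, 105, 104, 103, 102, 101, 111, 110, 109, 108].getD pc 0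
        ≤ 111 := by
      intro pc
      rcases lt_or_ge pc 15 with h | h
      · interval_cases pc <;> simp
      · rw [List.getD_eq_default _ _ (by simpa using h)]; omega
    have := h2 pc
    unfold bodyRank
    split <;> split <;> try omega
    all_goals split <;> try omega
    all_goals split <;> try omega
    all_goals split <;> omega

/-- A thread that runs alone for long enough responds, even if it has to invoke an operation
first. -/
theorem exists_response_of_solo {s : Schedule N} {t : Fin N} {k B : ℕ}
    (hB : ((plain N harris).conf s k).brk ≤ B)
    (hs : ∀ j, j ≤ 24 * B + 501 → (s (k + j)).1 = t) :
    ∃ i v, k ≤ i ∧ i ≤ k + (24 * B + 501) ∧ (plain N harris).event s i = .opRes v := by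
  have main : ∀ k', k ≤ k' → k' ≤ k + 1 → ((plain N harris).conf s k').brk ≤ B →
      ((plain N harris).thread s t k').ctrl ≠ .idle →
      ∃ i v, k ≤ i ∧ i ≤ k + (24 * B + 501) ∧ (plain N harris).event s i = .opRes v := by
    intro k' h1 h2 h3 h4
    obtain ⟨own, I⟩ := exists_inv s k'
    obtain ⟨j, v, h5, h6⟩ := solo_responds (24 * B + 500) I (I.thr t)
      ((threadRank_le _ _ _).trans (by omega)) h4 (fun j hj => by
        have := hs (k' - k + j) (by omega)
        rwa [show k + (k' - k + j) = k' + j by omega] at this)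
    exact ⟨k' + j, v, by omega, by omega, h6⟩
  by_cases hidle : ((plain N harris).thread s t k).ctrl = .idle
  · obtain ⟨own, I⟩ := exists_inv s k
    have hf := (I.thr t).1
    simp only [Integrated.thread] at hidle
    rcases hth : ((plain N harris).conf s k).thr t with ⟨ctrl, st, ρ, frame, regs⟩
    rw [hth] at hf hidle
    simp only at hf hidle
    subst hf hidle
    have h0 := hs 0 (by omega)
    have hc : (plain N harris).conf s (k + 1) = _ :=
      (show _ = ((plain N harris).step t (s k).2 _).1 by rw [← h0]; rfl).trans
        (congrArg Prod.fst (plain_step_idle hth))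
    refine main (k + 1) (by omega) le_rfl ?_ ?_
    · rw [hc]; exact hB
    · rw [Integrated.thread, hc]; simp [Config.setThr]
  · exact main k le_rfl (by omega) hB hidle

section

variable {A : Scheme.Obj N}

theorem thr_retireRef (c : Config A) (r : Ref) : (c.retireRef r).thr = c.thr := by
  unfold Config.retireRef; split <;> rfl

theorem thr_retireCall (c : Config A) (a : Call) : (c.retireCall a).thr = c.thr := by
  unfold Config.retireCall; split
  · exact thr_retireRef _ _
  · rfl

theorem thr_casField (c : Config A) (r : Ref) (f : ℕ) (e n : Val) :
    (c.casField r f e n).1.thr = c.thr := by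
  unfold Config.casField; split <;> rfl

theorem thr_reclaimAt (c : Config A) (a : ℕ) (b : Bool) : (c.reclaimAt a b).thr = c.thr := by
  unfold Config.reclaimAt; split <;> rfl

theorem thr_performDirect (c : Config A) (a : Call) : (performDirect c a).1.thr = c.thr := by
  cases a <;> simp only [performDirect]
  · split <;> rfl
  · split <;> rfl
  · split
    · exact thr_casField _ _ _ _ _
    · rfl
  · rfl
  · exact thr_retireCall _ _

end

theorem step_thr_of_ne (I : Integrated N) {t t' : Fin N} (h : t' ≠ t) (req : SetOp × ℤ)
    (c : Config I.obj) : (I.step t req c).1.thr t' = c.thr t' := by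
  have hset : ∀ (d : Config I.obj) th, (d.setThr t th).thr t' = d.thr t' := fun d th =>
    Function.update_of_ne h _ _
  have hissue : ∀ a, (I.issue t c a).1.thr t' = c.thr t' := by
    intro a
    unfold Integrated.issue
    split
    · rw [hset, thr_retireCall]
    · rw [hset, thr_performDirect]
  unfold Integrated.step
  dsimp only
  split
  · unfold Integrated.apiStep
    dsimp only
    split
    case h_8 =>
      split
      · split <;> exact hset _ _
      · exact hset _ _
    case h_9 => split <;> first | exact hset _ _ | rfl
    case h_10 => split <;> exact hset _ _
    case h_6 =>
      rw [hset, thr_casField]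
    case h_7 =>
      rw [hset, thr_reclaimAt]
    all_goals exact hset _ _
  · split
    · exact hset _ _
    · exact hissue _
    · exact hset _ _
    · unfold Integrated.bodyStep
      dsimp only
      split <;> first | exact hset _ _ | exact hissue _
    · exact hissue _
    · exact hset _ _

/-- As long as no operation responds, only finitely many nodes get allocated. -/
theorem brk_le_of_no_response {s : Schedule N} {k i : ℕ} (hk : k ≤ i)
    (h : ∀ j v, k ≤ j → (plain N harris).event s j ≠ .opRes v) :
    ((plain N harris).conf s i).brk + ∑ t, allocsLeft ((plain N harris).thread s t i).ctrl ≤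
      ((plain N harris).conf s k).brk + ∑ t, allocsLeft ((plain N harris).thread s t k).ctrl := by
  induction i, hk using Nat.le_induction with
  | base => exact le_rfl
  | succ i hi ih =>
    refine le_trans ?_ ih
    obtain ⟨own, I⟩ := exists_inv s i
    obtain ⟨own', -, h1⟩ := I.step (s i).1 (s i).2
    have h2 := h1 fun v => h i v hi
    rw [← Finset.add_sum_erase _ _ (Finset.mem_univ (s i).1),
      ← Finset.add_sum_erase (a := (s i).1) _ _ (Finset.mem_univ (s i).1)]
    have h3 : ∀ t ∈ Finset.univ.erase (s i).1,
        allocsLeft ((plain N harris).thread s t (i + 1)).ctrl =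
          allocsLeft ((plain N harris).thread s t i).ctrl := by
      intro t ht
      simp only [Integrated.thread, Integrated.conf]
      rw [step_thr_of_ne _ (Finset.ne_of_mem_erase ht)]
    rw [Finset.sum_congr rfl h3]
    simp only [Integrated.thread, Integrated.conf] at h2 ⊢
    omega

/-- Harris's list is clash-free: if no operation responded any more, then the number of nodes would
be bounded, and with it the rank of a thread that runs alone for longer than that. -/
theorem harris_guaranteesMinimal (hN : 0 < N) :
    (plain N harris).GuaranteesMinimal .isolating := by
  refine ⟨fun s hs k => ?_, ?_⟩
  · rintro ⟨t, -, ht⟩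
    by_contra hno
    push Not at hno
    set B := ((plain N harris).conf s k).brk +
      ∑ t, allocsLeft ((plain N harris).thread s t k).ctrl with hB
    obtain ⟨i, hi⟩ := hs t ht (k + (24 * B + 502))
    have hb := brk_le_of_no_response (i := max i k) (le_max_right i k) fun j v hj => hno j v hj
    obtain ⟨j, v, h1, -, h2⟩ := exists_response_of_solo (s := s) (t := t) (k := max i k) (B := B)
      (by omega)
      (fun j hj => by
        have := hi (max i k - i + j) (by omega)
        rwa [show i + (max i k - i + j) = max i k + j by omega] at this)
    exact hno j v ((le_max_right i k).trans h1) h2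
  · refine ⟨fun _ => (⟨0, hN⟩, .contains, 0), fun t ht k => ⟨0, fun j _ => ?_⟩, fun k t ht => ?_⟩
    · obtain ⟨i, -, h⟩ := ht 0
      exact h
    · obtain ⟨-, ht⟩ := ht
      obtain ⟨i, -, h⟩ := ht 0
      obtain ⟨j, v, h1, -, h2⟩ := exists_response_of_solo
        (s := fun _ => (⟨0, hN⟩, .contains, 0)) (t := t) (k := k) le_rfl fun _ _ => h
      exact ⟨j, v, h1, h, h2⟩

/-! ### Harris's list is a plain implementation -/

theorem reach_of_reachable {M : ℕ → Cell Unit} {b : ℕ} {E : Set ℕ} (S : ListShape M b E)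
    {c : Config (plain N harris).obj} (hM : c.mem = M) {a : ℕ} (h : Reachable harris c a) :
    Reach M 0 a := by
  subst hM
  obtain ⟨a0, h0, hr⟩ := h
  induction hr with
  | refl =>
    have h0 : a0 = 0 ∨ a0 = 1 := by simpa [harris] using h0
    rcases h0 with rfl | rfl
    · exact .refl
    · exact S.unmarked 1 S.tail_mem (by rw [S.fld_tail]; rfl)
  | @tail x y _ e ih =>
    obtain ⟨f, r, h1, rfl⟩ := e
    have hf : f = 1 := by
      by_contra hf
      rw [S.noRef x f hf] at h1
      cases h1
    subst hf
    have hx1 : x ≠ 1 := by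
      rintro rfl
      have := S.fld_tail
      unfold fld at this
      rw [this] at h1
      cases h1
    obtain ⟨d, m, h2, -⟩ := S.next x (S.mem_of_reach ih) hx1
    have h3 := h2
    unfold fld at h3
    rw [h3] at h1
    cases h1
    exact ih.tail ⟨m, h2⟩

theorem bodyStep_retire {I : Integrated N} {t : Fin N} {c : Config I.obj} {o : SetOp} {pc : ℕ}
    {p v : Val} {d : Option Var} (h : (I.bodyStep t c o pc).2 = .direct (.retire p) v d) :
    ∃ x, I.prog.code pc = .retire x ∧ p = (c.thr t).vars x := by
  unfold Integrated.bodyStep at h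
  cases hc : I.prog.code pc <;> simp only [hc] at h <;> try cases h
  all_goals
    unfold Integrated.issue at h
    split at h <;> simp at h
  exact ⟨_, rfl, h.1.symm⟩

theorem harris_code_of_le {pc : ℕ} (h : 61 ≤ pc) : harris.code pc = .goto pc := by
  show Harris.code.getD pc (.goto pc) = _
  rw [List.getD_eq_default _ _ (by simpa [Harris.code] using h)]

theorem harris_isPlain (N : ℕ) : IsPlain N harris := by
  constructor
  · intro pc d k args h
    rcases lt_or_ge pc 61 with h1 | h1
    · interval_cases pc <;> cases h
    · rw [harris_code_of_le h1] at h
      cases h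
  · simp [harris]
  · intro fs hfs f r h
    have hfs : fs = Harris.headNode ∨ fs = Harris.tailNode := by simpa [harris] using hfs
    rcases hfs with rfl | rfl
    · unfold Harris.headNode at h
      split at h
      · cases h
      · split at h <;> cases h
        exact ⟨by simp [harris], rfl⟩
    · unfold Harris.tailNode at h
      split at h <;> cases h
  · intro s i p v d h
    obtain ⟨own, I⟩ := exists_inv s i
    obtain ⟨h1, h2⟩ := I.thr (s i).1
    simp only [Integrated.event] at h
    rcases hth : ((plain N harris).conf s i).thr (s i).1 with ⟨ctrl, st, ρ, frame, regs⟩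
    rw [hth] at h1 h2
    simp only at h1 h2
    subst h1
    cases ctrl with
    | idle => rw [plain_step_idle hth] at h; cases h
    | pro o ks =>
      obtain ⟨rfl, -⟩ := h2
      rw [plain_step_pro hth] at h; cases h
    | epi o ks v =>
      have h2 : ks = [] := h2
      subst h2
      rw [plain_step_epi hth] at h; cases h
    | body o pc =>
      obtain ⟨j, h3, h4⟩ := h2
      rw [step_body hth] at h
      obtain ⟨x, h5, rfl⟩ := bodyStep_retire h
      have h5 : harris.code pc = .retire x := h5
      rw [hth]
      have hlt := h4.lt
      have hcase : (pc = 37 ∧ x = 7) ∨ (pc = 56 ∧ x = 10) := by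
        interval_cases pc <;> first | (cases h5; done) | skip
        · cases h5; exact .inl ⟨rfl, rfl⟩
        · cases h5; exact .inr ⟨rfl, rfl⟩
      rcases hcase with ⟨rfl, rfl⟩ | ⟨rfl, rfl⟩
      · obtain ⟨-, n, h6⟩ := h4
        exact ⟨⟨n, n⟩, by simp only [h6.1]; rfl, (I.own_ok _ n h6.2.1).2.1⟩
      · obtain ⟨-, n, h6, h7, -⟩ := h4
        exact ⟨⟨n, n⟩, by simp only [h7]; rfl, (I.own_ok _ n h6.1).2.1⟩
  · intro s i a ha hr
    obtain ⟨own, I⟩ := exists_inv s i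
    exact I.shape.retired a ha (reach_of_reachable I.shape rfl hr)

end HarrisExecutions

/-! ### Access-awareness of Harris's list -/

section ControlFlow

variable {N : ℕ}

/-- The control state and the stack after an instruction, unless it issues a call that an operation
of a scheme has yet to perform. -/
def Integrated.follow (I : Integrated N) (o : SetOp) (pc : ℕ) (st : List ℕ) (ρ : Var → Val) :
    Ctrl × List ℕ :=
  match I.prog.code pc with
  | .jumpIf b q => (.body o (if b.eval ρ then q else pc + 1), st)
  | .goto q => (.body o q, st)
  | .call q => (.body o q, (pc + 1) :: st)
  | .return => (.body o (st.headD 0), st.tail)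
  | .ret s => (.epi o (I.epi o) (ρ s), st)
  | _ => (.body o (pc + 1), st)

theorem plain_follow {P : Program} {c : Config (plain N P).obj} {t : Fin N} {req : SetOp × ℤ}
    {o : SetOp} {pc : ℕ} {st : List ℕ} {ρ : Var → Val}
    {regs : (plain N P).obj.Reg → (plain N P).obj.Word}
    (h : c.thr t = ⟨.body o pc, st, ρ, none, regs⟩) :
    ((((plain N P).step t req c).1.thr t).ctrl, (((plain N P).step t req c).1.thr t).stack) =
        (plain N P).follow o pc st ρ ∧
      (((plain N P).step t req c).2 = .quiet (P.code pc).dst ∨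
        ∃ a v, ((plain N P).step t req c).2 = .direct a v (P.code pc).dst) := by
  have hp : (plain N P).prog = P := rfl
  rw [step_body h]
  unfold Integrated.bodyStep Integrated.follow
  rw [hp]
  cases hi : P.code pc <;> simp [h, plain_issue h, Config.setThr, Instr.dst, hi]

end ControlFlow

section AccessAwareness

variable {N : ℕ} {s : Schedule N}

local notation "pH" => plain N harris

/-- The instructions in the write phases: in a search, those from the compare-and-swap on, and
otherwise those that follow a search. -/
def writePhase (pc : ℕ) : Bool := decide (19 ≤ pc ∧ pc ∉ [24, 33, 34, 44, 55])

/-- The variables that hold permitted pointers at an instruction in a read-only phase. -/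
def permittedVars (pc : ℕ) : List Var :=
  [[], [1], [1, 2], [1, 3], [1, 3, 4], [1, 3, 4], [1, 3, 4], [1, 3, 4], [1, 3, 4], [1, 3, 4], [1, 4],
    [1, 3], [1, 3], [1, 3], [1, 3, 4], [1, 3], [1, 3], [1, 3], [1, 3]].getD pc []

/-- After the instruction, `v` is permitted, if the variables in `l` have been before. -/
def Instr.Permits (l : List Var) (v : Var) (ins : Instr) : Prop :=
  (ins.dst ≠ some v ∧ v ∈ l) ∨ (∃ g, ins = .global v g) ∨ (∃ q f, ins = .read v q f ∧ q ∈ l) ∨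
    (∃ q, ins = .move v q ∧ q ∈ l) ∨ ∃ q k, ins = .setMark v q k ∧ q ∈ l

/-- The instructions of an insertion that follow the allocation, with those of its searches. -/
def Inserting (st : List ℕ) (pc : ℕ) : Prop := pc < 24 ∧ st = [35] ∨ 34 ≤ pc ∧ pc < 44

/-- The possible next instructions; `25`, `35`, `45`, `56` are the return addresses of searches. -/
noncomputable def successors (pc : ℕ) : List ℕ :=
  match harris.code pc with
  | .jumpIf _ q => [q, pc + 1]
  | .goto q => [q]
  | .call q => [q]
  | .return => [25, 35, 45, 56]
  | .ret _ => []
  | _ => [pc + 1]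

theorem follow_successors {o o' : SetOp} {pc pc' : ℕ} {st st' : List ℕ} {ρ : Var → Val}
    (h : (pH).follow o pc st ρ = (.body o' pc', st'))
    (hst : pc < 24 → st = [25] ∨ st = [35] ∨ st = [45] ∨ st = [56]) (hpc : pc < 61) :
    pc' ∈ successors pc := by
  have hp : (pH).prog = harris := rfl
  unfold Integrated.follow at h
  unfold successors
  rw [hp] at h
  have hret : harris.code pc = .return → pc < 24 := by
    intro hr
    interval_cases pc <;> first | (cases hr; done) | norm_num
  cases hi : harris.code pc <;> simp only [hi, Prod.mk.injEq, Ctrl.body.injEq, reduceCtorEq,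
    false_and] at h
  case jumpIf =>
    obtain ⟨⟨-, rfl⟩, -⟩ := h
    dsimp only
    split <;> simp
  all_goals
    obtain ⟨⟨-, rfl⟩, -⟩ := h
    first
    | exact List.mem_singleton_self _
    | rcases hst (hret hi) with rfl | rfl | rfl | rfl <;> simp

/-- The choice of `permittedVars` is sound for steps within a read-only phase. -/
theorem permits_of_successor {pc : ℕ} (hpc : pc < 61) (h : writePhase pc = false) :
    ∀ pc' ∈ successors pc, writePhase pc' = false →
      ∀ v ∈ permittedVars pc', (harris.code pc).Permits (permittedVars pc) v := by
  interval_cases pc <;> first | (exact absurd h (by decide)) | skip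
  all_goals
    simp [successors, harris, Harris.code, writePhase, permittedVars, Instr.Permits, Instr.dst,
      Harris.vKey, Harris.vPred, Harris.vPredNext, Harris.vCurr, Harris.vCurrNext, Harris.vTmp]

/-- Nothing needs to be permitted when a read-only phase starts. -/
theorem permittedVars_of_writePhase {pc : ℕ} (hpc : pc < 61) (h : writePhase pc = true) :
    ∀ pc' ∈ successors pc, writePhase pc' = false → permittedVars pc' = [] := by
  interval_cases pc <;> first | (exact absurd h (by decide)) | skip
  all_goals
    simp [successors, harris, Harris.code, writePhase, permittedVars]

/-- When a write phase starts, both ends of the search window are permitted. -/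
theorem permitted_of_writePhase {pc : ℕ} (hpc : pc < 61) (h : writePhase pc = false) :
    ∀ pc' ∈ successors pc, writePhase pc' = true →
      (harris.code pc).dst = none ∧ 1 ∈ permittedVars pc ∧ 3 ∈ permittedVars pc ∧
        (pc' = 19 ∨ pc' = 25 ∨ pc' = 35 ∨ pc' = 45 ∨ pc' = 56) := by
  interval_cases pc <;> first | (exact absurd h (by decide)) | skip
  all_goals
    simp [successors, harris, Harris.code, writePhase, permittedVars, Instr.dst]

/-- A pending insertion does not overwrite `vNew` after the allocation. -/
theorem inserting_of_follow {o o' : SetOp} {pc pc' : ℕ} {st st' : List ℕ} {ρ : Var → Val}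
    (h : (pH).follow o pc st ρ = (.body o' pc', st'))
    (hst : pc < 24 → st = [25] ∨ st = [35] ∨ st = [45] ∨ st = [56])
    (hst' : 24 ≤ pc → st = []) (hpc : pc < 61) (hi : Inserting st' pc') :
    pc = 33 ∨ (Inserting st pc ∧ (harris.code pc).dst ≠ some 7) := by
  have hp : (pH).prog = harris := rfl
  unfold Integrated.follow at h
  rw [hp] at h
  unfold Inserting at hi ⊢
  rcases lt_or_ge pc 24 with h24 | h24
  · replace hst := hst h24
    clear hst'
    interval_cases pc <;> simp [harris, Harris.code, Instr.dst, Harris.vPred, Harris.vPredNext,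
      Harris.vCurr, Harris.vCurrNext, Harris.vTmp, Harris.vFlag, Harris.vNew, Harris.vSucc,
      Harris.vMarked, Harris.vVictim] at h ⊢
    all_goals
      obtain ⟨⟨-, h1⟩, rfl⟩ := h
      rcases hst with rfl | rfl | rfl | rfl <;> simp at hi h1 ⊢ <;> (try split at h1) <;> omega
  · replace hst' := hst' h24
    subst hst'
    clear hst
    interval_cases pc <;> simp [harris, Harris.code, Instr.dst, Harris.vPred, Harris.vPredNext,
      Harris.vCurr, Harris.vCurrNext, Harris.vTmp, Harris.vFlag, Harris.vNew, Harris.vSucc,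
      Harris.vMarked, Harris.vVictim] at h ⊢
    all_goals
      obtain ⟨⟨-, h1⟩, rfl⟩ := h
      simp at hi
      (try split at h1) <;> omega

variable {t : Fin N}

theorem LastWrite.succ {P : Program} {p : Var} {i m : ℕ} (h : LastWrite N P s t p i m)
    (hw : ¬ (plain N P).Writes s t p m) : LastWrite N P s t p i (m + 1) := by
  obtain ⟨h1, h2, h3⟩ := h
  refine ⟨by omega, h2, fun k h4 h5 => ?_⟩
  rcases Nat.lt_succ_iff_lt_or_eq.1 h5 with h6 | rfl
  · exact h3 k h4 h6
  · exact hw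

theorem lastWrite_self {P : Program} {p : Var} {m : ℕ} (h : (plain N P).Writes s t p m) :
    LastWrite N P s t p m (m + 1) := ⟨by omega, h, fun k _ _ => by omega⟩

theorem exists_phaseStart (N : ℕ) (P : Program) (s : Schedule N) (φ : ℕ → Bool) (t : Fin N)
    (m : ℕ) : ∃ j, PhaseStart N P s φ t j m := by
  induction m with
  | zero => exact ⟨0, le_rfl, fun k _ h => by rw [Nat.le_zero.1 h], fun k h => by omega⟩
  | succ m ih =>
    by_cases hm : phase N P s φ t m = phase N P s φ t (m + 1)
    · obtain ⟨j, h1, h2, h3⟩ := ih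
      refine ⟨j, by omega, fun k h4 h5 => ?_, fun k h4 => by rw [← hm]; exact h3 k h4⟩
      rcases Nat.lt_succ_iff_lt_or_eq.1 (Nat.lt_succ_of_le h5) with h6 | rfl
      · rw [h2 k h4 (by omega), hm]
      · rfl
    · refine ⟨m + 1, le_rfl, fun k h4 h5 => by rw [le_antisymm h5 h4], fun k h4 => ?_⟩
      obtain rfl : k = m := by omega
      exact hm

theorem PhaseStart.of_succ {P : Program} {φ : ℕ → Bool} {j m : ℕ}
    (h : PhaseStart N P s φ t j (m + 1))
    (hm : phase N P s φ t m = phase N P s φ t (m + 1)) : PhaseStart N P s φ t j m := by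
  obtain ⟨h1, h2, h3⟩ := h
  have hj : j ≠ m + 1 := by rintro rfl; exact h3 m rfl hm
  exact ⟨by omega, fun k h4 h5 => by rw [h2 k h4 (by omega), hm], fun k h4 => by
    rw [hm]; exact h3 k h4⟩

theorem PhaseStart.eq_succ {P : Program} {φ : ℕ → Bool} {j m : ℕ}
    (h : PhaseStart N P s φ t j (m + 1))
    (hm : phase N P s φ t m ≠ phase N P s φ t (m + 1)) : j = m + 1 := by
  obtain ⟨h1, h2, h3⟩ := h
  by_contra hj
  exact hm (h2 m (by omega) (by omega))

/-- The variable `p` of `t` is `b`-permitted, and remains so until it is overwritten. -/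
def StablyPermitted (s : Schedule N) (t : Fin N) (b : ℕ) (p : Var) (m : ℕ) : Prop :=
  ∃ i, LastWrite N harris s t p i m ∧
    ∀ m', LastWrite N harris s t p i m' → Permitted N harris s t b p m'

theorem StablyPermitted.permitted {b m : ℕ} {p : Var} (h : StablyPermitted s t b p m) :
    Permitted N harris s t b p m := by
  obtain ⟨i, h1, h2⟩ := h
  exact h2 m h1

theorem StablyPermitted.succ {b m : ℕ} {p : Var} (h : StablyPermitted s t b p m)
    (hw : ¬ (pH).Writes s t p m) : StablyPermitted s t b p (m + 1) := by
  obtain ⟨i, h1, h2⟩ := h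
  exact ⟨i, h1.succ hw, h2⟩

theorem stablyPermitted_succ {b m : ℕ} {v : Var} {l : List Var} {ins : Instr}
    (hi : (pH).instr s m = some ins) (hw : (pH).Writes s t v m ↔ ins.dst = some v) (hb : b ≤ m)
    (hl : ∀ q ∈ l, StablyPermitted s t b q m) (h : ins.Permits l v) :
    StablyPermitted s t b v (m + 1) := by
  rcases h with ⟨h1, h2⟩ | ⟨g, rfl⟩ | ⟨q, f, rfl, h2⟩ | ⟨q, rfl, h2⟩ | ⟨q, k, rfl, h2⟩
  · exact (hl v h2).succ fun h => h1 (hw.1 h)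
  · exact ⟨m, lastWrite_self (hw.2 rfl), fun m' h3 => .global h3 hi (by omega)⟩
  · exact ⟨m, lastWrite_self (hw.2 rfl), fun m' h3 => .deref h3 hi hb (hl q h2).permitted⟩
  · exact ⟨m, lastWrite_self (hw.2 rfl), fun m' h3 => .move h3 hi (hl q h2).permitted⟩
  · exact ⟨m, lastWrite_self (hw.2 rfl), fun m' h3 => .setMark h3 hi (hl q h2).permitted⟩

/-- The variable `vNew` holds a node allocated by the pending insertion. -/
def HasNew (s : Schedule N) (t : Fin N) (m : ℕ) : Prop :=
  ∃ i init, LastWrite N harris s t 7 i m ∧ (pH).instr s i = some (.alloc 7 init)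

/-- What makes the accesses of a thread permitted. -/
def PhaseInv (s : Schedule N) (t : Fin N) (m : ℕ) : Prop :=
  ∀ o pc, ((pH).thread s t m).ctrl = .body o pc →
    (writePhase pc = false → ∀ b, PhaseStart N harris s writePhase t b m →
      ∀ v ∈ permittedVars pc, StablyPermitted s t b v m) ∧
    (writePhase pc = true → ∀ b, PhaseStart N harris s writePhase t b m →
      Reserved N harris s writePhase t 1 b ∧ Reserved N harris s writePhase t 3 b ∧
        (Inserting ((pH).thread s t m).stack pc → Reserved N harris s writePhase t 7 b)) ∧
    (Inserting ((pH).thread s t m).stack pc → HasNew s t m)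

theorem phase_body {m pc : ℕ} {o : SetOp} (h : ((pH).thread s t m).ctrl = .body o pc) :
    phase N harris s writePhase t m = some (writePhase pc) := by
  unfold phase; rw [h]

theorem isLocal_of_priv {m n : ℕ} {own : Fin N → Option ℕ} {k : Key} {ρ : Var → Val}
    (I : Inv ((pH).conf s m) (everReached N s m) own)
    (h : Priv ((pH).conf s m).mem ((pH).conf s m).brk (everReached N s m) (own t) k ρ n) :
    IsLocal N harris s n m := by
  refine ⟨(I.own_ok t n h.2.1).2.1, fun j hj hr => h.2.2.1 ?_⟩
  obtain ⟨own', I'⟩ := exists_inv s j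
  exact everReached_mono hj (reach_subset_everReached s j (reach_of_reachable I'.shape rfl hr))

/-- The stack of a thread is determined by its instruction, up to the return address of a
search. -/
theorem Assertion.stack {X : Type} {fr : Bool} {M : ℕ → Cell X} {b : ℕ} {E : Set ℕ} {own : Option ℕ}
    {k : Key} {st : List ℕ} {ρ : Var → Val} {pc : ℕ} (h : Assertion fr M b E own k st ρ pc) :
    (pc < 24 → Saved M b E own k st ρ) ∧ (24 ≤ pc → st = []) := by
  have hlt := h.lt
  constructor <;> intro h24 <;> interval_cases pc <;> first | exact h | exact h.1

/-- The new node of an insertion is permitted as long as it is local. -/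
theorem permitted_vNew {m pc : ℕ} {o : SetOp} {b : ℕ}
    (hc : ((pH).thread s t m).ctrl = .body o pc)
    (h : Inserting ((pH).thread s t m).stack pc) (hpc : pc < 24 ∨ pc = 34 ∨ pc = 35)
    (hn : HasNew s t m) : Permitted N harris s t b 7 m := by
  obtain ⟨own, I⟩ := exists_inv s m
  obtain ⟨i, init, h1, h2⟩ := hn
  have h3 := (I.thr t).2
  unfold Integrated.thread at hc h
  rw [hc] at h3
  obtain ⟨j, -, h3⟩ := h3
  have : ∃ n, Priv ((pH).conf s m).mem ((pH).conf s m).brk (everReached N s m) (own t) (j : WithTop ℤ)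
      (((pH).conf s m).thr t).vars n := by
    rcases hpc with hpc | rfl | rfl
    · have hs := h3.stack.1 hpc
      have hst : (((pH).conf s m).thr t).stack = [35] := by
        rcases h with h | h
        · exact h.2
        · omega
      rw [hst] at hs
      rcases hs with h5 | ⟨-, h5⟩ | h5 | ⟨h5, -⟩
      · simp at h5
      · exact h5
      · simp at h5
      · simp at h5
    · exact h3.2.2
    · exact h3.2.1
  obtain ⟨n, h4⟩ := this
  exact .alloc h1 h2 h4.1 (isLocal_of_priv I h4)

theorem phaseInv (s : Schedule N) (t : Fin N) (m : ℕ) : PhaseInv s t m := by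
  induction m with
  | zero => intro o pc h; cases h
  | succ m ih =>
    by_cases ht : (s m).1 = t
    swap
    · -- a step of another thread
      have hth : (pH).thread s t (m + 1) = (pH).thread s t m :=
        step_thr_of_ne _ (Ne.symm ht) _ _
      have hph : phase N harris s writePhase t m = phase N harris s writePhase t (m + 1) := by
        unfold phase; rw [hth]
      have hw : ∀ v, ¬ (pH).Writes s t v m := fun v h => ht h.1
      intro o pc h
      rw [hth] at h ⊢
      obtain ⟨h1, h2, h3⟩ := ih o pc h
      refine ⟨fun h4 b h5 v h6 => (h1 h4 b (h5.of_succ hph) v h6).succ (hw v),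
        fun h4 b h5 => h2 h4 b (h5.of_succ hph), fun h4 => ?_⟩
      obtain ⟨i, init, h5, h6⟩ := h3 h4
      exact ⟨i, init, h5.succ (hw 7), h6⟩
    obtain ⟨own, I⟩ := exists_inv s m
    have hok := I.thr t
    obtain ⟨hf, hok⟩ := hok
    have hconf : (pH).conf s (m + 1) = ((pH).step t (s m).2 ((pH).conf s m)).1 := by
      rw [← ht]; rfl
    have hev : (pH).event s m = ((pH).step t (s m).2 ((pH).conf s m)).2 := by
      rw [← ht]; rfl
    intro o' pc' hc'
    rcases hth : ((pH).conf s m).thr t with ⟨ctrl, st, ρ, frame, regs⟩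
    rw [hth] at hf hok
    simp only at hf
    subst hf
    have hfresh : ∀ pc', pc' = 24 ∨ pc' = 33 ∨ pc' = 44 → ∀ st' : List ℕ,
        writePhase pc' = false ∧ permittedVars pc' = [] ∧ ¬ Inserting st' pc' := by
      rintro pc' (rfl | rfl | rfl) st' <;> refine ⟨rfl, rfl, ?_⟩ <;> simp [Inserting]
    have hctrl : ∀ th, ((pH).conf s (m + 1)) = ((pH).conf s m).setThr t th →
        (pH).thread s t (m + 1) = th := by
      intro th h
      unfold Integrated.thread
      rw [h]
      exact Function.update_self _ _ _
    cases ctrl with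
    | idle =>
      rw [plain_step_idle hth] at hconf
      rw [hctrl _ hconf] at hc'
      cases hc'
    | epi o ks v =>
      have h2 : ks = [] := hok
      subst h2
      rw [plain_step_epi hth] at hconf
      rw [hctrl _ hconf] at hc'
      cases hc'
    | pro o ks =>
      obtain ⟨rfl, -⟩ := hok
      rw [plain_step_pro hth] at hconf
      rw [hctrl _ hconf] at hc'
      cases hc'
      obtain ⟨h1, h2, h3⟩ := hfresh (harris.start o') (by cases o' <;> simp [harris])
        ((pH).thread s t (m + 1)).stack
      rw [h1, h2]
      exact ⟨fun _ b _ v hv => absurd hv (List.not_mem_nil), fun h => by simp at h,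
        fun h => absurd h h3⟩
    | body o pc =>
      obtain ⟨i, -, hA⟩ := hok
      have hlt := hA.lt
      obtain ⟨hfol, hdst⟩ := plain_follow (req := (s m).2) hth
      rw [← hconf] at hfol
      rw [← hev] at hdst
      have hcm : ((pH).thread s t m).ctrl = .body o pc := by unfold Integrated.thread; rw [hth]
      have hsm : ((pH).thread s t m).stack = st := by unfold Integrated.thread; rw [hth]
      have hins : (pH).instr s m = some (harris.code pc) := by
        unfold Integrated.instr Integrated.thread Integrated.curInstr
        rw [ht, hth]
        rfl
      have hw : ∀ v, (pH).Writes s t v m ↔ (harris.code pc).dst = some v := by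
        intro v
        unfold Integrated.Writes
        rcases hdst with h | ⟨a, u, h⟩ <;> rw [h] <;> simp [ht]
      obtain ⟨h1, h2, h3⟩ := ih o pc hcm
      have hst : pc < 24 → st = [25] ∨ st = [35] ∨ st = [45] ∨ st = [56] := fun h24 => by
        rcases hA.stack.1 h24 with h | h | h | h
        · exact .inl h
        · exact .inr (.inl h.1)
        · exact .inr (.inr (.inl h))
        · exact .inr (.inr (.inr h.1))
      have hfol' : (pH).follow o pc st ρ = (.body o' pc', ((pH).thread s t (m + 1)).stack) := by
        rw [← hfol, ← hc']; rfl
      have hsucc := follow_successors hfol' hst hlt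
      have hnew : Inserting ((pH).thread s t (m + 1)).stack pc' → HasNew s t (m + 1) := by
        intro h4
        rcases inserting_of_follow hfol' hst hA.stack.2 hlt h4 with rfl | ⟨h5, h6⟩
        · exact ⟨m, _, lastWrite_self ((hw 7).2 rfl), hins⟩
        · rw [hsm] at h3
          obtain ⟨i, init, h7, h8⟩ := h3 h5
          exact ⟨i, init, h7.succ fun h => h6 ((hw 7).1 h), h8⟩
      refine ⟨fun h4 b h5 v hv => ?_, fun h4 b h5 => ?_, hnew⟩
      · -- a read-only phase
        cases h6 : writePhase pc with
        | false =>
          have hph : phase N harris s writePhase t m = phase N harris s writePhase t (m + 1) := by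
            rw [phase_body hcm, phase_body hc', h4, h6]
          have h7 := h5.of_succ hph
          exact stablyPermitted_succ hins (hw v) h7.1 (h1 h6 b h7)
            (permits_of_successor hlt h6 pc' hsucc h4 v hv)
        | true =>
          rw [permittedVars_of_writePhase hlt h6 pc' hsucc h4] at hv
          exact absurd hv List.not_mem_nil
      · -- a write phase
        cases h6 : writePhase pc with
        | false =>
          have hph : phase N harris s writePhase t m ≠ phase N harris s writePhase t (m + 1) := by
            rw [phase_body hcm, phase_body hc', h4, h6]; simp
          obtain rfl := h5.eq_succ hph
          obtain ⟨j, hj⟩ := exists_phaseStart N harris s writePhase t m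
          obtain ⟨h7, h8, h9, h10⟩ := permitted_of_writePhase hlt h6 pc' hsucc h4
          have hno : ∀ v, ¬ (pH).Writes s t v m := fun v h => by
            rw [hw, h7] at h; cases h
          have hres : ∀ p, Permitted N harris s t j p (m + 1) →
              Reserved N harris s writePhase t p (m + 1) :=
            fun p hp => ⟨m, j, rfl, by rw [phase_body hcm, h6], hj, hp⟩
          refine ⟨hres 1 ((h1 h6 j hj 1 h8).succ (hno 1)).permitted,
            hres 3 ((h1 h6 j hj 3 h9).succ (hno 3)).permitted, fun h => hres 7 ?_⟩
          refine permitted_vNew hc' h ?_ (hnew h)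
          rcases h with h | h <;> omega
        | true =>
          have hph : phase N harris s writePhase t m = phase N harris s writePhase t (m + 1) := by
            rw [phase_body hcm, phase_body hc', h4, h6]
          obtain ⟨h7, h8, h9⟩ := h2 h6 b (h5.of_succ hph)
          refine ⟨h7, h8, fun h10 => h9 ?_⟩
          rcases inserting_of_follow hfol' hst hA.stack.2 hlt h10 with rfl | ⟨h5, h6⟩
          · cases h6
          · rwa [hsm]

variable (N) in
/-- Harris's list is access-aware. -/
theorem harris_accessAware : AccessAware N harris := by
  refine ⟨writePhase, fun s m ins hins j hj => ?_⟩
  obtain ⟨t, ht⟩ : ∃ t, t = (s m).1 := ⟨_, rfl⟩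
  rw [← ht] at hj ⊢
  obtain ⟨own, I⟩ := exists_inv s m
  obtain ⟨hf, hok⟩ := I.thr t
  rcases hth : ((pH).conf s m).thr t with ⟨ctrl, st, ρ, frame, regs⟩
  rw [hth] at hf hok
  simp only at hf
  subst hf
  have hins' : (pH).instr s m = (pH).curInstr ((pH).conf s m) t := by
    unfold Integrated.instr Integrated.thread
    rw [← ht, hth]
  rw [hins', Integrated.curInstr, hth] at hins
  cases ctrl with
  | idle => cases hins
  | pro _ _ => cases hins
  | epi _ _ _ => cases hins
  | body o pc =>
    cases hins
    obtain ⟨i, -, hA⟩ := hok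
    have hlt := hA.lt
    have hcm : ((pH).thread s t m).ctrl = .body o pc := by unfold Integrated.thread; rw [hth]
    obtain ⟨hfol, hdst⟩ := plain_follow (req := (s m).2) hth
    have hconf : (pH).conf s (m + 1) = ((pH).step t (s m).2 ((pH).conf s m)).1 := by
      rw [ht]; rfl
    rw [← hconf] at hfol
    have hw : ∀ v, (pH).Writes s t v m ↔ (harris.code pc).dst = some v := by
      intro v
      unfold Integrated.Writes Integrated.event
      rw [← ht]
      rcases hdst with h | ⟨a, u, h⟩ <;> rw [h] <;> simp
    have hins : (pH).instr s m = some (harris.code pc) := by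
      rw [hins', Integrated.curInstr, hth]; rfl
    have hsm : ((pH).thread s t m).stack = st := by unfold Integrated.thread; rw [hth]
    obtain ⟨h1, h2, -⟩ := phaseInv s t m o pc hcm
    have hread : ∀ p q f, harris.code pc = .read p q f → q ∈ permittedVars pc →
        writePhase pc = false → Permitted N harris s t j p (m + 1) := by
      intro p q f hc hq hph
      exact .deref (lastWrite_self ((hw p).2 (by rw [hc]; rfl))) (hins.trans (by rw [hc])) hj.1
        (h1 hph j hj q hq).permitted
    have hglobal : ∀ p g, harris.code pc = .global p g →
        Permitted N harris s t j p (m + 1) := by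
      intro p g hc
      exact .global (lastWrite_self ((hw p).2 (by rw [hc]; rfl))) (hins.trans (by rw [hc]))
        (hj.1.trans (Nat.le_succ m))
    rw [phase_body hcm]
    simp only [Option.some.injEq]
    constructor
    · intro hph
      have hlt' : pc < 19 ∨ pc = 24 ∨ pc = 33 ∨ pc = 34 ∨ pc = 44 ∨ pc = 55 := by
        simp [writePhase] at hph; omega
      rcases hlt' with h | rfl | rfl | rfl | rfl | rfl
      · interval_cases pc <;> first
          | trivial
          | (intro _; exact hglobal _ _ rfl)
          | (intro _; exact hread _ _ _ rfl (by decide) rfl)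
      · trivial
      · intro _
        have hc' : ((pH).thread s t (m + 1)).ctrl = .body o 34 := congrArg Prod.fst hfol
        exact permitted_vNew hc' (.inr ⟨le_rfl, by norm_num⟩) (.inr (.inl rfl))
          ((phaseInv s t (m + 1) o 34 hc').2.2 (.inr ⟨le_rfl, by norm_num⟩))
      · trivial
      · trivial
      · trivial
    · intro hph
      obtain ⟨h3, h4, h5⟩ := h2 hph j hj
      have hge : 19 ≤ pc := by simp [writePhase] at hph; omega
      interval_cases pc <;> first
        | trivial
        | exact h3
        | exact h4
        | exact fun _ => h4
        | exact h5 (.inr ⟨by norm_num, by norm_num⟩)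

end AccessAwareness

/-! ### Effects of steps on the life-cycle of nodes -/

section LifeCycle

variable {N : ℕ} {A : Scheme.Obj N}

/-- The references to active nodes. -/
def Config.activeRefs (c : Config A) : Set Ref :=
  {r | (c.mem r.addr).id = r.id ∧ (c.mem r.addr).status = .active}

/-- Nodes occupy addresses below `brk`, and have identities below `nextId`. -/
structure Config.Sane (c : Config A) : Prop where
  beyond : ∀ a, c.brk ≤ a → (c.mem a).status = .system
  id_lt : ∀ a, (c.mem a).id < c.nextId

/-- The life-cycle of nodes is the same in both configurations, except that `c'` may lack some of
the retired nodes of `c`. -/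
structure Shrinks (c c' : Config A) : Prop where
  nextId : c'.nextId = c.nextId
  brk : c'.brk = c.brk
  id : ∀ a, (c'.mem a).id = (c.mem a).id
  status : ∀ a, (c'.mem a).status = (c.mem a).status ∨
    (c.mem a).status = .retired ∧ (c'.mem a).status ≠ .active ∧ (c'.mem a).status ≠ .retired

theorem Shrinks.rfl' (c : Config A) : Shrinks c c := ⟨rfl, rfl, fun _ => rfl, fun _ => .inl rfl⟩

theorem shrinks_writeField (c : Config A) (r : Ref) (f : ℕ) (v : Val) :
    Shrinks c (c.writeField r f v) := by
  refine ⟨rfl, rfl, fun a => ?_, fun a => .inl ?_⟩ <;>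
    by_cases h : a = r.addr <;> simp [Config.writeField, h]

theorem shrinks_writeExt (c : Config A) (r : Ref) (x : A.X) : Shrinks c (c.writeExt r x) := by
  refine ⟨rfl, rfl, fun a => ?_, fun a => .inl ?_⟩ <;>
    by_cases h : a = r.addr <;> simp [Config.writeExt, h]

theorem shrinks_casField (c : Config A) (r : Ref) (f : ℕ) (e n : Val) :
    Shrinks c (c.casField r f e n).1 := by
  unfold Config.casField
  split
  · exact shrinks_writeField _ _ _ _
  · exact Shrinks.rfl' c

theorem shrinks_reclaimAt (c : Config A) (b : ℕ) (x : Bool) : Shrinks c (c.reclaimAt b x) := by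
  unfold Config.reclaimAt
  split
  · rename_i hb
    refine ⟨rfl, rfl, fun a => ?_, fun a => ?_⟩
    · by_cases h : a = b <;> simp [h]
    · by_cases h : a = b
      · subst h
        refine .inr ⟨hb, ?_⟩
        cases x <;> simp
      · simp [h]
  · exact Shrinks.rfl' c

theorem Shrinks.setThr {c d : Config A} (h : Shrinks c d) (t : Fin N) (th : Thread A) :
    Shrinks c (d.setThr t th) := ⟨h.nextId, h.brk, h.id, h.status⟩

/-- The effect of an event on the life-cycle of nodes. -/
def Effect (c c' : Config A) : Event A → Prop
  | .direct (.alloc init) v _ =>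
    v = .ptr (some ⟨c.brk, c.nextId⟩) 0 ∧ Shrinks (c.allocAt c.brk init) c'
  | .direct a _ _ => Shrinks (c.retireCall a) c'
  | .apiInv a => Shrinks (c.retireCall a) c'
  | .allocated b init _ => c.Unallocated b ∧ Shrinks (c.allocAt b init) c'
  | _ => Shrinks c c'

theorem effect_issue (I : Integrated N) (t : Fin N) (c : Config I.obj) (a : Call) :
    Effect c (I.issue t c a).1 (I.issue t c a).2 := by
  unfold Integrated.issue
  split
  · exact (Shrinks.rfl' _).setThr _ _
  · cases a with
    | read p f =>
      simp only [performDirect]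
      split <;> exact (Shrinks.rfl' c).setThr _ _
    | write p f v =>
      simp only [performDirect]
      split
      · exact (shrinks_writeField _ _ _ _).setThr _ _
      · exact (Shrinks.rfl' c).setThr _ _
    | cas p f e d =>
      simp only [performDirect]
      split
      · exact (shrinks_casField _ _ _ _ _).setThr _ _
      · exact (Shrinks.rfl' c).setThr _ _
    | alloc init => exact ⟨rfl, (Shrinks.rfl' _).setThr _ _⟩
    | retire p => exact (Shrinks.rfl' _).setThr _ _
    | aux k args => exact (Shrinks.rfl' _).setThr _ _

theorem effect_apiStep (I : Integrated N) (t : Fin N) (c : Config I.obj)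
    (fr : Frame I.obj.Label) : Effect c (I.apiStep t c fr).1 (I.apiStep t c fr).2 := by
  unfold Integrated.apiStep
  dsimp only
  split
  · exact (Shrinks.rfl' c).setThr _ _
  · exact ⟨rfl, rfl, fun _ => rfl, fun _ => .inl rfl⟩
  · exact (shrinks_writeExt _ _ _).setThr _ _
  · exact (Shrinks.rfl' c).setThr _ _
  · exact (shrinks_writeField _ _ _ _).setThr _ _
  · exact (shrinks_casField _ _ _ _ _).setThr _ _
  · exact (shrinks_reclaimAt _ _ _).setThr _ _
  · split
    · split
      · rename_i h
        exact ⟨h, (Shrinks.rfl' _).setThr _ _⟩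
      · exact (Shrinks.rfl' c).setThr _ _
    · exact (Shrinks.rfl' c).setThr _ _
  · split
    · exact (Shrinks.rfl' c).setThr _ _
    · exact Shrinks.rfl' c
  · split <;> exact (Shrinks.rfl' c).setThr _ _

theorem effect_step (I : Integrated N) (t : Fin N) (req : SetOp × ℤ) (c : Config I.obj) :
    Effect c (I.step t req c).1 (I.step t req c).2 := by
  unfold Integrated.step
  dsimp only
  split
  · exact effect_apiStep _ _ _ _
  · split
    · exact (Shrinks.rfl' c).setThr _ _
    · exact effect_issue _ _ _ _
    · exact (Shrinks.rfl' c).setThr _ _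
    · unfold Integrated.bodyStep
      dsimp only
      split <;> first | exact effect_issue _ _ _ _ | exact (Shrinks.rfl' c).setThr _ _
    · exact effect_issue _ _ _ _
    · exact (Shrinks.rfl' c).setThr _ _

variable {c c' : Config A}

theorem Shrinks.sane (h : Shrinks c c') (hc : c.Sane) : c'.Sane := by
  refine ⟨fun a ha => ?_, fun a => by rw [h.id, h.nextId]; exact hc.id_lt a⟩
  have h1 := hc.beyond a (h.brk ▸ ha)
  rcases h.status a with h2 | ⟨h2, -⟩
  · rw [h2, h1]
  · rw [h1] at h2; cases h2

theorem Shrinks.activeRefs (h : Shrinks c c') : c'.activeRefs = c.activeRefs := by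
  ext r
  simp only [Config.activeRefs, Set.mem_ofPred_eq, h.id]
  refine and_congr_right fun _ => ?_
  rcases h.status r.addr with h2 | ⟨h2, h3, -⟩
  · rw [h2]
  · simp [h2, h3]

theorem Shrinks.valid (h : Shrinks c c') {r : Ref} (hr : c'.Valid r) : c.Valid r := by
  obtain ⟨h1, h2⟩ := hr
  refine ⟨by rw [← h.id, h1], ?_⟩
  rcases h.status r.addr with h3 | ⟨-, h3, h4⟩
  · rwa [h3] at h2
  · exact absurd h2 (by simp [h3, h4])

theorem retireRef_of_not_active {r : Ref} (h : r ∉ c.activeRefs) : c.retireRef r = c := by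
  unfold Config.retireRef
  exact if_neg h

theorem retireRef_mem_of_active {r : Ref} (h : r ∈ c.activeRefs) : c.retireRef r =
    { c with mem := Function.update c.mem r.addr { c.mem r.addr with status := .retired } } := by
  unfold Config.retireRef
  exact if_pos h

theorem sane_retireRef (hc : c.Sane) (r : Ref) : (c.retireRef r).Sane := by
  by_cases h : r ∈ c.activeRefs
  · rw [retireRef_mem_of_active h]
    refine ⟨fun a ha => ?_, fun a => ?_⟩
    · have h1 := hc.beyond a ha
      by_cases hb : a = r.addr
      · subst hb; rw [h.2] at h1; cases h1
      · simpa [Function.update_apply, hb] using h1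
    · have h1 := hc.id_lt a
      by_cases hb : a = r.addr
      · subst hb; simpa using h1
      · simpa [Function.update_apply, hb] using h1
  · rwa [retireRef_of_not_active h]

theorem activeRefs_retireRef (c : Config A) (r : Ref) :
    (c.retireRef r).activeRefs = c.activeRefs \ {r} := by
  by_cases h : r ∈ c.activeRefs
  · rw [retireRef_mem_of_active h]
    ext q
    simp only [Config.activeRefs, Set.mem_ofPred_eq, Set.mem_sdiff, Set.mem_singleton_iff]
    by_cases hb : q.addr = r.addr
    · simp only [hb, Function.update_self]
      constructor
      · rintro ⟨-, h2⟩; cases h2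
      · rintro ⟨⟨h1, -⟩, h2⟩
        refine absurd ?_ h2
        obtain ⟨a, i⟩ := q
        obtain ⟨b, j⟩ := r
        obtain rfl : a = b := hb
        exact congrArg (Ref.mk a) (h1.symm.trans h.1)
    · simp only [Function.update_of_ne hb]
      refine ⟨fun h1 => ⟨h1, ?_⟩, fun h1 => h1.1⟩
      rintro rfl; exact hb rfl
  · rw [retireRef_of_not_active h, Set.sdiff_singleton_eq_self h]

theorem valid_retireRef {r q : Ref} : (c.retireRef r).Valid q ↔ c.Valid q := by
  by_cases h : r ∈ c.activeRefs
  · rw [retireRef_mem_of_active h]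
    by_cases hb : q.addr = r.addr
    · have := h.2
      simp [Config.Valid, hb, this]
    · simp [Config.Valid, Function.update_of_ne hb]
  · rw [retireRef_of_not_active h]

theorem nextId_retireRef (c : Config A) (r : Ref) : (c.retireRef r).nextId = c.nextId := by
  unfold Config.retireRef; split <;> rfl

theorem sane_allocAt (hc : c.Sane) (b : ℕ) (init : ℕ → Val) : (c.allocAt b init).Sane := by
  refine ⟨fun a ha => ?_, fun a => ?_⟩
  · simp only [Config.allocAt] at ha ⊢
    have hb : a ≠ b := by omega
    rw [Function.update_of_ne hb]
    exact hc.beyond a (by omega)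
  · simp only [Config.allocAt]
    have := hc.id_lt a
    by_cases hb : a = b
    · subst hb; simp
    · rw [Function.update_of_ne hb]; omega

theorem activeRefs_allocAt {b : ℕ} (hb : c.Unallocated b) (init : ℕ → Val) :
    (c.allocAt b init).activeRefs = insert ⟨b, c.nextId⟩ c.activeRefs := by
  ext q
  simp only [Config.activeRefs, Config.allocAt, Set.mem_ofPred_eq, Set.mem_insert_iff]
  by_cases h : q.addr = b
  · simp only [h, Function.update_self]
    constructor
    · rintro ⟨h1, -⟩
      left
      cases q
      simp only at h h1
      rw [h, h1]
    · rintro (rfl | ⟨-, h2⟩)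
      · simp
      · rcases hb with hb | hb <;> rw [hb] at h2 <;> cases h2
  · rw [Function.update_of_ne h]
    refine ⟨fun h1 => .inr h1, ?_⟩
    rintro (rfl | h1)
    · exact absurd rfl h
    · exact h1

theorem valid_allocAt {b : ℕ} {init : ℕ → Val} {r : Ref} (h : (c.allocAt b init).Valid r)
    (hr : r.id ≠ c.nextId) : c.Valid r ∧ r.addr ≠ b := by
  have hb : r.addr ≠ b := by
    intro hb
    refine hr ?_
    rw [← h.1]
    simp [Config.allocAt, hb]
  refine ⟨?_, hb⟩
  simpa only [Config.Valid, Config.allocAt, Function.update_of_ne hb] using h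

theorem Config.Sane.unallocated_brk (hc : c.Sane) : c.Unallocated c.brk :=
  .inl (hc.beyond _ le_rfl)

theorem count_active_le {F : Finset Ref} (h : ∀ r ∈ c.activeRefs, r ∈ F) :
    c.count .active ≤ F.card := by
  refine Finset.card_le_card_of_injOn (fun a => ⟨a, (c.mem a).id⟩) (fun a ha => ?_) ?_
  · exact h _ ⟨rfl, (Finset.mem_filter.1 ha).2⟩
  · intro a _ b _ hab
    exact congrArg Ref.addr hab

end LifeCycle

/-! ### The memory words as linearizable objects -/

section Words

variable {N : ℕ}

/-- The contents of the memory after the invocation of a call. -/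
def callMem (W : ℕ → ℕ → Val) (a : Call) : ℕ → ℕ → Val :=
  match a.target, a.wordOp with
  | some (r, f), some w =>
    Function.update W r.addr (Function.update (W r.addr) f (wordSpec (W r.addr f) w).1)
  | _, _ => W

/-- The contents of the memory after an event, when calls take effect upon their invocation. -/
def eventMem {A : Scheme.Obj N} (W : ℕ → ℕ → Val) : Event A → ℕ → ℕ → Val
  | .apiInv a => callMem W a
  | .direct (.alloc init) (.ptr (some r) _) _ => Function.update W r.addr init
  | .direct a _ _ => callMem W a
  | .allocated b init _ => Function.update W b init
  | _ => W

variable (I : Integrated N) (s : Schedule N)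

/-- The contents of the memory in the `i`-th configuration, when calls take effect upon their
invocation. -/
noncomputable def Integrated.wordMem : ℕ → ℕ → ℕ → Val
  | 0 => fun a f => (I.conf s 0).readField ⟨a, a⟩ f
  | i + 1 => eventMem (Integrated.wordMem i) (I.event s i)

/-- All operations on memory words that have been invoked before step `m` have responded, and they
have not overlapped. -/
def Integrated.Settled (m : ℕ) : Prop :=
  ∀ k a, k < m → I.event s k = .apiInv a → a.target ≠ none →
    ∃ j v, j < m ∧ I.ApiRes s k j v ∧ ∀ l, k < l → l ≤ j → ∀ x f o, ¬ I.WordInv s x f l o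

variable {I s}

/-- An invocation takes effect at once on the word that it concerns. -/
theorem wordMem_succ_of_wordInv {a f i : ℕ} {o : WordOp} (h : I.WordInv s a f i o) :
    I.wordMem s (i + 1) a f = (wordSpec (I.wordMem s i a f) o).1 := by
  have hcall : ∀ c r, c.target = some (r, f) → r.addr = a → c.wordOp = some o →
      callMem (I.wordMem s i) c a f = (wordSpec (I.wordMem s i a f) o).1 := by
    intro c r h1 h2 h3
    subst h2
    simp [callMem, h1, h3]
  rcases h with ⟨c, r, h1, h2, h3, h4⟩ | ⟨init, h1, rfl⟩
  · rw [Integrated.wordMem]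
    rcases h1 with h1 | ⟨v, d, h1⟩
    · rw [h1]; exact hcall c r h2 h3 h4
    · rw [h1]
      cases c <;> first | (cases h4; done) | exact hcall _ r h2 h3 h4
  · rw [Integrated.wordMem]
    rcases h1 with ⟨d, h1⟩ | ⟨r, m, d, h1, h2⟩
    · rw [h1]; simp [eventMem, wordSpec]
    · rw [h1]; simp [eventMem, wordSpec, h2]

theorem wordMem_succ_of_not_wordInv {a f i : ℕ} (h : ∀ o, ¬ I.WordInv s a f i o) :
    I.wordMem s (i + 1) a f = I.wordMem s i a f := by
  have hcall : ∀ c, I.Issued s i c → callMem (I.wordMem s i) c a f = I.wordMem s i a f := by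
    intro c hc
    rcases h1 : c.target with _ | ⟨r, g⟩ <;> rcases h2 : c.wordOp with _ | w <;>
      simp only [callMem, h1, h2]
    by_cases ha : a = r.addr
    · by_cases hf : f = g
      · subst ha hf
        exact absurd (.inl ⟨c, r, hc, h1, rfl, h2⟩) (h w)
      · subst ha
        rw [Function.update_self, Function.update_of_ne hf]
    · rw [Function.update_of_ne ha]
  have hnew : ∀ b init, I.NewNode s i b init →
      Function.update (I.wordMem s i) b init a f = I.wordMem s i a f := by
    intro b init hb
    have ha : a ≠ b := by
      rintro rfl
      exact h _ (.inr ⟨init, hb, rfl⟩)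
    rw [Function.update_of_ne ha]
  rw [Integrated.wordMem]
  cases hc : I.event s i with
  | apiInv c => exact hcall _ (.inl hc)
  | allocated b init d => exact hnew b init (.inl ⟨d, hc⟩)
  | direct c v d =>
    have := hcall c (.inr ⟨v, d, hc⟩)
    cases c with
    | alloc init =>
      rcases v with _ | _ | ⟨_ | r, m⟩
      · exact this
      · exact this
      · exact this
      · exact hnew _ _ (.inr ⟨r, m, d, hc, rfl⟩)
    | _ => exact this
  | _ => rfl

theorem wordMem_eq_of_not_wordInv {a f i j : ℕ} (hij : i ≤ j)
    (h : ∀ k, i ≤ k → k < j → ∀ o, ¬ I.WordInv s a f k o) :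
    I.wordMem s j a f = I.wordMem s i a f := by
  induction j, hij using Nat.le_induction with
  | base => rfl
  | succ j hj ih =>
    rw [wordMem_succ_of_not_wordInv (h j hj (Nat.lt_succ_self j)),
      ih fun k h1 h2 => h k h1 (h2.trans (Nat.lt_succ_self j))]

theorem wordInv_unique {a f i : ℕ} {o o' : WordOp} (h : I.WordInv s a f i o)
    (h' : I.WordInv s a f i o') : o = o' := by
  rcases h with ⟨c, r, h1, h2, h3, h4⟩ | ⟨init, h1, rfl⟩ <;>
    rcases h' with ⟨c', r', h1', h2', h3', h4'⟩ | ⟨init', h1', rfl⟩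
  · have : c = c' := by
      rcases h1 with h1 | ⟨v, d, h1⟩ <;> rcases h1' with h1' | ⟨v', d', h1'⟩ <;>
        rw [h1] at h1' <;> cases h1' <;> rfl
    subst this
    rw [h4] at h4'
    exact Option.some.inj h4'
  · rcases h1 with h1 | ⟨v, d, h1⟩ <;> rcases h1' with ⟨d', h1'⟩ | ⟨r', m, d', h1', -⟩ <;>
      rw [h1] at h1' <;> cases h1'
    cases h2
  · rcases h1' with h1' | ⟨v, d, h1'⟩ <;> rcases h1 with ⟨d', h1⟩ | ⟨r', m, d', h1, -⟩ <;>
      rw [h1'] at h1 <;> cases h1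
    cases h2'
  · rcases h1 with ⟨d, h1⟩ | ⟨r, m, d, h1, -⟩ <;> rcases h1' with ⟨d', h1'⟩ | ⟨r', m', d', h1', -⟩ <;>
      rw [h1] at h1' <;> cases h1' <;> rfl

/-- In a legal sequential order by the time of invocation, each operation finds the word as left by
the operations invoked before. -/
theorem legal_response {a f m : ℕ} (L : List (ℕ × WordOp × Val)) (lo : ℕ)
    (hlo : ∀ x ∈ L, lo ≤ x.1) (hsort : L.Pairwise fun x y => x.1 < y.1)
    (hinv : ∀ x ∈ L, x.1 < m ∧ I.WordInv s a f x.1 x.2.1)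
    (hall : ∀ k o, lo ≤ k → k < m → I.WordInv s a f k o → ∃ r, (k, o, r) ∈ L)
    (hL : Legal wordSpec (I.wordMem s lo a f) (L.map Prod.snd)) :
    ∀ x ∈ L, x.2.2 = (wordSpec (I.wordMem s x.1 a f) x.2.1).2 := by
  induction L generalizing lo with
  | nil => intro x hx; cases hx
  | cons y L ih =>
    obtain ⟨k, o, r⟩ := y
    obtain ⟨h1, h2⟩ := List.pairwise_cons.1 hsort
    have hk := hlo _ List.mem_cons_self
    obtain ⟨hkm, hko⟩ := hinv _ List.mem_cons_self
    simp only at hk hkm hko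
    have hW : I.wordMem s k a f = I.wordMem s lo a f := by
      refine wordMem_eq_of_not_wordInv hk fun l h3 h4 o' h5 => ?_
      obtain ⟨r', h6⟩ := hall l o' h3 (h4.trans hkm) h5
      rcases List.mem_cons.1 h6 with h6 | h6
      · cases h6; omega
      · have := h1 _ h6; simp only at this; omega
    simp only [List.map_cons, Legal] at hL
    rw [← hW] at hL
    intro x hx
    rcases List.mem_cons.1 hx with rfl | hx
    · exact hL.1.symm
    · refine ih (k + 1) (fun y hy => h1 y hy) h2 (fun y hy => hinv y (List.mem_cons_of_mem _ hy))
        (fun l o' h3 h4 h5 => ?_) ?_ x hx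
      · obtain ⟨r', h6⟩ := hall l o' (by omega) h4 h5
        rcases List.mem_cons.1 h6 with h6 | h6
        · cases h6; omega
        · exact ⟨r', h6⟩
      · rw [wordMem_succ_of_wordInv hko]
        exact hL.2

/-- If operations on memory words do not overlap, then linearizability determines what they
return. -/
theorem word_response (hlin : I.LinearizableWords) {m : ℕ} (hset : I.Settled s m) {a f k j : ℕ}
    {o : WordOp} {v : Val} (hk : I.WordInv s a f k o) (hr : I.WordRes s a f k j v)
    (hj : j < m) : v = (wordSpec (I.wordMem s k a f) o).2 := by
  have hcomplete : ∀ k o, k < m → I.WordInv s a f k o → ∃ j v, j < m ∧ I.WordRes s a f k j v ∧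
      ∀ l o', k < l → I.WordInv s a f l o' → j < l := by
    rintro k o hk (⟨c, r, h1, h2, h3, h4⟩ | ⟨init, h1, rfl⟩)
    · rcases h1 with h1 | ⟨v, d, h1⟩
      · obtain ⟨j, v, h5, h6, h7⟩ := hset k c hk h1 (by rw [h2]; simp)
        refine ⟨j, v, h5, .inl ⟨c, r, h2, h3, .inr ⟨h1, h6⟩⟩, fun l o' h8 h9 => ?_⟩
        by_contra h10
        exact h7 l h8 (not_lt.1 h10) a f o' h9
      · exact ⟨k, v, hk, .inl ⟨c, r, h2, h3, .inl ⟨rfl, d, h1⟩⟩, fun l o' h _ => h⟩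
    · exact ⟨k, .null, hk, .inr ⟨rfl, rfl, init, h1⟩, fun l o' h _ => h⟩
  obtain ⟨L, h1, h2, h3, h4, h5⟩ := hlin s a f m
  have hall : ∀ k o, k < m → I.WordInv s a f k o → ∃ r, (k, o, r) ∈ L := by
    intro k o hk ho
    obtain ⟨j, v, h6, h7, -⟩ := hcomplete k o hk ho
    obtain ⟨o', h8⟩ := h3 k j v h7 h6
    have := wordInv_unique ho (h2 _ h8).2
    simp only at this
    exact ⟨v, this ▸ h8⟩
  have hsort : L.Pairwise fun x y => x.1 < y.1 := by
    have hne : L.Pairwise fun x y => x.1 ≠ y.1 := List.pairwise_map.1 h1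
    refine (h4.and hne).imp_of_mem fun {x y} hx hy h => ?_
    by_contra hlt
    obtain ⟨j, v, -, h6, h7⟩ := hcomplete y.1 y.2.1 (h2 y hy).1 (h2 y hy).2
    exact h.1 j v h6 (h7 x.1 x.2.1 (lt_of_le_of_ne (not_lt.1 hlt) (Ne.symm h.2)) (h2 x hx).2)
  obtain ⟨o', h6⟩ := h3 k j v hr hj
  have h7 := wordInv_unique hk (h2 _ h6).2
  have h8 := legal_response (m := m) L 0 (fun _ _ => Nat.zero_le _) hsort h2
    (fun k o _ => hall k o) h5 _ h6
  simp only at h7 h8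
  rw [h8, h7]

end Words

/-! ### Calls of a thread that runs alone -/

section SoloCalls

variable {N : ℕ} {I : Integrated N} {s : Schedule N} {t : Fin N}

/-- Events that neither issue calls nor allocate nodes. -/
def Neutral {A : Scheme.Obj N} : Event A → Prop
  | .apiInv _ | .direct _ _ _ | .allocated _ _ _ => False
  | _ => True

/-- A snapshot of the memory: `W` are its contents, `F` are the active nodes, whose number has never
exceeded `4`; and `K` lists nodes that are not active any more, with the words that are in their
next fields for as long as the nodes are not reclaimed. -/
structure Snap (I : Integrated N) (s : Schedule N) (i : ℕ) (W : ℕ → ℕ → Val) (F : Finset Ref)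
    (K : Set (Ref × Val)) : Prop where
  sane : (I.conf s i).Sane
  mem : I.wordMem s i = W
  active : ∀ r, r ∈ (I.conf s i).activeRefs ↔ r ∈ F
  card : F.card ≤ 4
  bound : ∀ l ≤ i, (I.conf s l).count .active ≤ 4
  old : ∀ x ∈ K, x.1 ∉ F ∧ x.1.id < (I.conf s i).nextId ∧
    ((I.conf s i).Valid x.1 → W x.1.addr 1 = x.2)

variable {W : ℕ → ℕ → Val} {F : Finset Ref} {K : Set (Ref × Val)} {i : ℕ}

theorem effect_event (I : Integrated N) (s : Schedule N) (i : ℕ) :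
    Effect (I.conf s i) (I.conf s (i + 1)) (I.event s i) := effect_step I _ _ _

theorem bound_succ (hb : ∀ l ≤ i, (I.conf s l).count .active ≤ 4)
    (ha : ∀ r, r ∈ (I.conf s (i + 1)).activeRefs → r ∈ F) (hF : F.card ≤ 4) :
    ∀ l ≤ i + 1, (I.conf s l).count .active ≤ 4 := by
  intro l hl
  rcases Nat.le_succ_iff.1 hl with h | rfl
  · exact hb l h
  · exact (count_active_le ha).trans hF

theorem Snap.neutral (h : Snap I s i W F K) (he : Neutral (I.event s i)) :
    Snap I s (i + 1) W F K := by
  have hs : Shrinks (I.conf s i) (I.conf s (i + 1)) := by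
    have := effect_event I s i
    revert he this
    cases I.event s i <;> intro he this <;> first | exact this | exact he.elim
  have hact : ∀ r, r ∈ (I.conf s (i + 1)).activeRefs ↔ r ∈ F := by
    intro r; rw [hs.activeRefs]; exact h.active r
  refine ⟨hs.sane h.sane, ?_, hact, h.card, bound_succ h.bound (fun r => (hact r).1) h.card,
    fun x hx => ?_⟩
  · rw [Integrated.wordMem, h.mem]
    revert he
    cases I.event s i <;> intro he <;> first | rfl | exact he.elim
  · obtain ⟨h1, h2, h3⟩ := h.old x hx
    exact ⟨h1, by rwa [hs.nextId], fun hv => h3 (hs.valid hv)⟩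

/-- The active nodes after a call, except for allocations. -/
def callActive (F : Finset Ref) : Call → Finset Ref
  | .retire (.ptr (some r) _) => F.erase r
  | _ => F

theorem callActive_subset (F : Finset Ref) (a : Call) : callActive F a ⊆ F := by
  unfold callActive
  split
  · exact Finset.erase_subset _ _
  · exact subset_rfl

theorem retireCall_spec {A : Scheme.Obj N} {c : Config A} (hc : c.Sane) (a : Call)
    (ha : ∀ r, r ∈ c.activeRefs ↔ r ∈ F) :
    (c.retireCall a).Sane ∧ (∀ r, r ∈ (c.retireCall a).activeRefs ↔ r ∈ callActive F a) ∧
      (∀ r, (c.retireCall a).Valid r → c.Valid r) ∧ (c.retireCall a).nextId = c.nextId := by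
  have key : (∃ r m, a = .retire (.ptr (some r) m)) ∨
      (c.retireCall a = c ∧ callActive F a = F) := by
    rcases a with _ | _ | _ | _ | (_ | _ | ⟨_ | r, m⟩) | _ <;>
      first | exact .inl ⟨_, _, rfl⟩ | exact .inr ⟨rfl, rfl⟩
  rcases key with ⟨r, m, rfl⟩ | ⟨h1, h2⟩
  · show (c.retireRef r).Sane ∧ (∀ q, q ∈ (c.retireRef r).activeRefs ↔ q ∈ F.erase r) ∧
      (∀ q, (c.retireRef r).Valid q → c.Valid q) ∧ (c.retireRef r).nextId = c.nextId
    refine ⟨sane_retireRef hc r, fun q => ?_, fun q => valid_retireRef.1, nextId_retireRef c r⟩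
    rw [activeRefs_retireRef, Set.mem_sdiff, ha, Set.mem_singleton_iff, Finset.mem_erase, and_comm]
  · rw [h1, h2]
    exact ⟨hc, ha, fun _ h => h, rfl⟩

theorem callMem_read (W : ℕ → ℕ → Val) (p : Val) (f : ℕ) : callMem W (.read p f) = W := by
  unfold callMem
  split
  · rename_i h
    cases h
    simp [wordSpec]
  · rfl

/-- Nodes that are still allocated, but not active, are not affected by accesses to active
nodes. -/
theorem Snap.addr_ne (h : Snap I s i W F K) {x : Ref × Val} (hx : x ∈ K) {r : Ref} (hr : r ∈ F)
    (hv : (I.conf s i).Valid x.1) : x.1.addr ≠ r.addr := by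
  intro hxr
  obtain ⟨h1, -⟩ := h.old x hx
  have h2 := ((h.active r).2 hr).1
  rw [← hxr, hv.1] at h2
  apply h1
  have : x.1 = r := by
    obtain ⟨⟨a, j⟩, y⟩ := x
    obtain ⟨b, k⟩ := r
    simp only at hxr h2
    simp [hxr, h2]
  rwa [this]

/-- A call takes effect upon its invocation, no matter how the scheme implements it. -/
theorem Snap.call (h : Snap I s i W F K) {a : Call}
    (he : I.event s i = .apiInv a ∨
      (∃ v d, I.event s i = .direct a v d) ∧ ∀ init, a ≠ .alloc init)
    (hw : ∀ r f, a.target = some (r, f) → (∃ p g, a = .read p g) ∨ r ∈ F) :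
    Snap I s (i + 1) (callMem W a) (callActive F a) K := by
  have hs : Shrinks ((I.conf s i).retireCall a) (I.conf s (i + 1)) := by
    have := effect_event I s i
    rcases he with he | ⟨⟨v, d, he⟩, hne⟩
    · rw [he] at this; exact this
    · rw [he] at this
      cases a <;> first | exact this | exact absurd rfl (hne _)
  obtain ⟨h1, h2, h3, h4⟩ := retireCall_spec h.sane a h.active
  have hact : ∀ r, r ∈ (I.conf s (i + 1)).activeRefs ↔ r ∈ callActive F a := by
    intro r; rw [hs.activeRefs]; exact h2 r
  have hcard : (callActive F a).card ≤ 4 :=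
    (Finset.card_le_card (callActive_subset F a)).trans h.card
  refine ⟨hs.sane h1, ?_, hact, hcard, bound_succ h.bound (fun r => (hact r).1) hcard,
    fun x hx => ?_⟩
  · rw [Integrated.wordMem, h.mem]
    rcases he with he | ⟨⟨v, d, he⟩, hne⟩
    · rw [he]; rfl
    · rw [he]
      cases a <;> first | rfl | exact absurd rfl (hne _)
  · obtain ⟨h5, h6, h7⟩ := h.old x hx
    refine ⟨fun h8 => h5 (callActive_subset F a h8), by rwa [hs.nextId, h4], fun hv => ?_⟩
    have hv' := h3 _ (hs.valid hv)
    rw [← h7 hv']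
    by_cases hr : ∃ p f, a = .read p f
    · obtain ⟨p, f, rfl⟩ := hr
      rw [callMem_read]
    · rcases ht : a.target with _ | ⟨r, f⟩ <;> rcases hop : a.wordOp with _ | w <;>
        simp only [callMem, ht, hop]
      have hrF : r ∈ F := (hw r f ht).resolve_left hr
      rw [Function.update_of_ne (h.addr_ne hx hrF hv')]

/-- A new node: no active node has its address, and it is not among the nodes in `K`. -/
def Fresh (F : Finset Ref) (K : Set (Ref × Val)) (r : Ref) : Prop :=
  (∀ q ∈ F, q.addr ≠ r.addr) ∧ ∀ x ∈ K, x.1 ≠ r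

/-- The address of a new node may be that of a node in `K`, which then has become invalid. -/
theorem Snap.alloc (h : Snap I s i W F K) {b : ℕ} {init : ℕ → Val}
    (hb : (I.conf s i).Unallocated b)
    (hs : Shrinks ((I.conf s i).allocAt b init) (I.conf s (i + 1)))
    (he : eventMem W (I.event s i) = Function.update W b init) (hF : F.card ≤ 3) :
    Fresh F K ⟨b, (I.conf s i).nextId⟩ ∧
      Snap I s (i + 1) (Function.update W b init) (insert ⟨b, (I.conf s i).nextId⟩ F) K := by
  set r : Ref := ⟨b, (I.conf s i).nextId⟩ with hr
  have hact : ∀ q, q ∈ (I.conf s (i + 1)).activeRefs ↔ q ∈ insert r F := by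
    intro q
    rw [hs.activeRefs, activeRefs_allocAt hb, Set.mem_insert_iff, Finset.mem_insert, h.active q]
  have hcard : (insert r F).card ≤ 4 := (Finset.card_insert_le _ _).trans (by omega)
  have hfresh : ∀ x ∈ K, x.1 ≠ r := by
    intro x hx hxr
    have := (h.old x hx).2.1
    rw [hxr] at this
    exact lt_irrefl _ this
  refine ⟨⟨fun q hq hqb => ?_, hfresh⟩, hs.sane (sane_allocAt h.sane b init), ?_, hact, hcard,
    bound_succ h.bound (fun r => (hact r).1) hcard, fun x hx => ?_⟩
  · have h1 := ((h.active q).2 hq).2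
    rw [hqb] at h1
    rcases hb with hb | hb <;> rw [hb] at h1 <;> cases h1
  · rw [Integrated.wordMem, h.mem, he]
  · obtain ⟨h5, h6, h7⟩ := h.old x hx
    refine ⟨fun h8 => (Finset.mem_insert.1 h8).elim (hfresh x hx) h5, ?_, fun hv => ?_⟩
    · rw [hs.nextId]
      exact h6.trans (Nat.lt_succ_self _)
    · obtain ⟨h8, h9⟩ := valid_allocAt (hs.valid hv) (ne_of_lt h6)
      rw [Function.update_of_ne h9]
      exact h7 h8

/-- What a step inside an operation of a scheme may do. -/
theorem apiStep_cases (I : Integrated N) (t : Fin N) (c : Config I.obj) {ctrl : Ctrl} {st : List ℕ}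
    {ρ : Var → Val} {fr : Frame I.obj.Label} {regs : I.obj.Reg → I.obj.Word}
    (h : c.thr t = ⟨ctrl, st, ρ, some fr, regs⟩) :
    (∃ a d lab regs', (I.apiStep t c fr).2 = .inner a d ∧
        (I.apiStep t c fr).1.thr t = ⟨ctrl, st, ρ, some ⟨fr.call, lab, fr.result⟩, regs'⟩) ∨
    (∃ init b d lab regs', fr.call = .alloc init ∧ fr.result = none ∧
        (I.apiStep t c fr).2 = .allocated b init d ∧
        (I.apiStep t c fr).1.thr t =
          ⟨ctrl, st, ρ, some ⟨fr.call, lab, some ⟨b, c.nextId⟩⟩, regs'⟩) ∨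
    (∃ v u, deliver fr v = some u ∧
        (I.apiStep t c fr).2 = .apiRes fr.call u (I.resume (c.thr t) u).2 ∧
        (I.apiStep t c fr).1.thr t = (I.resume (c.thr t) u).1) ∨
    ((I.apiStep t c fr).2 = .quiet none ∧
      ((I.apiStep t c fr).1.thr t = c.thr t ∨ ((I.apiStep t c fr).1.thr t).frame = none)) := by
  have hset : ∀ (d : Config I.obj) th, (d.setThr t th).thr t = th := fun d th =>
    Function.update_self _ _ _
  unfold Integrated.apiStep
  rw [h]
  dsimp only
  split
  case h_8 =>
    split
    · rename_i hcall hres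
      split
      · exact .inr (.inl ⟨_, _, _, _, _, hcall, hres, rfl, hset _ _⟩)
      · exact .inl ⟨_, _, _, _, rfl, hset _ _⟩
    · exact .inl ⟨_, _, _, _, rfl, hset _ _⟩
  case h_9 =>
    split
    · rename_i hd
      exact .inr (.inr (.inl ⟨_, _, hd, rfl, hset _ _⟩))
    · exact .inr (.inr (.inr ⟨rfl, .inl h⟩))
  case h_10 =>
    split <;> exact .inr (.inr (.inr ⟨rfl, .inr (by rw [hset])⟩))
  all_goals exact .inl ⟨_, _, _, _, rfl, hset _ _⟩

theorem step_of_frame_none (I : Integrated N) (t : Fin N) (req : SetOp × ℤ) (c : Config I.obj)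
    (h : (c.thr t).frame = none) :
    (∃ a, (I.step t req c).2 = .apiInv a) ∨
      (((I.step t req c).1.thr t).frame = none ∧ ∀ a v d, (I.step t req c).2 ≠ .apiRes a v d) := by
  have hset : ∀ (d : Config I.obj) th, (d.setThr t th).thr t = th := fun d th =>
    Function.update_self _ _ _
  have hissue : ∀ a, (∃ a', (I.issue t c a).2 = .apiInv a') ∨
      (((I.issue t c a).1.thr t).frame = none ∧ ∀ a' v d, (I.issue t c a).2 ≠ .apiRes a' v d) := by
    intro a
    unfold Integrated.issue
    split
    · exact .inl ⟨_, rfl⟩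
    · refine .inr ⟨?_, by simp⟩
      rw [hset]
      unfold Integrated.resume
      split <;> rfl
  unfold Integrated.step
  dsimp only
  split
  · rename_i hf
    rw [h] at hf
    cases hf
  split
  · exact .inr ⟨by rw [hset]; exact h, by simp⟩
  · exact hissue _
  · exact .inr ⟨by rw [hset]; exact h, by simp⟩
  · unfold Integrated.bodyStep
    dsimp only
    split <;> first | exact hissue _ | exact .inr ⟨by rw [hset]; exact h, by simp⟩
  · exact hissue _
  · exact .inr ⟨by rw [hset]; exact h, by simp⟩

/-- Steps of an operation of a scheme called with `a`, before its response. -/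
def Internal {A : Scheme.Obj N} (a : Call) : Event A → Prop
  | .inner _ _ => True
  | .quiet d => d = none
  | .allocated _ _ _ => a.target = none
  | _ => False

/-- The thread `t` is executing the operation of the scheme called with `a`. -/
def InCall (I : Integrated N) (s : Schedule N) (t : Fin N) (ctrl : Ctrl) (st : List ℕ)
    (ρ : Var → Val) (a : Call) (W : ℕ → ℕ → Val) (F : Finset Ref) (K : Set (Ref × Val))
    (i : ℕ) : Prop :=
  ∃ regs lab res, (I.conf s i).thr t = ⟨ctrl, st, ρ, some ⟨a, lab, res⟩, regs⟩ ∧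
    ((res = none ∧ Snap I s i W F K) ∨ ∃ init r, a = .alloc init ∧ res = some r ∧ Fresh F K r ∧
      Snap I s i (Function.update W r.addr init) (insert r F) K)

/-- The call `a` has yielded `v`. -/
def Finished (I : Integrated N) (s : Schedule N) (a : Call) (v : Val) (W : ℕ → ℕ → Val)
    (F : Finset Ref) (K : Set (Ref × Val)) (i : ℕ) : Prop :=
  ((∀ init, a ≠ .alloc init) ∧ Snap I s i W F K) ∨
    ∃ init r, a = .alloc init ∧ v = .ptr (some r) 0 ∧ Fresh F K r ∧
      Snap I s i (Function.update W r.addr init) (insert r F) K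

variable {ctrl : Ctrl} {st : List ℕ} {ρ : Var → Val} {a : Call}

/-- A step inside an operation of a scheme is internal, or the response, or leaves the operation
without a response. -/
theorem InCall.step (h : InCall I s t ctrl st ρ a W F K i) (ht : (s i).1 = t)
    (hF : ∀ init, a = .alloc init → F.card ≤ 3) :
    (InCall I s t ctrl st ρ a W F K (i + 1) ∧ Internal a (I.event s i)) ∨
      (∃ v regs, I.event s i = .apiRes a v (I.resume ⟨ctrl, st, ρ, none, regs⟩ v).2 ∧
        (I.conf s (i + 1)).thr t = (I.resume ⟨ctrl, st, ρ, none, regs⟩ v).1 ∧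
        Finished I s a v W F K (i + 1)) ∨
      (I.event s i = .quiet none ∧ ((I.conf s (i + 1)).thr t).frame = none) := by
  obtain ⟨regs, lab, res, h1, h2⟩ := h
  have hstep : I.step (s i).1 (s i).2 (I.conf s i) = I.apiStep t (I.conf s i) ⟨a, lab, res⟩ := by
    rw [ht]
    unfold Integrated.step
    rw [h1]
  have hc : I.conf s (i + 1) = (I.apiStep t (I.conf s i) ⟨a, lab, res⟩).1 := congrArg Prod.fst hstep
  have he : I.event s i = (I.apiStep t (I.conf s i) ⟨a, lab, res⟩).2 := congrArg Prod.snd hstep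
  have hneutral : Neutral (I.event s i) →
      ((res = none ∧ Snap I s (i + 1) W F K) ∨ ∃ init r, a = .alloc init ∧ res = some r ∧
        Fresh F K r ∧ Snap I s (i + 1) (Function.update W r.addr init) (insert r F) K) := by
    intro hn
    rcases h2 with ⟨h2, h3⟩ | ⟨init, r, h2, h3, h4, h5⟩
    · exact .inl ⟨h2, h3.neutral hn⟩
    · exact .inr ⟨init, r, h2, h3, h4, h5.neutral hn⟩
  rcases apiStep_cases I t (I.conf s i) h1 with ⟨b, d, lab', regs', h3, h4⟩ |
    ⟨init, b, d, lab', regs', h3, h4, h5, h6⟩ | ⟨v, u, h3, h4, h5⟩ | ⟨h3, h4⟩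
  · rw [← he] at h3
    rw [← hc] at h4
    exact .inl ⟨⟨_, _, _, h4, hneutral (by rw [h3]; trivial)⟩, by rw [h3]; trivial⟩
  · rw [← he] at h5
    rw [← hc] at h6
    simp only at h3 h4
    subst h3 h4
    obtain ⟨-, hsnap⟩ := h2.resolve_right (by rintro ⟨_, _, -, h, -⟩; cases h)
    have heff := effect_event I s i
    rw [h5] at heff
    obtain ⟨h7, h8⟩ := hsnap.alloc heff.1 heff.2 (by rw [h5]; rfl) (hF init rfl)
    exact .inl ⟨⟨_, _, _, h6, .inr ⟨init, _, rfl, rfl, h7, h8⟩⟩, by rw [h5]; rfl⟩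
  · rw [← he] at h4
    rw [← hc] at h5
    have hres : ∀ v, I.resume ((I.conf s i).thr t) v = I.resume ⟨ctrl, st, ρ, none, regs⟩ v := by
      intro v
      rw [h1]
      unfold Integrated.resume
      cases ctrl <;> rfl
    rw [hres] at h4 h5
    refine .inr (.inl ⟨u, regs, h4, h5, ?_⟩)
    rcases hneutral (by rw [h4]; trivial) with ⟨h6, h7⟩ | ⟨init, r, h6, h7, h8, h9⟩
    · refine .inl ⟨fun init hinit => ?_, h7⟩
      subst hinit h6
      simp [deliver] at h3
    · subst h6 h7
      simp [deliver] at h3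
      exact .inr ⟨init, r, rfl, h3.symm, h8, h9⟩
  · rw [← he] at h3
    rw [← hc] at h4
    rcases h4 with h4 | h4
    · exact .inl ⟨⟨_, _, _, h4.trans h1, hneutral (by rw [h3]; trivial)⟩, by rw [h3]; rfl⟩
    · exact .inr (.inr ⟨h3, h4⟩)

/-- In an execution in which a thread runs alone from some point on, no other thread takes
infinitely many steps. -/
theorem isolating_of_solo (hs : ∀ l, i ≤ l → (s l).1 = t) : SchedClass.isolating.Mem s := by
  intro t' ht' k
  obtain ⟨l, hl, hlt⟩ := ht' i
  rw [hs l hl] at hlt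
  subst hlt
  exact ⟨i, fun j _ => hs _ (Nat.le_add_right i j)⟩

/-- An operation of the scheme invoked by a thread that runs alone responds: the thread has to
complete its set operation, and cannot do so before. -/
theorem InCall.completes (hwf : I.WellFormed)
    (hprog : ∀ s, SchedClass.isolating.Mem s → I.MinimalProgress s)
    (hs : ∀ l, i ≤ l → (s l).1 = t) (he : I.event s i = .apiInv a) (hctrl : ctrl ≠ .idle)
    (h : InCall I s t ctrl st ρ a W F K (i + 1)) (hF : ∀ init, a = .alloc init → F.card ≤ 3) :
    ∃ j v regs, i < j ∧ I.event s j = .apiRes a v (I.resume ⟨ctrl, st, ρ, none, regs⟩ v).2 ∧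
      (I.conf s (j + 1)).thr t = (I.resume ⟨ctrl, st, ρ, none, regs⟩ v).1 ∧
      Finished I s a v W F K (j + 1) ∧ ∀ l, i < l → l < j → Internal a (I.event s l) := by
  have hpend : ∃ t, I.PendingEffective s t (i + 1) := by
    obtain ⟨regs, lab, res, h1, -⟩ := h
    refine ⟨t, ?_, fun m => ⟨max m i, le_max_left _ _, hs _ (le_max_right _ _)⟩⟩
    unfold Integrated.thread
    rw [h1]
    exact hctrl
  obtain ⟨j, v, hj, hres⟩ := hprog s (isolating_of_solo hs) (i + 1) hpend
  -- as long as no step leaves the operation, all steps are internal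
  have hind : ∀ n, (∀ l, i < l → l < i + 1 + n → InCall I s t ctrl st ρ a W F K l →
      InCall I s t ctrl st ρ a W F K (l + 1)) → InCall I s t ctrl st ρ a W F K (i + 1 + n) := by
    intro n
    induction n with
    | zero => exact fun _ => h
    | succ n ih =>
      intro hl
      exact hl (i + 1 + n) (by omega) (by omega) (ih fun l h1 h2 => hl l h1 (by omega))
  have hex : ∃ l, i < l ∧ InCall I s t ctrl st ρ a W F K l ∧
      ¬ InCall I s t ctrl st ρ a W F K (l + 1) := by
    by_contra hno
    push Not at hno
    have h1 : InCall I s t ctrl st ρ a W F K j := by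
      have := hind (j - (i + 1)) fun l h2 _ h3 => hno l h2 h3
      rwa [show i + 1 + (j - (i + 1)) = j by omega] at this
    rcases h1.step (hs j (by omega)) hF with ⟨-, h2⟩ | ⟨v', _, h2, -⟩ | ⟨h2, -⟩
    · rw [hres] at h2; exact h2
    · rw [hres] at h2; cases h2
    · rw [hres] at h2; cases h2
  classical
  obtain ⟨h1, h2, h3⟩ := Nat.find_spec hex
  have hmin := fun m (hm : m < Nat.find hex) => Nat.find_min hex hm
  set l := Nat.find hex with hl
  have hin : ∀ m, i < m → m < l → InCall I s t ctrl st ρ a W F K m →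
      InCall I s t ctrl st ρ a W F K (m + 1) := fun m h4 h5 h6 => by
    by_contra h7
    exact hmin m h5 ⟨h4, h6, h7⟩
  have hint : ∀ m, i < m → m < l → Internal a (I.event s m) := by
    intro m h4 h5
    have h6 : InCall I s t ctrl st ρ a W F K m := by
      have := hind (m - (i + 1)) fun k h6 h7 => hin k h6 (by omega)
      rwa [show i + 1 + (m - (i + 1)) = m by omega] at this
    rcases h6.step (hs m (by omega)) hF with ⟨-, h7⟩ | ⟨v', regs, h7, h8, -⟩ | ⟨h7, -⟩
    · exact h7
    · obtain ⟨_, _, _, h9, -⟩ := hin m h4 h5 h6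
      rw [h9] at h8
      have := congrArg Thread.frame h8
      unfold Integrated.resume at this
      cases ctrl <;> cases this
    · rw [h7]; rfl
  rcases h2.step (hs l h1.le) hF with ⟨h4, -⟩ | ⟨v', regs, h4, h5, h6⟩ | ⟨h4, h5⟩
  · exact absurd h4 h3
  · exact ⟨l, v', regs, h1, h4, h5, h6, hint⟩
  · -- a roll-back violates well-formedness
    exfalso
    have hlj : l < j := by
      rcases lt_trichotomy l j with h6 | h6 | h6
      · exact h6
      · rw [h6, hres] at h4; cases h4
      · have := hint j hj h6
        rw [hres] at this
        exact this.elim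
    have hex' : ∃ m, l < m ∧ ((∃ c, I.event s m = .apiInv c) ∨ ∃ v, I.event s m = .opRes v) :=
      ⟨j, hlj, .inr ⟨v, hres⟩⟩
    obtain ⟨h6, h7⟩ := Nat.find_spec hex'
    have hmin' := fun m (hm : m < Nat.find hex') => Nat.find_min hex' hm
    set m := Nat.find hex' with hm
    have hnone : ∀ n, l + 1 + n ≤ m → ((I.conf s (l + 1 + n)).thr t).frame = none := by
      intro n
      induction n with
      | zero => exact fun _ => h5
      | succ n ih =>
        intro hn
        have hsn := hs (l + 1 + n) (by omega)
        rcases step_of_frame_none I t (s (l + 1 + n)).2 _ (ih (by omega)) with h8 | ⟨h8, -⟩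
        · refine absurd ⟨by omega, .inl ?_⟩ (hmin' (l + 1 + n) (by omega))
          unfold Integrated.event
          rw [hsn]
          exact h8
        · rw [← hsn] at h8 ⊢
          exact h8
    obtain ⟨k, h8, h9, -, c, v', d, h10⟩ := (hwf s i m (by omega)
      (by rw [hs m (by omega), hs i le_rfl])).1 ⟨a, he⟩ (by
        rcases h7 with h7 | h7
        · exact .inl h7
        · exact .inr (.inr h7))
    rcases lt_trichotomy k l with h11 | rfl | h11
    · have := hint k h8 h11
      rw [h10] at this
      exact this
    · rw [h4] at h10; cases h10
    · have h12 := hnone (k - (l + 1)) (by omega)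
      rw [show l + 1 + (k - (l + 1)) = k by omega] at h12
      have hsk := hs k (by omega)
      rcases step_of_frame_none I t (s k).2 _ h12 with ⟨c', h13⟩ | ⟨-, h13⟩
      · unfold Integrated.event at h10
        rw [hsk, h13] at h10
        cases h10
      · refine h13 c v' d ?_
        unfold Integrated.event at h10
        rwa [hsk] at h10

end SoloCalls

/-! ### Running one thread of an integrated implementation -/

section SoloRuns

variable {N : ℕ}

/-- What is used of a scheme that is easily integrated into an implementation and applicable to
it. -/
structure WellBehaved (I : Integrated N) : Prop where
  words : I.LinearizableWords
  wellFormed : I.WellFormed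
  safe : I.Safe
  progress : ∀ s, SchedClass.isolating.Mem s → I.MinimalProgress s

/-- From step `i` on, the thread `t` runs alone, with requests `req`.  In the `i`-th configuration,
it is outside of the code of the scheme, `ctrl`, `st` and `ρ` are its control state, its stack and
its variables, and the state of the thread `u` is `th`. -/
structure At (I : Integrated N) (s : Schedule N) (t : Fin N) (req : SetOp × ℤ) (u : Fin N)
    (th : Thread I.obj) (i : ℕ) (ctrl : Ctrl) (st : List ℕ) (ρ : Var → Val) (W : ℕ → ℕ → Val)
    (F : Finset Ref) (K : Set (Ref × Val)) : Prop where
  solo : ∀ l, i ≤ l → s l = (t, req)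
  thr : ∃ regs, (I.conf s i).thr t = ⟨ctrl, st, ρ, none, regs⟩
  other : (I.conf s i).thr u = th
  snap : Snap I s i W F K
  settled : I.Settled s i

/-- The situation that `At` describes, in some configuration from the `m`-th one on. -/
def Arrives (I : Integrated N) (s : Schedule N) (t : Fin N) (req : SetOp × ℤ) (u : Fin N)
    (th : Thread I.obj) (m : ℕ) (ctrl : Ctrl) (st : List ℕ) (ρ : Var → Val) (W : ℕ → ℕ → Val)
    (F : Finset Ref) (K : Set (Ref × Val)) : Prop :=
  ∃ i, m ≤ i ∧ At I s t req u th i ctrl st ρ W F K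

variable {I : Integrated N} {s : Schedule N} {t u : Fin N} {req : SetOp × ℤ} {th : Thread I.obj}
  {i m : ℕ} {ctrl : Ctrl} {st : List ℕ} {ρ : Var → Val} {W : ℕ → ℕ → Val} {F : Finset Ref}
  {K : Set (Ref × Val)}

theorem Integrated.Settled.succ (h : I.Settled s i) (he : ∀ a, I.event s i ≠ .apiInv a) :
    I.Settled s (i + 1) := by
  intro k a hk ha ht
  rcases Nat.lt_succ_iff_lt_or_eq.1 hk with h1 | rfl
  · obtain ⟨j, v, h2, h3⟩ := h k a h1 ha ht
    exact ⟨j, v, by omega, h3⟩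
  · exact absurd ha (he a)

theorem not_wordInv {j x f : ℕ} {o : WordOp} (h1 : ∀ a, I.event s j ≠ .apiInv a)
    (h2 : ∀ a v d, I.event s j ≠ .direct a v d) (h3 : ∀ b init d, I.event s j ≠ .allocated b init d) :
    ¬ I.WordInv s x f j o := by
  rintro (⟨c, r, h | ⟨v, d, h⟩, -⟩ | ⟨init, ⟨d, h⟩ | ⟨r, m, d, h, -⟩, -⟩)
  · exact h1 _ h
  · exact h2 _ _ _ h
  · exact h3 _ _ _ h
  · exact h2 _ _ _ h

theorem thr_eq_of_solo (hut : u ≠ t) {j : ℕ} (hij : i ≤ j) (hs : ∀ l, i ≤ l → (s l).1 = t) :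
    (I.conf s j).thr u = (I.conf s i).thr u := by
  induction j, hij using Nat.le_induction with
  | base => rfl
  | succ j hj ih =>
    rw [← ih]
    exact step_thr_of_ne I (by rw [hs j hj]; exact hut) _ _

theorem nextId_valid_succ (I : Integrated N) (s : Schedule N) (i : ℕ) :
    (I.conf s i).nextId ≤ (I.conf s (i + 1)).nextId ∧ ∀ r, (I.conf s (i + 1)).Valid r →
      r.id < (I.conf s i).nextId → (I.conf s i).Valid r := by
  have hall : ∀ b init, Shrinks ((I.conf s i).allocAt b init) (I.conf s (i + 1)) →
      (I.conf s i).nextId ≤ (I.conf s (i + 1)).nextId ∧ ∀ r, (I.conf s (i + 1)).Valid r →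
      r.id < (I.conf s i).nextId → (I.conf s i).Valid r := fun b init h =>
    ⟨by rw [h.nextId]; exact Nat.le_succ _, fun r h1 h2 => (valid_allocAt (h.valid h1) h2.ne).1⟩
  have hret : ∀ a, Shrinks ((I.conf s i).retireCall a) (I.conf s (i + 1)) →
      (I.conf s i).nextId ≤ (I.conf s (i + 1)).nextId ∧ ∀ r, (I.conf s (i + 1)).Valid r →
      r.id < (I.conf s i).nextId → (I.conf s i).Valid r := by
    intro a h
    rcases a with _ | _ | _ | _ | (_ | _ | ⟨_ | r, m⟩) | _
    case retire.ptr.some =>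
      exact ⟨by rw [h.nextId]; exact (nextId_retireRef _ r).ge,
        fun q h1 _ => valid_retireRef.1 (h.valid h1)⟩
    all_goals exact ⟨h.nextId.ge, fun q h1 _ => h.valid h1⟩
  have heff := effect_event I s i
  cases he : I.event s i with
  | apiInv a => rw [he] at heff; exact hret a heff
  | allocated b init d => rw [he] at heff; exact hall b init heff.2
  | direct a v d =>
    rw [he] at heff
    cases a with
    | alloc init => exact hall _ init heff.2
    | _ => exact hret _ heff
  | _ =>
    rw [he] at heff
    exact ⟨(Shrinks.nextId heff).ge, fun q h1 _ => Shrinks.valid heff h1⟩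

theorem nextId_mono {j : ℕ} (h : i ≤ j) : (I.conf s i).nextId ≤ (I.conf s j).nextId := by
  induction h with
  | refl => exact le_rfl
  | step _ ih => exact ih.trans (nextId_valid_succ I s _).1

/-- Once a reference is invalid, it remains so. -/
theorem valid_antitone {j : ℕ} (h : i ≤ j) {r : Ref} (hr : (I.conf s j).Valid r)
    (hid : r.id < (I.conf s i).nextId) : (I.conf s i).Valid r := by
  induction h with
  | refl => exact hr
  | @step j h ih => exact ih ((nextId_valid_succ I s j).2 r hr (hid.trans_le (nextId_mono h)))

/-- A call issued by a thread that runs alone: it is performed directly in step `i`, or by an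
operation of the scheme, which responds in step `j`.  In both cases the thread `t` goes on as after
a direct call, with the value `v` that a sequential memory would return. -/
theorem At.issue (hI : WellBehaved I) (hut : u ≠ t) (h : At I s t req u th i ctrl st ρ W F K)
    (hctrl : ctrl ≠ .idle) {a : Call}
    (hiss : I.step t req (I.conf s i) = I.issue t (I.conf s i) a)
    (hw : ∀ r f, a.target = some (r, f) → (∃ p g, a = .read p g) ∨ r ∈ F)
    (hF : ∀ init, a = .alloc init → F.card ≤ 3) :
    ∃ j v regs, i ≤ j ∧ (I.conf s (j + 1)).thr t = (I.resume ⟨ctrl, st, ρ, none, regs⟩ v).1 ∧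
      (I.conf s (j + 1)).thr u = th ∧
      Finished I s a v (callMem W a) (callActive F a) K (j + 1) ∧ I.Settled s (j + 1) ∧
      (∀ r f w, a.target = some (r, f) → a.wordOp = some w →
        v = (wordSpec (W r.addr f) w).2) ∧
      ((j = i ∧ I.event s i = .direct a v (I.resume ⟨ctrl, st, ρ, none, regs⟩ v).2) ∨
        (I.event s i = .apiInv a ∧ I.ApiRes s i j v ∧
          I.event s j = .apiRes a v (I.resume ⟨ctrl, st, ρ, none, regs⟩ v).2)) := by
  obtain ⟨hs, ⟨regs, hthr⟩, hother, hsnap, hset⟩ := h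
  have hs1 : ∀ l, i ≤ l → (s l).1 = t := fun l hl => by rw [hs l hl]
  have hc : I.conf s (i + 1) = (I.issue t (I.conf s i) a).1 := by
    rw [← hiss, Integrated.conf, hs i le_rfl]
  have he : I.event s i = (I.issue t (I.conf s i) a).2 := by
    rw [← hiss, Integrated.event, hs i le_rfl]
  have hvalue : ∀ j v, i ≤ j → I.Settled s (j + 1) →
      (∀ r f, a.target = some (r, f) → I.WordRes s r.addr f i j v) →
      ∀ r f w, a.target = some (r, f) → a.wordOp = some w → v = (wordSpec (W r.addr f) w).2 := by
    intro j v hj h1 h2 r f w h3 h4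
    have hinv : I.WordInv s r.addr f i w := by
      refine .inl ⟨a, r, ?_, h3, rfl, h4⟩
      rw [Integrated.Issued, he]
      unfold Integrated.issue
      split
      · exact .inl rfl
      · exact .inr ⟨_, _, rfl⟩
    rw [← hsnap.mem]
    exact word_response hI.words h1 hinv (h2 r f h3) (Nat.lt_succ_self j)
  unfold Integrated.issue at hc he
  cases henter : I.obj.enter a with
  | none =>
    simp only [henter] at hc he
    rw [hthr] at hc he
    have hset' : I.Settled s (i + 1) := hset.succ (by rw [he]; simp)
    refine ⟨i, (performDirect (I.conf s i) a).2, regs, le_rfl, ?_, ?_, ?_, hset', ?_,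
      .inl ⟨rfl, he⟩⟩
    · rw [hc]; exact Function.update_self _ _ _
    · rw [← hother]; exact step_thr_of_ne I (by rw [hs1 i le_rfl]; exact hut) _ _
    · by_cases ha : ∃ init, a = .alloc init
      · obtain ⟨init, rfl⟩ := ha
        have heff := effect_event I s i
        rw [he] at heff
        obtain ⟨h1, h2⟩ := hsnap.alloc hsnap.sane.unallocated_brk heff.2
          (by rw [he]; rfl) (hF init rfl)
        exact .inr ⟨init, _, rfl, rfl, h1, h2⟩
      · have ha' : ∀ init, a ≠ .alloc init := fun init h => ha ⟨init, h⟩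
        exact .inl ⟨ha', hsnap.call (.inr ⟨⟨_, _, he⟩, ha'⟩) hw⟩
    · exact hvalue i _ le_rfl hset' fun r f hr => .inl ⟨a, r, hr, rfl, .inl ⟨rfl, _, he⟩⟩
  | some l =>
    simp only [henter] at hc he
    rw [hthr] at hc
    have hin : InCall I s t ctrl st ρ a (callMem W a) (callActive F a) K (i + 1) :=
      ⟨regs, l, none, by rw [hc]; exact Function.update_self _ _ _,
        .inl ⟨rfl, hsnap.call (.inl he) hw⟩⟩
    obtain ⟨j, v, regs', hj, hres, hthr', hfin, hint⟩ := hin.completes hI.wellFormed hI.progress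
      hs1 he hctrl fun init hinit => (Finset.card_le_card (callActive_subset F a)).trans
        (hF init hinit)
    have hapi : I.ApiRes s i j v := by
      refine ⟨a, _, he, hj, by rw [hs1 j hj.le, hs1 i le_rfl], hres, fun k h1 h2 _ => ?_⟩
      have := hint k h1 h2
      constructor
      · intro c' h3; rw [h3] at this; exact this
      · intro c' w d' h3; rw [h3] at this; exact this
    have hset' : I.Settled s (j + 1) := by
      intro k b hk hb ht
      rcases lt_trichotomy k i with h1 | rfl | h1
      · obtain ⟨j', v', h2, h3⟩ := hset k b h1 hb ht
        exact ⟨j', v', by omega, h3⟩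
      · rw [he] at hb
        cases hb
        refine ⟨j, v, Nat.lt_succ_self j, hapi, fun l h2 h3 x f o => ?_⟩
        rcases h3.lt_or_eq with h3 | rfl
        · have := hint l h2 h3
          refine not_wordInv (fun a' h4 => ?_) (fun a' v' d h4 => ?_) (fun b init d h4 => ?_) <;>
            rw [h4] at this
          · exact this
          · exact this
          · exact ht this
        · refine not_wordInv ?_ ?_ ?_ <;> rw [hres] <;> simp
      · exfalso
        rcases (Nat.lt_succ_iff.1 hk).lt_or_eq with h2 | rfl
        · have := hint k h1 h2
          rw [hb] at this
          exact this
        · rw [hres] at hb; cases hb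
    exact ⟨j, v, regs', hj.le, hthr', by rw [← hother, thr_eq_of_solo hut (by omega) hs1], hfin,
      hset', hvalue j v hj.le hset' fun r f hr => .inl ⟨a, r, hr, rfl, .inr ⟨he, hapi⟩⟩,
      .inr ⟨he, hapi, hres⟩⟩

/-- A step that does not involve the memory. -/
theorem At.local (hut : u ≠ t) (h : At I s t req u th i ctrl st ρ W F K) {ctrl' : Ctrl}
    {st' : List ℕ} {ρ' : Var → Val} {e : Event I.obj} (he : Neutral e)
    (hstep : ∀ regs, (I.conf s i).thr t = ⟨ctrl, st, ρ, none, regs⟩ →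
      I.step t req (I.conf s i) = ((I.conf s i).setThr t ⟨ctrl', st', ρ', none, regs⟩, e)) :
    At I s t req u th (i + 1) ctrl' st' ρ' W F K := by
  obtain ⟨hs, ⟨regs, hthr⟩, hother, hsnap, hset⟩ := h
  have h1 := hstep regs hthr
  have hc : I.conf s (i + 1) = (I.conf s i).setThr t ⟨ctrl', st', ρ', none, regs⟩ := by
    rw [Integrated.conf, hs i le_rfl, h1]
  have he' : I.event s i = e := by rw [Integrated.event, hs i le_rfl, h1]
  refine ⟨fun l hl => hs l (by omega), ⟨regs, by rw [hc]; exact Function.update_self _ _ _⟩, ?_,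
    hsnap.neutral (he' ▸ he), hset.succ fun a ha => ?_⟩
  · rw [hc, ← hother]; exact Function.update_of_ne hut _ _
  · rw [he'] at ha
    subst ha
    exact he

theorem Arrives.local (hut : u ≠ t) (h : Arrives I s t req u th m ctrl st ρ W F K) {ctrl' : Ctrl}
    {st' : List ℕ} {ρ' : Var → Val} {e : Event I.obj} (he : Neutral e)
    (hstep : ∀ i regs, (I.conf s i).thr t = ⟨ctrl, st, ρ, none, regs⟩ →
      I.step t req (I.conf s i) = ((I.conf s i).setThr t ⟨ctrl', st', ρ', none, regs⟩, e)) :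
    Arrives I s t req u th m ctrl' st' ρ' W F K := by
  obtain ⟨i, hi, h⟩ := h
  exact ⟨i + 1, by omega, h.local hut he (hstep i)⟩

variable {o : SetOp} {pc : ℕ}

section Instructions

variable (hut : u ≠ t) (h : Arrives I s t req u th m (.body o pc) st ρ W F K)
include hut h

theorem Arrives.bool {d : Var} {x : Bool} (hi : I.prog.code pc = .bool d x) :
    Arrives I s t req u th m (.body o (pc + 1)) st (Function.update ρ d (.bool x)) W F K :=
  h.local (e := .quiet (some d)) hut trivial fun _ _ hthr => step_bool hthr hi

theorem Arrives.move {d x : Var} (hi : I.prog.code pc = .move d x) :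
    Arrives I s t req u th m (.body o (pc + 1)) st (Function.update ρ d (ρ x)) W F K :=
  h.local (e := .quiet (some d)) hut trivial fun _ _ hthr => step_move hthr hi

theorem Arrives.setMark {d x : Var} {k : ℕ} (hi : I.prog.code pc = .setMark d x k) :
    Arrives I s t req u th m (.body o (pc + 1)) st (Function.update ρ d ((ρ x).setMark k))
      W F K :=
  h.local (e := .quiet (some d)) hut trivial fun _ _ hthr => step_setMark hthr hi

theorem Arrives.global {d g : ℕ} (hi : I.prog.code pc = .global d g) :
    Arrives I s t req u th m (.body o (pc + 1)) st (Function.update ρ d (I.prog.global g))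
      W F K :=
  h.local (e := .quiet (some d)) hut trivial fun _ _ hthr => step_global hthr hi

theorem Arrives.jump {b : Cond} {q : ℕ} (hi : I.prog.code pc = .jumpIf b q)
    (hb : b.eval ρ = true) : Arrives I s t req u th m (.body o q) st ρ W F K :=
  h.local (e := .quiet none) hut trivial fun _ _ hthr => by rw [step_jumpIf hthr hi, if_pos hb]

theorem Arrives.noJump {b : Cond} {q : ℕ} (hi : I.prog.code pc = .jumpIf b q)
    (hb : b.eval ρ = false) : Arrives I s t req u th m (.body o (pc + 1)) st ρ W F K :=
  h.local (e := .quiet none) hut trivial fun _ _ hthr => by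
    rw [step_jumpIf hthr hi, if_neg (by simp [hb])]

theorem Arrives.goto {q : ℕ} (hi : I.prog.code pc = .goto q) :
    Arrives I s t req u th m (.body o q) st ρ W F K :=
  h.local (e := .quiet none) hut trivial fun _ _ hthr => step_goto hthr hi

theorem Arrives.call {q : ℕ} (hi : I.prog.code pc = .call q) :
    Arrives I s t req u th m (.body o q) ((pc + 1) :: st) ρ W F K :=
  h.local (e := .quiet none) hut trivial fun _ _ hthr => step_call hthr hi

theorem Arrives.return (hi : I.prog.code pc = .return) :
    Arrives I s t req u th m (.body o (st.headD 0)) st.tail ρ W F K :=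
  h.local (e := .quiet none) hut trivial fun _ _ hthr => step_return hthr hi

theorem Arrives.ret {x : Var} (hi : I.prog.code pc = .ret x) :
    Arrives I s t req u th m (.epi o (I.epi o) (ρ x)) st ρ W F K :=
  h.local (e := .quiet none) hut trivial fun _ _ hthr => by
    simp [step_body hthr, Integrated.bodyStep, hi, hthr]

variable (hI : WellBehaved I)
include hI

/-- Reads return what is in memory. -/
theorem Arrives.read {d p f : ℕ} (hi : I.prog.code pc = .read d p f) {r : Ref} {k : ℕ}
    (hp : ρ p = .ptr (some r) k) :
    Arrives I s t req u th m (.body o (pc + 1)) st (Function.update ρ d (W r.addr f)) W F K := by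
  obtain ⟨i, hi', h⟩ := h
  obtain ⟨regs, hthr⟩ := h.thr
  obtain ⟨j, v, regs', hj, h1, h2, h3, h4, h5, -⟩ := h.issue hI hut (a := .read (ρ p) f) (by simp)
    (by simp [step_body hthr, Integrated.bodyStep, hi, hthr]) (fun _ _ _ => .inl ⟨_, _, rfl⟩)
    (by simp)
  have hv : v = W r.addr f := h5 r f .read (by simp [Call.target, hp, Val.ref?]) rfl
  refine ⟨j + 1, by omega, fun l hl => h.solo l (by omega), ⟨regs', ?_⟩, h2, ?_, h4⟩
  · rw [h1, hv]
    simp [Integrated.resume, hi, Instr.dst, setVar]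
  · rcases h3 with ⟨-, h3⟩ | ⟨_, _, h3, -⟩
    · rwa [callMem_read] at h3
    · cases h3

theorem Arrives.write {p f x : ℕ} (hi : I.prog.code pc = .write p f x) {r : Ref} {k : ℕ}
    (hp : ρ p = .ptr (some r) k) (hr : r ∈ F) :
    Arrives I s t req u th m (.body o (pc + 1)) st ρ
      (Function.update W r.addr (Function.update (W r.addr) f (ρ x))) F K := by
  obtain ⟨i, hi', h⟩ := h
  obtain ⟨regs, hthr⟩ := h.thr
  have htgt : (Call.write (ρ p) f (ρ x)).target = some (r, f) := by
    simp [Call.target, hp, Val.ref?]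
  obtain ⟨j, v, regs', hj, h1, h2, h3, h4, -, -⟩ := h.issue hI hut (a := .write (ρ p) f (ρ x))
    (by simp) (by simp [step_body hthr, Integrated.bodyStep, hi, hthr])
    (fun q g hq => .inr (by rw [htgt] at hq; cases hq; exact hr)) (by simp)
  refine ⟨j + 1, by omega, fun l hl => h.solo l (by omega), ⟨regs', ?_⟩, h2, ?_, h4⟩
  · rw [h1]
    simp [Integrated.resume, hi, Instr.dst, setVar]
  · rcases h3 with ⟨-, h3⟩ | ⟨_, _, h3, -⟩
    · simpa [callMem, htgt, Call.wordOp, wordSpec, callActive] using h3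
    · cases h3

theorem Arrives.cas {d p f e n : ℕ} (hi : I.prog.code pc = .cas d p f e n) {r : Ref} {k : ℕ}
    (hp : ρ p = .ptr (some r) k) (hr : r ∈ F) (he : (W r.addr f).same (ρ e) = true) :
    Arrives I s t req u th m (.body o (pc + 1)) st (Function.update ρ d (.bool true))
      (Function.update W r.addr (Function.update (W r.addr) f (ρ n))) F K := by
  obtain ⟨i, hi', h⟩ := h
  obtain ⟨regs, hthr⟩ := h.thr
  have htgt : (Call.cas (ρ p) f (ρ e) (ρ n)).target = some (r, f) := by
    simp [Call.target, hp, Val.ref?]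
  obtain ⟨j, v, regs', hj, h1, h2, h3, h4, h5, -⟩ := h.issue hI hut
    (a := .cas (ρ p) f (ρ e) (ρ n))
    (by simp) (by simp [step_body hthr, Integrated.bodyStep, hi, hthr])
    (fun q g hq => .inr (by rw [htgt] at hq; cases hq; exact hr)) (by simp)
  have hv : v = .bool true := by rw [h5 r f _ htgt rfl]; simp [wordSpec, he]
  refine ⟨j + 1, by omega, fun l hl => h.solo l (by omega), ⟨regs', ?_⟩, h2, ?_, h4⟩
  · rw [h1, hv]
    simp [Integrated.resume, hi, Instr.dst, setVar]
  · rcases h3 with ⟨-, h3⟩ | ⟨_, _, h3, -⟩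
    · simpa [callMem, htgt, Call.wordOp, wordSpec, he, callActive] using h3
    · cases h3

theorem Arrives.alloc {d : ℕ} {g : ℕ → Option Var} (hi : I.prog.code pc = .alloc d g)
    (hF : F.card ≤ 3) : ∃ r, Fresh F K r ∧
      Arrives I s t req u th m (.body o (pc + 1)) st (Function.update ρ d (.ptr (some r) 0))
        (Function.update W r.addr fun f => ((g f).map ρ).getD .null) (insert r F) K := by
  obtain ⟨i, hi', h⟩ := h
  obtain ⟨regs, hthr⟩ := h.thr
  obtain ⟨j, v, regs', hj, h1, h2, h3, h4, -, -⟩ := h.issue hI hut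
    (a := .alloc fun f => ((g f).map ρ).getD .null)
    (by simp) (by simp [step_body hthr, Integrated.bodyStep, hi, hthr])
    (fun q g hq => by cases hq) (fun _ _ => hF)
  rcases h3 with ⟨h3, -⟩ | ⟨init, r, h3, h6, h7, h8⟩
  · exact absurd rfl (h3 _)
  · cases h3
    refine ⟨r, h7, j + 1, by omega, fun l hl => h.solo l (by omega), ⟨regs', ?_⟩, h2, h8, h4⟩
    rw [h1, h6]
    simp [Integrated.resume, hi, Instr.dst, setVar]

theorem Arrives.retire {p : ℕ} (hi : I.prog.code pc = .retire p) {r : Ref} {k : ℕ}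
    (hp : ρ p = .ptr (some r) k) (hr : r ∈ F) :
    Arrives I s t req u th m (.body o (pc + 1)) st ρ W (F.erase r)
      (insert (r, W r.addr 1) K) := by
  obtain ⟨i, hi', h⟩ := h
  obtain ⟨regs, hthr⟩ := h.thr
  obtain ⟨j, v, regs', hj, h1, h2, h3, h4, -, -⟩ := h.issue hI hut
    (a := .retire (ρ p))
    (by simp) (by simp [step_body hthr, Integrated.bodyStep, hi, hthr])
    (fun q g hq => by cases hq) (by simp)
  refine ⟨j + 1, by omega, fun l hl => h.solo l (by omega), ⟨regs', ?_⟩, h2, ?_, h4⟩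
  · rw [h1]
    simp [Integrated.resume, hi, Instr.dst, setVar]
  · rcases h3 with ⟨-, h3⟩ | ⟨_, _, h3, -⟩
    · have h5 : callActive F (.retire (ρ p)) = F.erase r := by rw [hp]; rfl
      rw [h5] at h3
      have h6 : callMem W (.retire (ρ p)) = W := rfl
      rw [h6] at h3
      refine ⟨h3.sane, h3.mem, h3.active, h3.card, h3.bound, ?_⟩
      rintro x (rfl | hx)
      · refine ⟨Finset.notMem_erase _ _, ?_, fun _ => rfl⟩
        have h7 := h.snap.sane.id_lt r.addr
        rw [((h.snap.active r).2 hr).1] at h7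
        exact h7.trans_le (nextId_mono (by omega))
      · exact h3.old x hx
    · cases h3

end Instructions

section Operations

variable (hut : u ≠ t) (hI : WellBehaved I)
include hut hI

theorem Arrives.prologue (ks : List ℕ) (h : Arrives I s t req u th m (.pro o ks) st ρ W F K) :
    Arrives I s t req u th m (.body o (I.prog.start o)) st ρ W F K := by
  induction ks with
  | nil =>
    exact h.local (e := .quiet none) hut trivial fun _ _ hthr => by simp [Integrated.step, hthr]
  | cons k ks ih =>
    refine ih ?_
    obtain ⟨i, hi', h⟩ := h
    obtain ⟨regs, hthr⟩ := h.thr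
    obtain ⟨j, v, regs', hj, h1, h2, h3, h4, -, -⟩ := h.issue hI hut (a := .aux k [])
      (by simp) (by simp [Integrated.step, hthr]) (fun q g hq => by cases hq) (by simp)
    refine ⟨j + 1, by omega, fun l hl => h.solo l (by omega), ⟨regs', ?_⟩, h2, ?_, h4⟩
    · rw [h1]; rfl
    · rcases h3 with ⟨-, h3⟩ | ⟨_, _, h3, -⟩
      · exact h3
      · cases h3

theorem Arrives.epilogue (ks : List ℕ) {v : Val}
    (h : Arrives I s t req u th m (.epi o ks v) st ρ W F K) :
    Arrives I s t req u th m .idle st ρ W F K := by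
  induction ks with
  | nil =>
    exact h.local (e := .opRes v) hut trivial fun _ _ hthr => by simp [Integrated.step, hthr]
  | cons k ks ih =>
    refine ih ?_
    obtain ⟨i, hi', h⟩ := h
    obtain ⟨regs, hthr⟩ := h.thr
    obtain ⟨j, v, regs', hj, h1, h2, h3, h4, -, -⟩ := h.issue hI hut (a := .aux k [])
      (by simp) (by simp [Integrated.step, hthr]) (fun q g hq => by cases hq) (by simp)
    refine ⟨j + 1, by omega, fun l hl => h.solo l (by omega), ⟨regs', ?_⟩, h2, ?_, h4⟩
    · rw [h1]; rfl
    · rcases h3 with ⟨-, h3⟩ | ⟨_, _, h3, -⟩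
      · exact h3
      · cases h3

theorem Arrives.invoke (h : Arrives I s t req u th m .idle st ρ W F K) :
    Arrives I s t req u th m (.body req.1 (I.prog.start req.1)) []
      (Function.update (fun _ => .null) 0 (.key ((req.2 : WithTop ℤ) : Key))) W F K :=
  Arrives.prologue hut hI (I.pro req.1) <|
    h.local (e := .opInv req.1 req.2) hut trivial fun _ _ hthr => by
      simp [Integrated.step, hthr]

end Operations

end SoloRuns

/-! ### Operations of Harris's list on short lists -/

theorem update_field_of_ne {W : ℕ → ℕ → Val} {a b f g : ℕ} {v : Val} (h : f ≠ g ∨ a ≠ b) :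
    Function.update W b (Function.update (W b) g v) a f = W a f := by
  by_cases hab : a = b
  · subst hab
    rw [Function.update_self, Function.update_of_ne (h.resolve_right (not_not.2 rfl))]
  · rw [Function.update_of_ne hab]

section ShortLists

variable {N : ℕ} {A : Scheme.Obj N} {pro epi : SetOp → List ℕ} {s : Schedule N} {t u : Fin N}
  {req : SetOp × ℤ} {m : ℕ} {st : List ℕ} {ρ : Var → Val} {W : ℕ → ℕ → Val} {F : Finset Ref}
  {K : Set (Ref × Val)} {o : SetOp}

/-- Harris's list with the scheme `A` inserted into it. -/
noncomputable abbrev withHarris (A : Scheme.Obj N) (pro epi : SetOp → List ℕ) : Integrated N :=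
  A.insertInto pro epi harris

variable {th : Thread (withHarris A pro epi).obj} (hut : u ≠ t)
  (hI : WellBehaved (withHarris A pro epi))
include hut hI

/-- The beginning of a search. -/
theorem search_start
    (h : Arrives (withHarris A pro epi) s t req u th m (.body o 0) st ρ W F K) {c : Ref}
    (hc : W 0 1 = .ptr (some c) 0) :
    ∃ ρ', Arrives (withHarris A pro epi) s t req u th m (.body o 4) st ρ' W F K ∧
      ρ' 1 = .ptr (some ⟨0, 0⟩) 0 ∧ ρ' 2 = .ptr (some c) 0 ∧ ρ' 3 = .ptr (some c) 0 ∧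
      ρ' 4 = W c.addr 1 ∧ ∀ v : ℕ, v = 0 ∨ 6 < v → ρ' v = ρ v := by
  have h1 := h.global (d := 1) (g := 0) hut rfl
  have h2 := h1.read (d := 2) (p := 1) (f := 1) (r := ⟨0, 0⟩) (k := 0) hut hI rfl rfl
  have h3 := h2.move (d := 3) (x := 2) hut rfl
  have h4 := h3.read (d := 4) (p := 3) (f := 1) (r := c) (k := 0) hut hI rfl (by simp [hc])
  refine ⟨_, h4, by simp; rfl, by simp [hc], by simp [hc], by simp, fun v hv => ?_⟩
  rw [Function.update_of_ne (show v ≠ (4 : ℕ) by omega),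
    Function.update_of_ne (show v ≠ (3 : ℕ) by omega),
    Function.update_of_ne (show v ≠ (2 : ℕ) by omega),
    Function.update_of_ne (show v ≠ (1 : ℕ) by omega)]

/-- The end of a search, when the right end of the window directly follows the left end. -/
theorem search_end
    (h : Arrives (withHarris A pro epi) s t req u th m (.body o 15) st ρ W F K) {c : Ref}
    (h2 : ρ 2 = .ptr (some c) 0) (h3 : ρ 3 = .ptr (some c) 0) (hm : (W c.addr 1).mark = 0) :
    ∃ ρ', Arrives (withHarris A pro epi) s t req u th m (.body o (st.headD 0)) st.tail ρ' W F K ∧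
      ∀ v : ℕ, v ≠ 5 → ρ' v = ρ v := by
  have h4 := h.noJump hut rfl (by simp [Cond.eval, Harris.vPredNext, Harris.vCurr, h2, h3, Val.same])
  have h5 := h4.read (d := 5) (p := 3) (f := 1) hut hI rfl h3
  have h6 := h5.noJump hut rfl (by
    simp [Cond.eval, Harris.isMarked, Harris.vTmp, hm])
  exact ⟨_, h6.return hut rfl, fun v hv => Function.update_of_ne hv _ _⟩

/-- The traversal of a search stops at a node whose key is not too small. -/
theorem search_stop
    (h : Arrives (withHarris A pro epi) s t req u th m (.body o 4) st ρ W F K) {c : Ref} {k kc : Key}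
    (h0 : ρ 0 = .key k) (h3 : ρ 3 = .ptr (some c) 0) (h4 : ρ 4 = W c.addr 1)
    (hm : (W c.addr 1).mark = 0) (hkc : W c.addr 0 = .key kc) (hk : ¬ kc < k) :
    ∃ ρ', Arrives (withHarris A pro epi) s t req u th m (.body o 15) st ρ' W F K ∧
      ∀ v : ℕ, v ≠ 5 → ρ' v = ρ v := by
  have h5 := h.noJump hut rfl (by simp [Cond.eval, Harris.isMarked, Harris.vCurrNext, h4, hm])
  have h6 := h5.read (d := 5) (p := 3) (f := 0) hut hI rfl h3
  have h7 := h6.jump hut rfl (by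
    simp [Cond.eval, Harris.keyLt, Harris.vTmp, Harris.vKey, h0, hkc, Val.toKey, not_lt.1 hk])
  exact ⟨_, h7, fun v hv => Function.update_of_ne hv _ _⟩

/-- A search for a key that is not greater than the first key of the list. -/
theorem search_first
    (h : Arrives (withHarris A pro epi) s t req u th m (.body o 0) st ρ W F K) {c : Ref} {k kc : Key}
    (h0 : ρ 0 = .key k) (hc : W 0 1 = .ptr (some c) 0)
    (hm : (W c.addr 1).mark = 0) (hkc : W c.addr 0 = .key kc) (hk : ¬ kc < k) :
    ∃ ρ', Arrives (withHarris A pro epi) s t req u th m (.body o (st.headD 0)) st.tail ρ' W F K ∧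
      ρ' 1 = .ptr (some ⟨0, 0⟩) 0 ∧ ρ' 3 = .ptr (some c) 0 ∧ ∀ v : ℕ, v = 0 ∨ 6 < v → ρ' v = ρ v := by
  obtain ⟨ρ1, h1, p1, p2, p3, p4, q1⟩ := search_start hut hI h hc
  obtain ⟨ρ2, h2, q2⟩ := search_stop hut hI h1 (by rw [q1 0 (.inl rfl), h0]) p3 p4 hm hkc hk
  obtain ⟨ρ3, h3, q3⟩ := search_end hut hI h2 (by rw [q2 2 (by decide), p2])
    (by rw [q2 3 (by decide), p3]) hm
  refine ⟨ρ3, h3, ?_, ?_, fun v hv => ?_⟩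
  · rw [q3 1 (by decide), q2 1 (by decide), p1]
  · rw [q3 3 (by decide), q2 3 (by decide), p3]
  · rw [q3 v (by omega), q2 v (by omega), q1 v hv]

/-- A search for a key that is greater than the only key of the list. -/
theorem search_second
    (h : Arrives (withHarris A pro epi) s t req u th m (.body o 0) st ρ W F K) {n : Ref}
    {k kn : Key} (h0 : ρ 0 = .key k) (hn : W 0 1 = .ptr (some n) 0)
    (hkn : W n.addr 0 = .key kn) (hk : kn < k) (hc : W n.addr 1 = .ptr (some ⟨1, 1⟩) 0)
    (hm : (W 1 1).mark = 0) :
    ∃ ρ', Arrives (withHarris A pro epi) s t req u th m (.body o (st.headD 0)) st.tail ρ' W F K ∧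
      ρ' 1 = .ptr (some n) 0 ∧ ρ' 3 = .ptr (some ⟨1, 1⟩) 0 ∧ ∀ v : ℕ, v = 0 ∨ 6 < v → ρ' v = ρ v := by
  obtain ⟨ρ1, h1, p1, p2, p3, p4, q1⟩ := search_start hut hI h hn
  rw [hc] at p4
  have h2 := h1.noJump hut rfl (by simp [Cond.eval, Harris.isMarked, Harris.vCurrNext, p4, Val.mark])
  have h3 := h2.read (d := 5) (p := 3) (f := 0) hut hI rfl p3
  have h4 := h3.noJump hut rfl (by
    simp [Cond.eval, Harris.keyLt, Harris.vTmp, Harris.vKey, q1 0 (.inl rfl), h0, hkn, Val.toKey, hk])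
  have h5 := h4.noJump hut rfl (by
    simp [Cond.eval, Harris.isMarked, Harris.vCurrNext, p4, Val.mark])
  have h6 := h5.move (d := 1) (x := 3) hut rfl
  have h7 := h6.move (d := 2) (x := 4) hut rfl
  have h8 := h7.setMark (d := 3) (x := 4) (k := 0) hut rfl
  have h9 := h8.global (d := 5) (g := 1) hut rfl
  have h10 := h9.jump hut rfl (by
    simp [Cond.eval, Harris.vCurr, Harris.vTmp, p4, Val.setMark]; rfl)
  obtain ⟨ρ2, h11, q2⟩ := search_end hut hI h10 (c := ⟨1, 1⟩) (by simp [p4])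
    (by simp [p4, Val.setMark]) hm
  refine ⟨ρ2, h11, ?_, ?_, fun v hv => ?_⟩
  · rw [q2 1 (by decide)]; simp [p3]
  · rw [q2 3 (by decide)]; simp [p4, Val.setMark]
  · rw [q2 v (by omega), ← q1 v hv]
    rw [Function.update_of_ne (show v ≠ (5 : ℕ) by omega),
      Function.update_of_ne (show v ≠ (3 : ℕ) by omega),
      Function.update_of_ne (show v ≠ (2 : ℕ) by omega),
      Function.update_of_ne (show v ≠ (1 : ℕ) by omega),
      Function.update_of_ne (show v ≠ (5 : ℕ) by omega)]

/-- An insertion links the new node `n` between `p` and the tail. -/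
theorem insert_end
    (h : Arrives (withHarris A pro epi) s t req u th m (.body o 35) st ρ W F K) {p n : Ref} {k : ℤ}
    (h0 : ρ 0 = .key (k : WithTop ℤ)) (h1 : ρ 1 = .ptr (some p) 0) (h3 : ρ 3 = .ptr (some ⟨1, 1⟩) 0)
    (h7 : ρ 7 = .ptr (some n) 0) (hp : p ∈ F) (hn : n ∈ F) (hpn : p.addr ≠ n.addr)
    (hk : W 1 0 = .key ⊤) (hW : W p.addr 1 = .ptr (some ⟨1, 1⟩) 0) :
    ∃ ρ' W', Arrives (withHarris A pro epi) s t req u th m .idle st ρ' W' F K ∧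
      W' p.addr 1 = .ptr (some n) 0 ∧ W' n.addr 1 = .ptr (some ⟨1, 1⟩) 0 ∧
      ∀ a f, f ≠ 1 ∨ (a ≠ p.addr ∧ a ≠ n.addr) → W' a f = W a f := by
  have h4 := h.read (d := 5) (p := 3) (f := 0) hut hI rfl h3
  have h5 := h4.jump hut rfl (by
    simp [Cond.eval, Harris.keyEq, Harris.vTmp, Harris.vKey, h0, hk, Val.toKey])
  have h6 := h5.write (p := 7) (f := 1) (x := 3) hut hI rfl
    (by rw [Function.update_of_ne (by decide)]; exact h7) hn
  have h8 := h6.cas (d := 6) (p := 1) (f := 1) (e := 3) (n := 7) hut hI rfl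
    (by rw [Function.update_of_ne (by decide)]; exact h1) hp
    (by simp [Function.update_of_ne hpn, hW, h3, Val.same])
  have h9 := h8.noJump hut rfl (by simp [Cond.eval, Harris.vFlag, Val.isTrue])
  have h10 := Arrives.epilogue hut hI _ (h9.ret hut rfl)
  refine ⟨_, _, h10, by simp [h7], by simp [Function.update_of_ne hpn.symm, h3], fun a f haf => ?_⟩
  rw [update_field_of_ne (haf.imp_right fun h => h.1),
    update_field_of_ne (haf.imp_right fun h => h.2)]

/-- The first instructions of an insertion. -/
theorem insert_begin {k : ℤ}
    (h : Arrives (withHarris A pro epi) s t (.insert, k) u th m .idle st ρ W F K) (hF : F.card ≤ 3) :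
    ∃ n ρ', Fresh F K n ∧ Arrives (withHarris A pro epi) s t (.insert, k) u th m (.body .insert 0)
      [35] ρ' (Function.update W n.addr fun f => if f = 0 then .key (k : WithTop ℤ) else .null)
      (insert n F) K ∧ ρ' 0 = .key (k : WithTop ℤ) ∧ ρ' 7 = .ptr (some n) 0 := by
  obtain ⟨n, hn, h1⟩ := (Arrives.invoke hut hI h).alloc (d := 7)
    (g := fun f => if f = 0 then some 0 else none) hut hI rfl hF
  have h2 := h1.call (q := 0) hut rfl
  have hf : (fun f => ((if f = 0 then some 0 else none : Option Var).map
      (Function.update (fun _ => .null) 0 (.key ((k : WithTop ℤ) : Key)))).getD .null) =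
      fun f => if f = 0 then Val.key (k : WithTop ℤ) else .null := by
    ext f
    split <;> simp
  rw [hf] at h2
  exact ⟨n, _, hn, h2, by simp, by simp⟩

/-- An insertion into the empty list. -/
theorem insert_first {k : ℤ}
    (h : Arrives (withHarris A pro epi) s t (.insert, k) u th m .idle st ρ W F K) (hF : F.card ≤ 3)
    (h0 : ⟨0, 0⟩ ∈ F) (h1 : ⟨1, 1⟩ ∈ F) (hW : W 0 1 = .ptr (some ⟨1, 1⟩) 0)
    (hk : W 1 0 = .key ⊤) (hm : W 1 1 = .null) :
    ∃ n st' ρ' W', Fresh F K n ∧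
      Arrives (withHarris A pro epi) s t (.insert, k) u th m .idle st' ρ' W' (insert n F) K ∧
      W' 0 1 = .ptr (some n) 0 ∧ W' n.addr 0 = .key (k : WithTop ℤ) ∧
      W' n.addr 1 = .ptr (some ⟨1, 1⟩) 0 ∧ W' 1 0 = .key ⊤ ∧ W' 1 1 = .null := by
  obtain ⟨n, ρ1, hn, h2, p0, p7⟩ := insert_begin hut hI h hF
  have hn0 : 0 ≠ n.addr := hn.1 _ h0
  have hn1 : 1 ≠ n.addr := hn.1 _ h1
  obtain ⟨ρ2, h3, q1, q3, q⟩ := search_first hut hI h2 (c := ⟨1, 1⟩) (kc := ⊤) p0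
    (by rw [Function.update_of_ne hn0]; exact hW)
    (by rw [Function.update_of_ne hn1, hm]; rfl) (by rw [Function.update_of_ne hn1]; exact hk)
    not_top_lt
  obtain ⟨ρ3, W', h4, w1, w2, w3⟩ := insert_end hut hI h3 (p := ⟨0, 0⟩) (n := n) (k := k)
    (by rw [q 0 (.inl rfl), p0]) q1 q3 (by rw [q 7 (by omega), p7])
    (Finset.mem_insert_of_mem h0) (Finset.mem_insert_self _ _) hn0
    (by rw [Function.update_of_ne hn1]; exact hk) (by rw [Function.update_of_ne hn0]; exact hW)
  refine ⟨n, _, ρ3, W', hn, h4, w1, ?_, w2, ?_, ?_⟩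
  · rw [w3 _ _ (.inl (by decide))]; simp
  · rw [w3 _ _ (.inl (by decide)), Function.update_of_ne hn1, hk]
  · rw [w3 _ _ (.inr ⟨by decide, hn1⟩), Function.update_of_ne hn1, hm]

/-- An insertion at the end of a list with one node. -/
theorem insert_second {k k' : ℤ} (hkk : k < k')
    (h : Arrives (withHarris A pro epi) s t (.insert, k') u th m .idle st ρ W F K) (hF : F.card ≤ 3)
    {n : Ref} (h0 : ⟨0, 0⟩ ∈ F) (h1 : ⟨1, 1⟩ ∈ F) (hnF : n ∈ F) (hn1 : n.addr ≠ 1)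
    (hn0 : n.addr ≠ 0)
    (hW : W 0 1 = .ptr (some n) 0) (hkn : W n.addr 0 = .key (k : WithTop ℤ))
    (hWn : W n.addr 1 = .ptr (some ⟨1, 1⟩) 0)
    (hk : W 1 0 = .key ⊤) (hm : W 1 1 = .null) :
    ∃ n' st' ρ' W', Fresh F K n' ∧
      Arrives (withHarris A pro epi) s t (.insert, k') u th m .idle st' ρ' W' (insert n' F) K ∧
      W' 0 1 = .ptr (some n) 0 ∧ W' n.addr 0 = .key (k : WithTop ℤ) ∧
      W' n.addr 1 = .ptr (some n') 0 ∧ W' n'.addr 0 = .key (k' : WithTop ℤ) ∧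
      W' n'.addr 1 = .ptr (some ⟨1, 1⟩) 0 ∧ W' 1 0 = .key ⊤ ∧ W' 1 1 = .null := by
  obtain ⟨n', ρ1, hn', h2, p0, p7⟩ := insert_begin hut hI h hF
  have e0 : 0 ≠ n'.addr := hn'.1 _ h0
  have e1 : 1 ≠ n'.addr := hn'.1 _ h1
  have en : n.addr ≠ n'.addr := hn'.1 _ hnF
  obtain ⟨ρ2, h3, q1, q3, q⟩ := search_second hut hI h2 (n := n) (kn := (k : WithTop ℤ)) p0
    (by rw [Function.update_of_ne e0]; exact hW)
    (by rw [Function.update_of_ne en]; exact hkn) (by exact_mod_cast hkk)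
    (by rw [Function.update_of_ne en]; exact hWn)
    (by rw [Function.update_of_ne e1, hm]; rfl)
  obtain ⟨ρ3, W', h4, w1, w2, w3⟩ := insert_end hut hI h3 (p := n) (n := n') (k := k')
    (by rw [q 0 (.inl rfl), p0]) q1 q3 (by rw [q 7 (by omega), p7])
    (Finset.mem_insert_of_mem hnF) (Finset.mem_insert_self _ _) en
    (by rw [Function.update_of_ne e1]; exact hk) (by rw [Function.update_of_ne en]; exact hWn)
  refine ⟨n', _, ρ3, W', hn', h4, ?_, ?_, w1, ?_, w2, ?_, ?_⟩
  · rw [w3 _ _ (.inr ⟨hn0.symm, e0⟩), Function.update_of_ne e0, hW]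
  · rw [w3 _ _ (.inl (by decide)), Function.update_of_ne en, hkn]
  · rw [w3 _ _ (.inl (by decide))]; simp
  · rw [w3 _ _ (.inl (by decide)), Function.update_of_ne e1, hk]
  · rw [w3 _ _ (.inr ⟨hn1.symm, e1⟩), Function.update_of_ne e1, hm]

/-- A deletion of the first node. -/
theorem delete_first {k : ℤ}
    (h : Arrives (withHarris A pro epi) s t (.delete, k) u th m .idle st ρ W F K)
    {n n' : Ref} (h0 : ⟨0, 0⟩ ∈ F) (hnF : n ∈ F) (hn0 : n.addr ≠ 0)
    (hW : W 0 1 = .ptr (some n) 0) (hkn : W n.addr 0 = .key (k : WithTop ℤ))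
    (hWn : W n.addr 1 = .ptr (some n') 0) :
    ∃ st' ρ' W', Arrives (withHarris A pro epi) s t (.delete, k) u th m .idle st' ρ' W' (F.erase n)
        (insert (n, .ptr (some n') 1) K) ∧
      W' 0 1 = .ptr (some n') 0 ∧ ∀ a f, f ≠ 1 ∨ (a ≠ 0 ∧ a ≠ n.addr) → W' a f = W a f := by
  have h1 := (Arrives.invoke hut hI h).call (q := 0) hut rfl
  obtain ⟨ρ1, h2, p1, p3, p0⟩ := search_first hut hI h1 (c := n) (k := (k : WithTop ℤ))
    (kc := (k : WithTop ℤ)) (by simp) hW (by rw [hWn]; rfl) hkn (lt_irrefl _)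
  replace p0 := p0 0 (.inl rfl)
  rw [Function.update_self] at p0
  have h3 := h2.read (d := 5) (p := 3) (f := 0) hut hI rfl p3
  have h4 := h3.noJump hut rfl (by
    simp [Cond.eval, Harris.keyEq, Harris.vTmp, Harris.vKey, p0, hkn, Val.toKey])
  have h5 := h4.read (d := 8) (p := 3) (f := 1) (r := n) (k := 0) hut hI rfl (by simp [p3])
  have h6 := h5.setMark (d := 8) (x := 8) (k := 0) hut rfl
  have h7 := h6.setMark (d := 9) (x := 8) (k := 1) hut rfl
  have h8 := h7.cas (d := 6) (p := 3) (f := 1) (e := 8) (n := 9) (r := n) (k := 0) hut hI rfl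
    (by simp [p3]) hnF (by simp [hWn, Val.setMark, Val.same])
  have h9 := h8.noJump hut rfl (by simp [Cond.eval, Harris.vFlag, Val.isTrue])
  have h10 := h9.move (d := 10) (x := 3) hut rfl
  have h11 := h10.cas (d := 6) (p := 1) (f := 1) (e := 3) (n := 8) (r := ⟨0, 0⟩) (k := 0) hut hI rfl
    (by simp [p1]) h0 (by simp [Function.update_of_ne hn0.symm, hW, p3, Val.same])
  have h12 := h11.jump hut rfl (by simp [Cond.eval, Harris.vFlag, Val.isTrue])
  have h13 := h12.retire (p := 10) (r := n) (k := 0) hut hI rfl (by simp [p3]) hnF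
  have h14 := h13.bool (d := 6) hut rfl
  have h15 := Arrives.epilogue hut hI _ (h14.ret hut rfl)
  have hgoal : ∀ st' ρ' (W' : ℕ → ℕ → Val),
      Arrives (withHarris A pro epi) s t (.delete, k) u th m .idle st' ρ' W' (F.erase n)
        (insert (n, W' n.addr 1) K) → W' n.addr 1 = .ptr (some n') 1 →
      W' 0 1 = .ptr (some n') 0 → (∀ a f, f ≠ 1 ∨ (a ≠ 0 ∧ a ≠ n.addr) → W' a f = W a f) →
      ∃ st' ρ' W', Arrives (withHarris A pro epi) s t (.delete, k) u th m .idle st' ρ' W'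
          (F.erase n) (insert (n, .ptr (some n') 1) K) ∧
        W' 0 1 = .ptr (some n') 0 ∧ ∀ a f, f ≠ 1 ∨ (a ≠ 0 ∧ a ≠ n.addr) → W' a f = W a f := by
    intro st' ρ' W' g1 g2 g3 g4
    rw [g2] at g1
    exact ⟨st', ρ', W', g1, g3, g4⟩
  refine hgoal _ _ _ h15 ?_ ?_ ?_
  · rw [Function.update_of_ne hn0, Function.update_self, Function.update_self]
    simp [hWn, Val.setMark]
  · rw [Function.update_self, Function.update_self]
    simp [hWn, Val.setMark]
  · intro a f haf
    rw [update_field_of_ne (haf.imp_right fun h => h.1),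
      update_field_of_ne (haf.imp_right fun h => h.2)]

/-- The beginning of a membership test. -/
theorem contains_begin {k : ℤ}
    (h : Arrives (withHarris A pro epi) s t (.contains, k) u th m .idle st ρ W F K) :
    ∃ ρ', Arrives (withHarris A pro epi) s t (.contains, k) u th m (.body .contains 2) [25] ρ' W F K ∧
      ρ' 2 = W 0 1 := by
  have h1 := (Arrives.invoke hut hI h).call (q := 0) hut rfl
  have h2 := h1.global (d := 1) (g := 0) hut rfl
  have h3 := h2.read (d := 2) (p := 1) (f := 1) (r := ⟨0, 0⟩) (k := 0) hut hI rfl rfl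
  exact ⟨_, h3, by simp⟩

end ShortLists

/-! ### Extending finite executions -/

section Extensions

variable {N : ℕ} {I : Integrated N} {s s' : Schedule N} {i : ℕ}

theorem conf_congr (h : ∀ l < i, s l = s' l) : ∀ l ≤ i, I.conf s l = I.conf s' l := by
  intro l
  induction l with
  | zero => exact fun _ => rfl
  | succ l ih => intro hl; rw [Integrated.conf, Integrated.conf, ih (by omega), h l hl]

theorem event_congr (h : ∀ l < i, s l = s' l) {l : ℕ} (hl : l < i) :
    I.event s l = I.event s' l := by
  rw [Integrated.event, Integrated.event, conf_congr h l hl.le, h l hl]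

theorem wordMem_congr (h : ∀ l < i, s l = s' l) : ∀ l ≤ i, I.wordMem s l = I.wordMem s' l := by
  intro l
  induction l with
  | zero => exact fun _ => rfl
  | succ l ih =>
    intro hl
    rw [Integrated.wordMem, Integrated.wordMem, ih (by omega), event_congr h hl]

theorem Integrated.Settled.congr (h : ∀ l < i, s l = s' l) (hset : I.Settled s i) :
    I.Settled s' i := by
  intro k a hk ha ht
  rw [← event_congr h hk] at ha
  obtain ⟨j, v, hj, ⟨c, d, h1, h2, h3, h4, h5⟩, h6⟩ := hset k a hk ha ht
  refine ⟨j, v, hj, ⟨c, d, ?_, h2, ?_, ?_, fun l hl1 hl2 hl3 => ?_⟩, fun l hl1 hl2 x f o hw => ?_⟩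
  · rw [← event_congr h hk, h1]
  · rw [← h j hj, ← h k hk, h3]
  · rw [← event_congr h hj, h4]
  · rw [← event_congr h (hl2.trans hj)]
    exact h5 l hl1 hl2 (by rw [h l (hl2.trans hj), h k hk, hl3])
  · refine h6 l hl1 hl2 x f o ?_
    simp only [Integrated.WordInv, Integrated.Issued, Integrated.NewNode] at hw ⊢
    rwa [event_congr h (by omega : l < i)]

theorem Snap.congr {W : ℕ → ℕ → Val} {F : Finset Ref} {K : Set (Ref × Val)}
    (h : ∀ l < i, s l = s' l) (hsnap : Snap I s i W F K) : Snap I s' i W F K where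
  sane := conf_congr (I := I) h i le_rfl ▸ hsnap.sane
  mem := by rw [← wordMem_congr h i le_rfl, hsnap.mem]
  active := conf_congr (I := I) h i le_rfl ▸ hsnap.active
  card := hsnap.card
  bound l hl := conf_congr (I := I) h l hl ▸ hsnap.bound l hl
  old := conf_congr (I := I) h i le_rfl ▸ hsnap.old

/-- The schedule `s` up to step `i`; then `t` runs alone. -/
def Schedule.thenSolo (s : Schedule N) (i : ℕ) (t : Fin N) (req : SetOp × ℤ) : Schedule N :=
  fun l => if l < i then s l else (t, req)

theorem thenSolo_eq (s : Schedule N) (i : ℕ) (t : Fin N) (req : SetOp × ℤ) {l : ℕ} (hl : l < i) :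
    s l = s.thenSolo i t req l := (if_pos hl).symm

variable {t u : Fin N} {req : SetOp × ℤ} {ctrl : Ctrl} {st : List ℕ} {ρ : Var → Val}
  {W : ℕ → ℕ → Val} {F : Finset Ref} {K : Set (Ref × Val)}

theorem At.newRequest {th : Thread I.obj} (h : At I s t req u th i ctrl st ρ W F K)
    (req' : SetOp × ℤ) : At I (s.thenSolo i t req') t req' u th i ctrl st ρ W F K where
  solo _ hl := if_neg (not_lt.2 hl)
  thr := conf_congr (I := I) (fun _ => thenSolo_eq s i t req') i le_rfl ▸ h.thr
  other := conf_congr (I := I) (fun _ => thenSolo_eq s i t req') i le_rfl ▸ h.other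
  snap := h.snap.congr fun _ => thenSolo_eq s i t req'
  settled := h.settled.congr fun _ => thenSolo_eq s i t req'

/-- The other thread takes over. -/
theorem At.switch {ctrl' : Ctrl} {st' : List ℕ} {ρ' : Var → Val} {regs' : I.obj.Reg → I.obj.Word}
    (h : At I s t req u ⟨ctrl', st', ρ', none, regs'⟩ i ctrl st ρ W F K) (req' : SetOp × ℤ) :
    ∃ regs, At I (s.thenSolo i u req') u req' t ⟨ctrl, st, ρ, none, regs⟩ i ctrl' st' ρ' W F K := by
  obtain ⟨regs, hregs⟩ := h.thr
  have hc := conf_congr (I := I) (fun _ => thenSolo_eq s i u req') i le_rfl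
  exact ⟨regs, fun l hl => if_neg (not_lt.2 hl), ⟨regs', hc ▸ h.other⟩, hc ▸ hregs,
    h.snap.congr fun _ => thenSolo_eq s i u req', h.settled.congr fun _ => thenSolo_eq s i u req'⟩

/-- A reference is valid if what is read through it gets used by the next instruction, or by the
target of a jump that comes next. -/
theorem At.valid_of_read {th : Thread I.obj} {o : SetOp} {pc d p f k : ℕ} {r : Ref}
    (h : At I s t req u th i (.body o pc) st ρ W F K) (hI : WellBehaved I) (hut : u ≠ t)
    (hi : I.prog.code pc = .read d p f) (hp : ρ p = .ptr (some r) k)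
    (huse : d ∈ (I.prog.code (pc + 1)).uses ∨
      ∃ q, I.prog.code (pc + 1) = .goto q ∧ d ∈ (I.prog.code q).uses) :
    (I.conf s i).Valid r := by
  by_contra hv
  obtain ⟨regs, hthr⟩ := h.thr
  obtain ⟨j, v, regs', hj, h1, -, -, -, -, h6⟩ := h.issue hI hut (a := .read (ρ p) f) (by simp)
    (by simp [step_body hthr, Integrated.bodyStep, hi, hthr]) (fun _ _ _ => .inl ⟨_, _, rfl⟩)
    (by simp)
  have ht : ∀ l, i ≤ l → (s l).1 = t := fun l hl => by rw [h.solo l hl]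
  have hres : I.resume ⟨.body o pc, st, ρ, none, regs'⟩ v =
      (⟨.body o (pc + 1), st, Function.update ρ d v, none, regs'⟩, some d) := by
    simp [Integrated.resume, hi, Instr.dst, setVar]
  rw [hres] at h1 h6
  have hnever : I.NeverUsed s t d j := by
    have hsafe := hI.safe s i
    rw [ht i le_rfl] at hsafe
    rcases h6 with ⟨rfl, h6⟩ | ⟨h6, h7, h8⟩
    · exact (hsafe.1 _ _ _ r f h6 (by simp [Call.target, hp, Val.ref?]) hv).2 ⟨_, rfl⟩ d rfl
    · exact hsafe.2.1 _ r f j v _ h6 (by simp [hp, Val.ref?]) hv h7 h8 d rfl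
  rcases huse with huse | ⟨q, hq, huse⟩
  · obtain ⟨k, h2, h3, -⟩ := hnever (j + 1) (Nat.lt_succ_self j)
      ⟨ht _ (by omega), _, by simp [Integrated.instr, Integrated.thread, ht (j + 1) (by omega), h1,
        Integrated.curInstr], huse⟩
    omega
  · have hstep := step_goto (req := req) h1 hq
    have he : I.event s (j + 1) = .quiet none := by
      rw [Integrated.event, h.solo (j + 1) (by omega), hstep]
    have h2 : (I.conf s (j + 1 + 1)).thr t = ⟨.body o q, st, Function.update ρ d v, none, regs'⟩ := by
      rw [Integrated.conf, h.solo (j + 1) (by omega), hstep]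
      exact Function.update_self _ _ _
    obtain ⟨k, h3, h4, -, h5⟩ := hnever (j + 2) (by omega)
      ⟨ht _ (by omega), _, by simp [Integrated.instr, Integrated.thread, ht (j + 2) (by omega), h2,
        Integrated.curInstr], huse⟩
    obtain rfl : k = j + 1 := by omega
    rw [he] at h5
    cases h5

end Extensions

/-! ### A reader that is overtaken by insertions and deletions -/

section Adversary

variable {N : ℕ} {A : Scheme.Obj N} {pro epi : SetOp → List ℕ} {s : Schedule N} {t u : Fin N}

/-- The nodes `n 0, …, n (k - 1)` have been deleted, each while it was followed by the next one. -/
def deletedChain (n : ℕ → Ref) (k : ℕ) : Set (Ref × Val) :=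
  {x | ∃ j < k, x = (n j, .ptr (some (n (j + 1))) 1)}

/-- After step `i` of the schedule `s`, the threads `t` and `u` have built a chain of `k` deleted
nodes, the last of which points to the only node `n k` that is in the list: `t` is idle, and `u`
is about to traverse the chain in the course of a membership test, having just read the pointer to
`n 0` from the head. -/
def Stalled (I : Integrated N) (t u : Fin N) (k : ℕ) (s : Schedule N) (i : ℕ) : Prop :=
  ∃ (n : ℕ → Ref) (req : SetOp × ℤ) (ρu : Var → Val) (regs : I.obj.Reg → I.obj.Word)
    (st : List ℕ) (ρ : Var → Val) (W : ℕ → ℕ → Val),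
    At I s t req u ⟨.body .contains 2, [25], ρu, none, regs⟩ i .idle st ρ W
      (insert (n k) {⟨0, 0⟩, ⟨1, 1⟩}) (deletedChain n k) ∧
    ρu 2 = .ptr (some (n 0)) 0 ∧
    W 0 1 = .ptr (some (n k)) 0 ∧ W (n k).addr 0 = .key ((k : ℤ) : WithTop ℤ) ∧
    W (n k).addr 1 = .ptr (some ⟨1, 1⟩) 0 ∧ W 1 0 = .key ⊤ ∧ W 1 1 = .null ∧
    (∀ j ≤ k, (n j).addr ≠ 1) ∧ (n k).addr ≠ 0 ∧ ∀ j ≤ k, ∀ j' ≤ k, n j = n j' → j = j'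

variable (hI : WellBehaved (withHarris A pro epi))
include hI

/-- The thread `t` inserts the node `n 0`; then `u` reads the pointer to it from the head. -/
theorem exists_stalled_zero (htu : t ≠ u) :
    ∃ s i, Stalled (withHarris A pro epi) t u 0 s i := by
  have hinit : At (withHarris A pro epi) (fun _ => (t, .insert, 0)) t (.insert, 0) u
      ⟨.idle, [], fun _ => .null, none, A.regs₀ u⟩ 0 .idle [] (fun _ => .null)
      (fun a f => ((withHarris A pro epi).initial.mem a).fields f) {⟨0, 0⟩, ⟨1, 1⟩} ∅ := by
    have hmem : ∀ a, (withHarris A pro epi).initial.mem a =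
        if a = 0 then ⟨Harris.headNode, A.x₀, 0, .active⟩
        else if a = 1 then ⟨Harris.tailNode, A.x₀, 1, .active⟩
        else ⟨fun _ => .null, A.x₀, 0, .system⟩ := by
      rintro (_ | _ | a) <;> rfl
    have hact : ∀ r, r ∈ (withHarris A pro epi).initial.activeRefs ↔
        r ∈ ({⟨0, 0⟩, ⟨1, 1⟩} : Finset Ref) := by
      rintro ⟨a, b⟩
      simp only [Config.activeRefs, Set.mem_ofPred_eq, hmem]
      split_ifs with h h' <;> simp [*, eq_comm]
    refine ⟨fun _ _ => rfl, ⟨A.regs₀ t, rfl⟩, rfl,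
      ⟨⟨fun a ha => ?_, fun a => ?_⟩, rfl, hact, by decide, ?_, by simp⟩,
      fun k a hk => absurd hk (Nat.not_lt_zero _)⟩
    · have h2 : 2 ≤ a := ha
      change ((withHarris A pro epi).initial.mem a).status = _
      rw [hmem, if_neg (by omega), if_neg (by omega)]
    · change ((withHarris A pro epi).initial.mem a).id < 2
      rw [hmem]
      split_ifs <;> simp
    · intro l hl
      obtain rfl : l = 0 := by omega
      exact (count_active_le fun r hr => (hact r).1 hr).trans (by decide)
  obtain ⟨n, st, ρ, W, hn, ⟨i, -, h1⟩, w1, w2, w3, w4, w5⟩ := insert_first htu.symm hI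
    ⟨0, le_rfl, hinit⟩ (by decide) (by simp) (by simp) rfl rfl rfl
  obtain ⟨regs, h2⟩ := h1.switch (.contains, 0)
  obtain ⟨ρ', ⟨j, -, h3⟩, hρ'⟩ := contains_begin htu hI ⟨i, le_rfl, h2⟩
  obtain ⟨regs', h4⟩ := h3.switch (.insert, 1)
  have hK : deletedChain (fun _ => n) 0 = ∅ := by simp [deletedChain]
  rw [← hK] at h4
  exact ⟨_, j, fun _ => n, _, ρ', regs', st, ρ, W, h4, by rw [hρ', w1], w1, w2, w3, w4, w5,
    fun _ _ => (hn.1 ⟨1, 1⟩ (by simp)).symm, (hn.1 ⟨0, 0⟩ (by simp)).symm, by omega⟩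

/-- A new node is added after the only one in the list, which is then deleted. -/
theorem Stalled.extend (htu : t ≠ u) {k i : ℕ} (h : Stalled (withHarris A pro epi) t u k s i) :
    ∃ s' i', Stalled (withHarris A pro epi) t u (k + 1) s' i' ∧ i < i' ∧ ∀ l < i, s l = s' l := by
  obtain ⟨n, req, ρu, regs, st, ρ, W, h, hρu, w1, w2, w3, w4, w5, hn1, hn0, hinj⟩ := h
  obtain ⟨n', st1, ρ1, W1, hn', ⟨i1, hi1, h1⟩, v1, v2, v3, v4, v5, v6, v7⟩ :=
    insert_second (k := k) (k' := (k + 1 : ℕ)) htu.symm hI (by omega)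
      ⟨i, le_rfl, h.newRequest (.insert, ((k + 1 : ℕ) : ℤ))⟩ Finset.card_le_three
      (by simp) (by simp) (Finset.mem_insert_self _ _) (hn1 k le_rfl) hn0 w1 w2 w3 w4 w5
  obtain ⟨st2, ρ2, W2, ⟨i2, hi2, h2⟩, x1, x2⟩ := delete_first htu.symm hI
    ⟨i1, le_rfl, h1.newRequest (.delete, (k : ℤ))⟩ (by simp) (by simp) hn0 v1 v2 v3
  have e0 : n'.addr ≠ 0 := (hn'.1 ⟨0, 0⟩ (by simp)).symm
  have e1 : n'.addr ≠ 1 := (hn'.1 ⟨1, 1⟩ (by simp)).symm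
  have ek : n'.addr ≠ (n k).addr := (hn'.1 (n k) (by simp)).symm
  have eold : ∀ j ≤ k, n j ≠ n' := by
    intro j hj
    rcases hj.lt_or_eq with hj | rfl
    · exact hn'.2 _ ⟨j, hj, rfl⟩
    · rintro rfl; exact ek rfl
  have hagree : ∀ l < i, s l = Schedule.thenSolo (s.thenSolo i t (.insert, ((k + 1 : ℕ) : ℤ))) i1 t
      (.delete, (k : ℤ)) l := fun l hl => by
    rw [← thenSolo_eq _ i1 _ _ (by omega), ← thenSolo_eq s i _ _ hl]
  have hne : ∀ j ≤ k, Function.update n (k + 1) n' j = n j := fun j hj =>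
    Function.update_of_ne (by omega) _ _
  refine ⟨_, i2, ⟨Function.update n (k + 1) n', (.delete, k), ρu, regs, st2, ρ2, W2, ?_, ?_, ?_, ?_, ?_,
    ?_, ?_, ?_, ?_, ?_⟩, lt_of_le_of_ne (hi1.trans hi2) ?_, hagree⟩
  · have hF' : (insert n' (insert (n k) ({⟨0, 0⟩, ⟨1, 1⟩} : Finset Ref))).erase (n k) =
        insert (Function.update n (k + 1) n' (k + 1)) {⟨0, 0⟩, ⟨1, 1⟩} := by
      rw [Function.update_self, Finset.erase_insert_of_ne (eold k le_rfl).symm, Finset.erase_insert]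
      simp only [Finset.mem_insert, Finset.mem_singleton]
      rintro (h | h)
      · exact hn0 (congrArg Ref.addr h)
      · exact hn1 k le_rfl (congrArg Ref.addr h)
    have hK' : insert (n k, Val.ptr (some n') 1) (deletedChain n k) =
        deletedChain (Function.update n (k + 1) n') (k + 1) := by
      ext x
      simp only [deletedChain, Set.mem_insert_iff, Set.mem_ofPred_eq]
      constructor
      · rintro (rfl | ⟨j, hj, rfl⟩)
        · exact ⟨k, by omega, by rw [hne k le_rfl, Function.update_self]⟩
        · exact ⟨j, by omega, by rw [hne j hj.le, hne (j + 1) hj]⟩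
      · rintro ⟨j, hj, rfl⟩
        rcases Nat.lt_succ_iff_lt_or_eq.1 hj with hj | rfl
        · exact .inr ⟨j, hj, by rw [hne j hj.le, hne (j + 1) hj]⟩
        · exact .inl (by rw [hne j le_rfl, Function.update_self])
    rw [hF', hK'] at h2
    exact h2
  · rw [hne 0 (Nat.zero_le k), hρu]
  · rw [Function.update_self, x1]
  · rw [Function.update_self, x2 _ _ (.inl (by decide)), v4]
  · rw [Function.update_self, x2 _ _ (.inr ⟨e0, ek⟩), v5]
  · rw [x2 _ _ (.inl (by decide)), v6]
  · rw [x2 _ _ (.inr ⟨by decide, (hn1 k le_rfl).symm⟩), v7]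
  · intro j hj
    rcases Nat.lt_succ_iff_lt_or_eq.1 (Nat.lt_succ_of_le hj) with hj | rfl
    · rw [hne j (by omega)]; exact hn1 j (by omega)
    · rwa [Function.update_self]
  · rwa [Function.update_self]
  · intro j hj j' hj' hjj
    rcases Nat.lt_succ_iff_lt_or_eq.1 (Nat.lt_succ_of_le hj) with hj | rfl <;>
      rcases Nat.lt_succ_iff_lt_or_eq.1 (Nat.lt_succ_of_le hj') with hj' | rfl
    · rw [hne j (by omega), hne j' (by omega)] at hjj
      exact hinj j (by omega) j' (by omega) hjj
    · rw [hne j (by omega), Function.update_self] at hjj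
      exact absurd hjj (eold j (by omega))
    · rw [hne j' (by omega), Function.update_self] at hjj
      exact absurd hjj.symm (eold j' (by omega))
    · rfl
  · rintro rfl
    have := h.snap.mem
    rw [wordMem_congr hagree i le_rfl, h2.snap.mem] at this
    rw [this, w1] at x1
    exact eold k le_rfl (by simpa using x1)

/-- A thread that traverses a chain of deleted nodes uses all the pointers in it. -/
theorem At.valid_of_chain (htu : t ≠ u) {i k : ℕ} {req : SetOp × ℤ} {n : ℕ → Ref}
    {th : Thread (withHarris A pro epi).obj} {st : List ℕ} {ρ : Var → Val} {W : ℕ → ℕ → Val}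
    {F : Finset Ref}
    (h : At (withHarris A pro epi) s u req t th i (.body .contains 2) st ρ W F (deletedChain n k))
    (hρ : ρ 2 = .ptr (some (n 0)) 0) (hn : ∀ j ≤ k, (n j).addr ≠ 1) :
    ∀ j < k, ((withHarris A pro epi).conf s i).Valid (n j) := by
  have hread : ∀ (j : ℕ) (pc : ℕ) (ρ : Var → Val), j < k → pc = 3 ∨ pc = 13 →
      ρ 3 = .ptr (some (n j)) 0 → Arrives (withHarris A pro epi) s u req t th i
        (.body .contains pc) st ρ W F (deletedChain n k) →
      ((withHarris A pro epi).conf s i).Valid (n j) ∧ ∃ ρ' : Var → Val,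
        ρ' 4 = .ptr (some (n (j + 1))) 1 ∧ Arrives (withHarris A pro epi) s u req t th i
          (.body .contains 4) st ρ' W F (deletedChain n k) := by
    intro j pc ρ hj hpc h3 harr
    have huse : (4 : ℕ) ∈ ((withHarris A pro epi).prog.code 4).uses := by
      change 4 ∈ (Instr.jumpIf (Harris.isMarked Harris.vCurrNext) 7).uses
      simp [Instr.uses, Cond.uses, Harris.isMarked, Harris.vCurrNext]
    obtain ⟨-, hid, hW⟩ := h.snap.old _ ⟨j, hj, rfl⟩
    have hv : ((withHarris A pro epi).conf s i).Valid (n j) := by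
      obtain ⟨m, hm, hat⟩ := harr
      refine valid_antitone hm ?_ hid
      rcases hpc with rfl | rfl
      · exact hat.valid_of_read (d := 4) (p := 3) (f := 1) hI htu rfl h3 (.inl huse)
      · exact hat.valid_of_read (d := 4) (p := 3) (f := 1) hI htu rfl h3
          (.inr ⟨4, rfl, huse⟩)
    refine ⟨hv, Function.update ρ 4 (W (n j).addr 1), by rw [Function.update_self]; exact hW hv, ?_⟩
    rcases hpc with rfl | rfl
    · exact harr.read (d := 4) (p := 3) (f := 1) htu hI rfl h3
    · exact (harr.read (d := 4) (p := 3) (f := 1) htu hI rfl h3).goto htu rfl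
  have hreach : ∀ j < k, ∃ (pc : ℕ) (ρ : Var → Val), (pc = 3 ∨ pc = 13) ∧
      ρ 3 = .ptr (some (n j)) 0 ∧ Arrives (withHarris A pro epi) s u req t th i
        (.body .contains pc) st ρ W F (deletedChain n k) := by
    intro j
    induction j with
    | zero =>
      intro _
      exact ⟨3, _, .inl rfl, by rw [Function.update_self]; exact hρ,
        Arrives.move (d := 3) (x := 2) htu ⟨i, le_rfl, h⟩ rfl⟩
    | succ j ih =>
      intro hj
      obtain ⟨pc, ρ1, hpc, h3, harr⟩ := ih (by omega)
      obtain ⟨-, ρ2, h4, harr⟩ := hread j pc ρ1 (by omega) hpc h3 harr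
      have h5 := harr.jump htu rfl (by
        simp [Cond.eval, Harris.isMarked, Harris.vCurrNext, h4, Val.mark])
      have h6 := h5.jump htu rfl (by
        simp [Cond.eval, Harris.isMarked, Harris.vCurrNext, h4, Val.mark])
      have h7 := h6.setMark (d := 3) (x := 4) (k := 0) htu rfl
      have h8 := h7.global (d := 5) (g := 1) htu rfl
      refine ⟨13, _, .inr rfl, ?_, h8.noJump htu rfl ?_⟩
      · simp [h4, Val.setMark]
      · have htail : (withHarris A pro epi).prog.global 1 = .ptr (some ⟨1, 1⟩) 0 := rfl
        simp [Cond.eval, Harris.vCurr, Harris.vTmp, h4, Val.setMark, Val.same, htail,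
          hn (j + 1) hj.le]
  intro j hj
  obtain ⟨pc, ρ1, hpc, h3, harr⟩ := hreach j hj
  exact (hread j pc ρ1 hj hpc h3 harr).1

/-- None of the deleted nodes has been reclaimed: what the scheme has done so far must be safe also
in the execution in which the stalled thread goes on alone. -/
theorem Stalled.le_count (htu : t ≠ u) {k i : ℕ} (h : Stalled (withHarris A pro epi) t u k s i) :
    k ≤ ((withHarris A pro epi).conf s i).count .retired := by
  obtain ⟨n, req, ρu, regs, st, ρ, W, h, hρu, -, -, -, -, -, hn1, -, hinj⟩ := h
  have hvalid : ∀ j < k, ((withHarris A pro epi).conf s i).Valid (n j) := by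
    obtain ⟨regs', h'⟩ := h.switch (.contains, 0)
    rw [conf_congr (fun _ => thenSolo_eq s i u (.contains, 0)) i le_rfl]
    exact h'.valid_of_chain hI htu hρu hn1
  rw [← Finset.card_range k]
  refine Finset.card_le_card_of_injOn (fun j => (n j).addr) (fun j hj => ?_)
    fun j hj j' hj' hjj => ?_
  · have hj := Finset.mem_range.1 hj
    obtain ⟨h1, h2⟩ := hvalid j hj
    refine Finset.mem_filter.2 ⟨Finset.mem_range.2 ?_, ?_⟩
    · by_contra hb
      have h3 := h.snap.sane.beyond (n j).addr (not_lt.1 hb)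
      simp [h3] at h2
    · exact h2.resolve_left fun h3 =>
        (h.snap.old _ ⟨j, hj, rfl⟩).1 ((h.snap.active (n j)).1 ⟨h1, h3⟩)
  · have hj := Finset.mem_range.1 hj
    have hj' := Finset.mem_range.1 hj'
    have hjj : (n j).addr = (n j').addr := hjj
    refine hinj j hj.le j' hj'.le ?_
    have h1 := (hvalid j hj).1
    rw [hjj, (hvalid j' hj').1] at h1
    cases hnj : n j
    cases hnj' : n j'
    simp_all

/-- There is an execution with at most four active nodes at any time and with arbitrarily many
retired ones. -/
theorem exists_unbounded_retired (htu : t ≠ u) : ∃ s,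
    (∀ i, (withHarris A pro epi).maxActive s i ≤ 4) ∧
      ∀ k, ∃ i, k ≤ ((withHarris A pro epi).conf s i).count .retired := by
  let I := withHarris A pro epi
  let X := fun k => {p : Schedule N × ℕ // Stalled I t u k p.1 p.2}
  have hnext : ∀ k (x : X k), ∃ y : X (k + 1), x.1.2 < y.1.2 ∧ ∀ l < x.1.2, x.1.1 l = y.1.1 l := by
    rintro k ⟨⟨s, i⟩, h⟩
    obtain ⟨s', i', h1, h2⟩ := h.extend hI htu
    exact ⟨⟨⟨s', i'⟩, h1⟩, h2⟩
  obtain ⟨s₀, i₀, h₀⟩ := exists_stalled_zero hI htu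
  choose next hlt hagree using hnext
  let x : ∀ k, X k := fun k => Nat.rec ⟨(s₀, i₀), h₀⟩ next k
  have hx : ∀ k, x (k + 1) = next k (x k) := fun k => rfl
  have hle : ∀ k, k ≤ (x k).1.2 := by
    intro k
    induction k with
    | zero => exact Nat.zero_le _
    | succ k ih => rw [hx]; exact ih.trans_lt (hlt k (x k))
  have hmono : ∀ k k', k ≤ k' → (x k).1.2 ≤ (x k').1.2 ∧
      ∀ l < (x k).1.2, (x k).1.1 l = (x k').1.1 l := by
    intro k k' hk
    induction hk with
    | refl => exact ⟨le_rfl, fun _ _ => rfl⟩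
    | @step k' _ ih =>
      refine ⟨ih.1.trans (hlt k' (x k')).le, fun l hl => ?_⟩
      rw [ih.2 l hl, hagree k' (x k') l (hl.trans_le ih.1)]
  -- the limit of the schedules of the stages
  let s : Schedule N := fun l => (x (l + 1)).1.1 l
  have hs : ∀ k, ∀ l < (x k).1.2, (x k).1.1 l = s l := by
    intro k l hl
    rcases le_total k (l + 1) with h | h
    · exact (hmono _ _ h).2 l hl
    · exact ((hmono _ _ h).2 l (hle (l + 1))).symm
  refine ⟨s, fun i => Finset.sup_le fun l _ => ?_, fun k => ⟨(x k).1.2, ?_⟩⟩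
  · obtain ⟨n, req, ρu, regs, st, ρ, W, h, -⟩ := (x l).2
    rw [← conf_congr (hs l) l (hle l)]
    exact h.snap.bound l (hle l)
  · rw [← conf_congr (hs k) _ le_rfl]
    exact (x k).2.le_count hI htu

/-- No function of the number of active nodes bounds the number of retired nodes. -/
theorem exists_not_bounded (hN : 2 ≤ N) : ∃ s, ∀ g : ℕ → ℕ, ¬ ∀ i,
    ((withHarris A pro epi).conf s i).count .retired ≤
      g ((withHarris A pro epi).maxActive s i) * N := by
  obtain ⟨s, h1, h2⟩ := exists_unbounded_retired (t := ⟨0, by omega⟩) (u := ⟨1, by omega⟩) hI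
    (by simp)
  refine ⟨s, fun g hg => ?_⟩
  obtain ⟨i, hi⟩ := h2 ((Finset.range 5).sup g * N + 1)
  have h3 : g ((withHarris A pro epi).maxActive s i) ≤ (Finset.range 5).sup g :=
    Finset.le_sup (Finset.mem_range.2 (Nat.lt_succ_of_le (h1 i)))
  have := (hg i).trans (Nat.mul_le_mul_right N h3)
  omega

end Adversary

/-- A scheme that is easily integrated into Harris's list and applicable to it is well-behaved, as
the list guarantees progress with respect to isolating schedules. -/
theorem Scheme.exists_not_bounded {N : ℕ} (hN : 2 ≤ N) (S : Scheme N)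
    (h1 : S.EasilyIntegratedInto fun P => P = harris) (h2 : S.ApplicableTo harris) :
    ∃ s, ∀ g : ℕ → ℕ, ¬ ∀ i, ((S harris).conf s i).count .retired ≤
      g ((S harris).maxActive s i) * N := by
  obtain ⟨A, pro, epi, h⟩ := h1
  obtain ⟨h3, h4, h5, -⟩ := h harris rfl
  obtain ⟨h6, -, h7⟩ := h2
  have h8 := ((h7 .isolating).1 (harris_guaranteesMinimal (by omega))).1
  rw [h3] at h4 h5 h6 h8 ⊢
  exact ERA.exists_not_bounded ⟨h4, h5, h6, h8⟩ hN

end ERA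

theorem theorem1 (N : ℕ) (hN : 2 ≤ N) (S : ERA.Scheme N) :
    ¬ (S.Robust ∧ S.EasilyIntegrated ∧ S.WidelyApplicable) ∧
    ¬ (S.WeaklyRobust ∧ S.EasilyIntegrated ∧ S.ApplicableTo ERA.harris) ∧
    ¬ ((S ERA.harris).WeaklyRobust ∧ S.EasilyIntegratedInto (fun P => P = ERA.harris) ∧
        S.ApplicableTo ERA.harris) := by
  have hplain := ERA.harris_isPlain N
  have hinto : S.EasilyIntegrated → S.EasilyIntegratedInto (fun P => P = ERA.harris) := by
    rintro ⟨A, pro, epi, h⟩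
    exact ⟨A, pro, epi, fun P hP => h P (hP ▸ hplain)⟩
  have hweak : ¬ ((S ERA.harris).WeaklyRobust ∧
      S.EasilyIntegratedInto (fun P => P = ERA.harris) ∧ S.ApplicableTo ERA.harris) := by
    rintro ⟨h1, h2, h3⟩
    obtain ⟨s, hs⟩ := S.exists_not_bounded hN h2 h3
    obtain ⟨p, hp⟩ := h1 s
    exact hs (fun n => p.eval n) hp
  refine ⟨?_, fun ⟨h1, h2, h3⟩ => hweak ⟨h1 _ hplain, hinto h2, h3⟩, hweak⟩
  rintro ⟨h1, h2, h3⟩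
  obtain ⟨s, hs⟩ := S.exists_not_bounded hN (hinto h2) (h3 _ hplain (ERA.harris_accessAware N))
  obtain ⟨g, -, hg⟩ := h1 _ hplain s
  exact hs g hg
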